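/- Let $\Omega\subset\mathbb{C}^d$ be a bounded domain (a non-empty, connected, bounded open set), let $\mu$ be Lebesgue measure on $\Omega$, let $H^\infty(\Omega)$ be the algebra of bounded holomorphic functions on $\Omega$, with the weak* topology that it inherits from $L^\infty(\Omega,\mu)=L^1(\Omega,\mu)^*$, and let $L^2_a(\Omega)$ be the Bergman space of holomorphic functions on $\Omega$ that lie in $L^2(\Omega,\mu)$. Let $\mathcal{A}$ be a weak*-closed subalgebra of $H^\infty(\Omega)$ that contains the constants. For $f\in L^2_a(\Omega)$ and the measure $\nu=|f|^2\mu$, let $\mathcal{A}^2(\nu)$ be the closure of $\mathcal{A}$ in $L^2(\Omega,\nu)$. For $z\in\Omega$ such that $\phi\mapsto\phi(z)$ $(\phi\in\mathcal{A})$ extends to a continuous linear functional on $\mathcal{A}^2(\nu)$, let $k^\nu_z\in\mathcal{A}^2(\nu)$ be the reproducing kernel at $z$, i.e. the unique element of $\mathcal{A}^2(\nu)$ with $\phi(z)=\langle\phi,k^\nu_z\rangle_{L^2(\nu)}$ for all $\phi\in\mathcal{A}$; for all other $z\in\Omega$ put $k^\nu_z=0$. Let $k^\nu(x,y)=\langle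 k^\nu_y,k^\nu_x\rangle_{L^2(\nu)}$. Let $z_1,\dots,z_n\in\Omega$ and $w_1,\dots,w_n\in\mathbb{C}$. Then there is a function $\phi\in\mathcal{A}$ with $\sup_{z\in\Omega}|\phi(z)|\le 1$ and $\phi(z_i)=w_i$ for $i=1,\dots,n$ if and only if the matrix \[ \bigl[(1-w_i\overline{w_j})\,k^\nu(z_i,z_j)\bigr]_{i,j=1}^n \] is positive semidefinite for every measure of the form $\nu=|f|^2\mu$ with $f\in L^2_a(\Omega)$. -/

import Mathlib

open MeasureTheory
open scoped ENNReal ComplexConjugate ComplexOrder Topology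

noncomputable section

namespace BergmanPick

/-- A function given on a set `Ω ⊆ ℂ^d` is holomorphic. Only the values on `Ω` matter; for open `Ω`
this is complex differentiability at every point of `Ω`. -/
def Holo {d : ℕ} (Ω : Set (Fin d → ℂ)) (φ : Ω → ℂ) : Prop :=
  ∃ F : (Fin d → ℂ) → ℂ, DifferentiableOn ℂ F Ω ∧ ∀ z : Ω, F z = φ z

/-- `H^∞(Ω)`: the unital algebra of bounded holomorphic functions on `Ω`. -/
def HInfty {d : ℕ} (Ω : Set (Fin d → ℂ)) : Subalgebra ℂ (Ω → ℂ) where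
  carrier := {φ | Holo Ω φ ∧ ∃ C : ℝ, ∀ z, ‖φ z‖ ≤ C}
  mul_mem' := by
    rintro φ ψ ⟨⟨F, hF, hFφ⟩, C, hC⟩ ⟨⟨G, hG, hGψ⟩, D, hD⟩
    refine ⟨⟨F * G, hF.mul hG, fun z => by simp [hFφ, hGψ]⟩, C * D, fun z => ?_⟩
    rw [Pi.mul_apply, norm_mul]
    exact mul_le_mul (hC z) (hD z) (norm_nonneg _) ((norm_nonneg _).trans (hC z))
  add_mem' := by
    rintro φ ψ ⟨⟨F, hF, hFφ⟩, C, hC⟩ ⟨⟨G, hG, hGψ⟩, D, hD⟩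
    exact ⟨⟨F + G, hF.add hG, fun z => by simp [hFφ, hGψ]⟩, C + D,
      fun z => (norm_add_le _ _).trans (add_le_add (hC z) (hD z))⟩
  algebraMap_mem' := fun c =>
    ⟨⟨fun _ => c, differentiableOn_const c, fun _ => rfl⟩, ‖c‖, fun _ => le_rfl⟩

/-- Lebesgue measure `μ` on the measurable set `Ω ⊆ ℂ^d`. -/
def leb {d : ℕ} (Ω : Set (Fin d → ℂ)) : Measure Ω :=
  Measure.comap Subtype.val volume

/-- The weak* topology of `H^∞(Ω) ⊆ L^∞(Ω) = L^1(Ω)*`: the coarsest topology for which all the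
functionals `φ ↦ ∫_Ω φ h dμ`, `h ∈ L^1(Ω, μ)`, are continuous (`μ` is Lebesgue measure on `Ω`). -/
@[reducible]
def weakStar {d : ℕ} (Ω : Set (Fin d → ℂ)) : TopologicalSpace (HInfty Ω) :=
  TopologicalSpace.induced
    (fun (φ : HInfty Ω) (h : Lp ℂ 1 (leb Ω)) => ∫ z, (φ : Ω → ℂ) z * h z ∂(leb Ω))
    Pi.topologicalSpace

/-- `f` belongs to the Bergman space `L²_a(Ω)`. -/
def MemBergman {d : ℕ} (Ω : Set (Fin d → ℂ)) (f : Ω → ℂ) : Prop :=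
  Holo Ω f ∧ MemLp f 2 (leb Ω)

/-- The measure `|f|² μ` on `Ω`, where `μ` is Lebesgue measure. -/
def sqMeasure {d : ℕ} {Ω : Set (Fin d → ℂ)} (f : Ω → ℂ) : Measure Ω :=
  (leb Ω).withDensity fun z => ‖f z‖ₑ ^ 2

/-- The classes in `L²(Ω, ν)` of the functions in `A`. -/
def classes {d : ℕ} {Ω : Set (Fin d → ℂ)} (A : Subalgebra ℂ (HInfty Ω)) (ν : Measure Ω) :
    Submodule ℂ (Lp ℂ 2 ν) where
  carrier := {g | ∃ φ ∈ A, ⇑g =ᵐ[ν] (φ : Ω → ℂ)}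
  zero_mem' := ⟨0, A.zero_mem, Lp.coeFn_zero ℂ 2 ν⟩
  add_mem' := by
    rintro g h ⟨φ, hφ, hg⟩ ⟨ψ, hψ, hh⟩
    exact ⟨φ + ψ, A.add_mem hφ hψ, (Lp.coeFn_add g h).trans (hg.add hh)⟩
  smul_mem' := by
    rintro c g ⟨φ, hφ, hg⟩
    exact ⟨c • φ, A.smul_mem hφ c, (Lp.coeFn_smul c g).trans (hg.const_smul c)⟩

/-- `A²(ν)`: the closure of `A` in `L²(Ω, ν)`. -/
def A2 {d : ℕ} {Ω : Set (Fin d → ℂ)} (A : Subalgebra ℂ (HInfty Ω)) (ν : Measure Ω) :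
    Submodule ℂ (Lp ℂ 2 ν) :=
  (classes A ν).topologicalClosure

/-- `k ∈ A²(ν)` reproduces the evaluation at `z`: `φ(z) = ⟨φ, k⟩` for all `φ ∈ A`. (Mathlib's inner
product is linear in the second variable.) There is at most one such `k`, since `A` is dense in
`A²(ν)`, and there is one exactly when evaluation at `z` extends to a continuous functional on
`A²(ν)`, that is, when `ν` is dominating for `z`. -/
def Reproduces {d : ℕ} {Ω : Set (Fin d → ℂ)} (A : Subalgebra ℂ (HInfty Ω)) (ν : Measure Ω)
    (z : Ω) (k : Lp ℂ 2 ν) : Prop :=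
  k ∈ A2 A ν ∧ ∀ φ ∈ A, ∀ g : Lp ℂ 2 ν, ⇑g =ᵐ[ν] (φ : Ω → ℂ) → inner ℂ k g = (φ : Ω → ℂ) z

open Classical in
/-- The kernel vector `k_z^ν ∈ A²(ν)`; it is `0` at the points `z` whose evaluation is not
continuous on `A²(ν)`. -/
def kernelAt {d : ℕ} {Ω : Set (Fin d → ℂ)} (A : Subalgebra ℂ (HInfty Ω)) (ν : Measure Ω)
    (z : Ω) : Lp ℂ 2 ν :=
  if h : ∃ k, Reproduces A ν z k then h.choose else 0

/-- The kernel function `k^ν(x, y) = ⟨k_y^ν, k_x^ν⟩`, in the convention where the inner product is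
linear in the first variable. -/
def kernel {d : ℕ} {Ω : Set (Fin d → ℂ)} (A : Subalgebra ℂ (HInfty Ω)) (ν : Measure Ω)
    (x y : Ω) : ℂ :=
  inner ℂ (kernelAt A ν x) (kernelAt A ν y)

end BergmanPick

end

noncomputable section

namespace BergmanPick

open Metric Filter

/-- Quantitative second order Taylor estimate for bounded holomorphic functions on a ball. -/
theorem norm_sub_sub_fderiv_le {E : Type*} [NormedAddCommGroup E] [NormedSpace ℂ E] {f : E → ℂ}
    {c z : E} {R M : ℝ} (hR : 0 < R) (hd : DifferentiableOn ℂ f (ball c R))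
    (hM : ∀ x ∈ ball c R, ‖f x‖ ≤ M) (hz : z ∈ ball c R) :
    ‖f z - f c - fderiv ℂ f c (z - c)‖ ≤ 4 * M * (‖z - c‖ / R) ^ 2 := by
  have hc : c ∈ ball c R := mem_ball_self hR
  have hmaps : Set.MapsTo f (ball c R) (closedBall (f c) (2 * M)) := fun x hx => by
    rw [mem_closedBall_iff_norm]
    linarith [norm_sub_le (f x) (f c), hM x hx, hM c hc]
  have hD : ‖fderiv ℂ f c‖ ≤ 2 * M / R := Complex.norm_fderiv_le_div_of_mapsTo_ball hd hmaps hR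
  have hM0 : 0 ≤ M := (norm_nonneg _).trans (hM c hc)
  have hfc : HasFDerivAt f (fderiv ℂ f c) c :=
    (hd.differentiableAt (ball_mem_nhds c hR)).hasFDerivAt
  set h : E → ℂ := fun x => f x - fderiv ℂ f c (x - c) with hh
  have hhc : h c = f c := by simp [hh]
  have key := Complex.dist_le_mul_div_pow_of_mapsTo_ball_of_isLittleO (f := h) (c := c) (z := z)
    (R₁ := R) (R₂ := 4 * M) (n := 1) ?_ ?_ ?_ hz
  · rw [hhc, dist_eq_norm, dist_eq_norm] at key
    have h3 : h z - f c = f z - f c - fderiv ℂ f c (z - c) := by simp only [hh]; ring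
    rwa [h3] at key
  · exact hd.sub (((fderiv ℂ f c).differentiable.comp
      (differentiable_id.sub_const c)).differentiableOn)
  · intro x hx
    rw [hhc, mem_closedBall_iff_norm]
    have h1 : ‖fderiv ℂ f c (x - c)‖ ≤ 2 * M := by
      refine ((fderiv ℂ f c).le_opNorm _).trans ?_
      have hx' : ‖x - c‖ ≤ R := (mem_ball_iff_norm.1 hx).le
      calc _ ≤ 2 * M / R * R := by gcongr
        _ = 2 * M := by field_simp
    have h2 := mem_closedBall_iff_norm.1 (hmaps hx)
    calc ‖h x - f c‖ = ‖(f x - f c) - fderiv ℂ f c (x - c)‖ := by simp only [hh]; ring_nf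
      _ ≤ ‖f x - f c‖ + ‖fderiv ℂ f c (x - c)‖ := norm_sub_le _ _
      _ ≤ 4 * M := by linarith
  · have := hfc.isLittleO
    rw [hhc]
    simp only [pow_one]
    refine (this.norm_right).congr (fun x => ?_) (fun x => rfl)
    simp only [hh]; ring

/-- A uniformly bounded family of holomorphic functions is holomorphic as a map into the space of
bounded functions on the index set. -/
theorem differentiableAt_family {E ι : Type*} [NormedAddCommGroup E] [NormedSpace ℂ E]
    [TopologicalSpace ι] [DiscreteTopology ι] {F : ι → E → ℂ}
    {Φ : E → BoundedContinuousFunction ι ℂ}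
    {c : E} {R M : ℝ} (hR : 0 < R) (hd : ∀ i, DifferentiableOn ℂ (F i) (ball c R))
    (hM : ∀ i, ∀ x ∈ ball c R, ‖F i x‖ ≤ M) (hΦ : ∀ x ∈ ball c R, ∀ i, Φ x i = F i x) :
    DifferentiableAt ℂ Φ c := by
  rcases isEmpty_or_nonempty ι with hι | ⟨⟨i₀⟩⟩
  · have : Φ = fun _ => 0 := by
      funext x; ext i; exact isEmptyElim i
    rw [this]; exact differentiableAt_const _
  have hc : c ∈ ball c R := mem_ball_self hR
  have hM0 : 0 ≤ M := (norm_nonneg _).trans (hM i₀ c hc)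
  have hD : ∀ i, ‖fderiv ℂ (F i) c‖ ≤ 2 * M / R := fun i =>
    Complex.norm_fderiv_le_div_of_mapsTo_ball (hd i) (fun x hx => by
      rw [mem_closedBall_iff_norm]
      linarith [norm_sub_le (F i x) (F i c), hM i x hx, hM i c hc]) hR
  have hDv : ∀ v i, ‖fderiv ℂ (F i) c v‖ ≤ 2 * M / R * ‖v‖ := fun v i =>
    ((fderiv ℂ (F i) c).le_opNorm v).trans (by gcongr; exact hD i)
  let D : E →L[ℂ] BoundedContinuousFunction ι ℂ := LinearMap.mkContinuous
    { toFun := fun v => BoundedContinuousFunction.ofNormedAddCommGroupDiscrete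
        (fun i => fderiv ℂ (F i) c v) _ (hDv v)
      map_add' := fun v w => by ext i; simp
      map_smul' := fun a v => by ext i; simp } (2 * M / R) (fun v => by
        refine BoundedContinuousFunction.norm_ofNormedAddCommGroup_le _ (by positivity) (hDv v))
  refine ⟨D, ?_⟩
  rw [hasFDerivAt_iff_isLittleO]
  have hO : (fun x => Φ x - Φ c - D (x - c)) =O[𝓝 c] fun x => ‖x - c‖ ^ 2 := by
    refine Asymptotics.IsBigO.of_bound (4 * M / R ^ 2) ?_
    filter_upwards [ball_mem_nhds c hR] with x hx
    rw [BoundedContinuousFunction.norm_le (by positivity)]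
    intro i
    have := norm_sub_sub_fderiv_le hR (hd i) (hM i) hx
    simp only [norm_pow, norm_norm]
    calc _ = ‖F i x - F i c - fderiv ℂ (F i) c (x - c)‖ := by
          rw [← hΦ x hx, ← hΦ c hc]; rfl
      _ ≤ _ := this
      _ = _ := by rw [div_pow]; ring
  refine hO.trans_isLittleO ?_
  have h0 : Tendsto (fun x => ‖x - c‖) (𝓝 c) (𝓝 0) := by
    have : Tendsto (fun x => ‖x - c‖) (𝓝 c) (𝓝 ‖c - c‖) := Continuous.tendsto (by fun_prop) c
    simpa using this
  have h1 : (fun x : E => ‖x - c‖ * ‖x - c‖) =o[𝓝 c] fun x => 1 * ‖x - c‖ :=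
    ((Asymptotics.isLittleO_one_iff ℝ).2 h0).mul_isBigO (Asymptotics.isBigO_refl _ _)
  simp only [one_mul, ← pow_two] at h1
  exact h1.of_norm_right

theorem measurePreserving_smul_pi {d : ℕ} (u : Circle) :
    MeasurePreserving (fun v : Fin d → ℂ => (u : ℂ) • v) volume volume := by
  have := volume_preserving_pi (fun _ : Fin d => (rotation u).measurePreserving)
  have h2 : (fun v : Fin d → ℂ => (u : ℂ) • v) = fun a i => rotation u (a i) := by
    funext v i; simp [rotation_apply]
  rw [h2]; exact this

/-- Sub-mean value property of holomorphic functions on polydiscs. -/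
theorem enorm_mul_volume_ball_le {d : ℕ} {f : (Fin d → ℂ) → ℂ} {z : Fin d → ℂ} {r : ℝ}
    (hd : DifferentiableOn ℂ f (ball z r)) :
    ‖f z‖ₑ * volume (ball z r) ≤ ∫⁻ x in ball z r, ‖f x‖ₑ := by
  set h : (Fin d → ℂ) → ℝ≥0∞ := (ball 0 r).indicator fun v => ‖f (z + v)‖ₑ with hh
  have hdz : DifferentiableOn ℂ (fun v => f (z + v)) (ball 0 r) := by
    refine hd.comp (by fun_prop) fun v hv => ?_
    simpa [mem_ball_iff_norm] using hv
  have hmeas : Measurable h := by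
    classical
    have : Measurable ((ball (0 : Fin d → ℂ) r).piecewise (fun v => f (z + v)) 0) :=
      hdz.continuousOn.measurable_piecewise continuousOn_const measurableSet_ball
    have h2 : h = fun v => ‖(ball (0 : Fin d → ℂ) r).piecewise (fun v => f (z + v)) 0 v‖ₑ := by
      funext v
      by_cases hv : v ∈ ball (0 : Fin d → ℂ) r <;> simp [hh, hv, Set.piecewise]
    rw [h2]; exact this.enorm
  have hrot : ∀ θ : ℝ, ∫⁻ v, h ((Circle.exp θ : ℂ) • v) = ∫⁻ v, h v := fun θ =>
    (measurePreserving_smul_pi (Circle.exp θ)).lintegral_comp hmeas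
  have hpt : ∀ v, ‖f z‖ₑ * (ball (0 : Fin d → ℂ) r).indicator 1 v ≤
      (ENNReal.ofReal (2 * Real.pi))⁻¹ *
        ∫⁻ θ in Set.Ioc 0 (2 * Real.pi), h ((Circle.exp θ : ℂ) • v) := by
    intro v
    by_cases hv : v ∈ ball (0 : Fin d → ℂ) r
    · have hv' : ‖v‖ < r := by simpa using hv
      have hsm : ∀ θ : ℝ, (Circle.exp θ : ℂ) • v ∈ ball (0 : Fin d → ℂ) r := fun θ => by
        simpa [norm_smul] using hv'
      have havg : Real.circleAverage (fun t : ℂ => f (z + t • v)) 0 1 = f z := by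
        have hmap : ∀ t ∈ closedBall (0 : ℂ) 1, t • v ∈ ball (0 : Fin d → ℂ) r := by
          intro t ht
          rw [mem_closedBall_zero_iff] at ht
          rw [mem_ball_zero_iff, norm_smul]
          exact lt_of_le_of_lt (mul_le_of_le_one_left (norm_nonneg _) ht) hv'
        have hdc : DiffContOnCl ℂ (fun t : ℂ => f (z + t • v)) (ball 0 |1|) := by
          rw [abs_one]
          have : DifferentiableOn ℂ (fun t : ℂ => f (z + t • v)) (closedBall 0 1) :=
            hdz.comp (f := fun t : ℂ => t • v) (by fun_prop) hmap
          refine DifferentiableOn.diffContOnCl (this.mono closure_ball_subset_closedBall)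
        have := hdc.circleAverage
        simpa using this
      have hle : ‖f z‖ₑ ≤ (ENNReal.ofReal (2 * Real.pi))⁻¹ *
          ∫⁻ θ in Set.Ioc 0 (2 * Real.pi), ‖f (z + (Circle.exp θ : ℂ) • v)‖ₑ := by
        rw [← havg, Real.circleAverage, enorm_smul, intervalIntegral.integral_of_le
          Real.two_pi_pos.le]
        have h1 : ‖(2 * Real.pi)⁻¹‖ₑ = (ENNReal.ofReal (2 * Real.pi))⁻¹ := by
          rw [Real.enorm_eq_ofReal (by positivity), ENNReal.ofReal_inv_of_pos (by positivity)]
        rw [h1]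
        gcongr
        refine (enorm_integral_le_lintegral_enorm _).trans_eq ?_
        refine lintegral_congr fun θ => ?_
        simp [circleMap, Circle.coe_exp]
      simp only [hv, Set.indicator_of_mem, Pi.one_apply, mul_one]
      refine hle.trans_eq ?_
      congr 1
      refine lintegral_congr fun θ => ?_
      simp only [hh, Set.indicator_of_mem (hsm θ)]
    · simp [hv]
  have hpi : ENNReal.ofReal (2 * Real.pi) ≠ 0 := by
    simp [Real.pi_pos]
  have hvol : volume (ball z r) = volume (ball (0 : Fin d → ℂ) r) :=
    Measure.addHaar_ball_center _ _ _
  calc ‖f z‖ₑ * volume (ball z r)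
      = ∫⁻ v, ‖f z‖ₑ * (ball (0 : Fin d → ℂ) r).indicator 1 v := by
        rw [lintegral_const_mul _ (measurable_one.indicator measurableSet_ball),
          lintegral_indicator_one measurableSet_ball, hvol]
    _ ≤ ∫⁻ v, (ENNReal.ofReal (2 * Real.pi))⁻¹ *
        ∫⁻ θ in Set.Ioc 0 (2 * Real.pi), h ((Circle.exp θ : ℂ) • v) := lintegral_mono hpt
    _ = (ENNReal.ofReal (2 * Real.pi))⁻¹ *
        ∫⁻ v, ∫⁻ θ in Set.Ioc 0 (2 * Real.pi), h ((Circle.exp θ : ℂ) • v) := by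
        rw [lintegral_const_mul']
        simpa using hpi
    _ = (ENNReal.ofReal (2 * Real.pi))⁻¹ *
        ∫⁻ θ in Set.Ioc 0 (2 * Real.pi), ∫⁻ v, h ((Circle.exp θ : ℂ) • v) := by
        rw [lintegral_lintegral_swap]
        refine Measurable.aemeasurable (hmeas.comp ?_)
        have : Continuous fun p : (Fin d → ℂ) × ℝ => (Circle.exp p.2 : ℂ) • p.1 := by
          fun_prop
        exact this.measurable
    _ = ∫⁻ v, h v := by
        simp only [hrot, lintegral_const, Measure.restrict_apply, MeasurableSet.univ,
          Set.univ_inter, Real.volume_Ioc, sub_zero]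
        rw [mul_comm (∫⁻ v, h v), ← mul_assoc, ENNReal.inv_mul_cancel hpi ENNReal.ofReal_ne_top,
          one_mul]
    _ = ∫⁻ x in ball z r, ‖f x‖ₑ := by
        rw [hh, lintegral_indicator measurableSet_ball]
        have hmp := (measurePreserving_add_left (volume : Measure (Fin d → ℂ)) z)
        have := hmp.setLIntegral_comp_preimage_emb (measurableEmbedding_addLeft z)
          (fun x => ‖f x‖ₑ) (ball z r)
        rw [← this]
        congr 2
        ext v; simp

theorem differentiableAt_of_tendstoUniformlyOn_ball {E : Type*} [NormedAddCommGroup E]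
    [NormedSpace ℂ E] {F : ℕ → E → ℂ} {g : E → ℂ} {c : E} {R : ℝ} (hR : 0 < R)
    (hd : ∀ n, DifferentiableOn ℂ (F n) (ball c R))
    (h : TendstoUniformlyOn F g atTop (ball c R)) : DifferentiableAt ℂ g c := by
  have hsub : ∀ x ∈ ball c (R / 2), ball x (R / 2) ⊆ ball c R := fun x hx =>
    ball_subset_ball' (by rw [mem_ball] at hx; linarith)
  have hC : UniformCauchySeqOn (fun n => fderiv ℂ (F n)) atTop (ball c (R / 2)) := by
    rw [Metric.uniformCauchySeqOn_iff]
    intro ε hε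
    obtain ⟨N, hN⟩ := Metric.uniformCauchySeqOn_iff.1 h.uniformCauchySeqOn (ε * R / 8)
      (by positivity)
    refine ⟨N, fun m hm n hn x hx => ?_⟩
    have hxR : ball x (R / 2) ∈ 𝓝 x := ball_mem_nhds x (by positivity)
    have hdm := (hd m).mono (hsub x hx)
    have hdn := (hd n).mono (hsub x hx)
    have key := Complex.norm_fderiv_le_div_of_mapsTo_ball (f := fun y => F m y - F n y) (c := x)
      (R₁ := R / 2) (R₂ := 2 * (ε * R / 8)) (hdm.sub hdn) (fun y hy => by
        rw [mem_closedBall_iff_norm]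
        have h1 := hN m hm n hn y (hsub x hx hy)
        have h2 := hN m hm n hn x (hsub x hx (mem_ball_self (by positivity)))
        rw [dist_eq_norm] at h1 h2
        linarith [norm_sub_le (F m y - F n y) (F m x - F n x)]) (by positivity)
    rw [fderiv_fun_sub (hdm.differentiableAt hxR) (hdn.differentiableAt hxR)] at key
    rw [dist_eq_norm]
    calc _ ≤ _ := key
      _ = ε / 2 := by field_simp; norm_num
      _ < ε := by linarith
  have hex : ∀ x ∈ ball c (R / 2), ∃ D, Tendsto (fun n => fderiv ℂ (F n) x) atTop (𝓝 D) :=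
    fun x hx => cauchySeq_tendsto_of_complete (hC.cauchySeq hx)
  choose! g' hg' using hex
  have hunif := hC.tendstoUniformlyOn_of_tendsto hg'
  exact (hasFDerivAt_of_tendstoUniformlyOn isOpen_ball hunif (fun n x hx =>
    (((hd n).mono (hsub x hx)).differentiableAt
      (ball_mem_nhds x (by positivity))).hasFDerivAt)
    (fun x hx => h.tendsto_at (ball_subset_ball (by linarith) hx))
    (mem_ball_self (by positivity))).differentiableAt

section Holo

variable {d : ℕ} {Ω : Set (Fin d → ℂ)} {φ ψ : Ω → ℂ}

theorem Holo.continuous (h : Holo Ω φ) : Continuous φ := by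
  obtain ⟨F, hF, hFφ⟩ := h
  have : φ = Ω.domRestrict F := by funext z; exact (hFφ z).symm
  rw [this]
  exact hF.continuousOn.domRestrict

theorem Holo.add (h : Holo Ω φ) (h' : Holo Ω ψ) : Holo Ω (φ + ψ) := by
  obtain ⟨F, hF, hFφ⟩ := h
  obtain ⟨G, hG, hGψ⟩ := h'
  exact ⟨F + G, hF.add hG, fun z => by simp [hFφ, hGψ]⟩

theorem Holo.const_smul (c : ℂ) (h : Holo Ω φ) : Holo Ω (c • φ) := by
  obtain ⟨F, hF, hFφ⟩ := h
  exact ⟨c • F, hF.const_smul c, fun z => by simp [hFφ]⟩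

theorem Holo.cexp (h : Holo Ω φ) : Holo Ω fun z => Complex.exp (φ z) := by
  obtain ⟨F, hF, hFφ⟩ := h
  exact ⟨fun z => Complex.exp (F z), hF.cexp, fun z => by simp [hFφ]⟩

theorem holo_const (c : ℂ) : Holo Ω fun _ => c :=
  ⟨fun _ => c, differentiableOn_const c, fun _ => rfl⟩

theorem holo_coord (i : Fin d) : Holo Ω fun z => (z : Fin d → ℂ) i :=
  ⟨fun z => z i, by fun_prop, fun _ => rfl⟩

end Holo

section Leb

variable {d : ℕ} {Ω : Set (Fin d → ℂ)}

theorem leb_apply (hΩ : IsOpen Ω) (s : Set Ω) : leb Ω s = volume (Subtype.val '' s) :=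
  (MeasurableEmbedding.subtype_coe hΩ.measurableSet).comap_apply _ _

theorem isFiniteMeasure_leb (hΩ : IsOpen Ω) (hb : Bornology.IsBounded Ω) :
    IsFiniteMeasure (leb Ω) :=
  ⟨by
    rw [leb_apply hΩ]
    exact (measure_mono (by simp)).trans_lt (hb.measure_lt_top (μ := volume))⟩

theorem isOpenPosMeasure_leb (hΩ : IsOpen Ω) : (leb Ω).IsOpenPosMeasure :=
  ⟨fun U hU hne => by
    rw [leb_apply hΩ]
    exact ((hΩ.isOpenMap_subtype_val U hU).measure_pos volume (hne.image _)).ne'⟩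

theorem setLIntegral_eq_leb (hΩ : IsOpen Ω) {s : Set (Fin d → ℂ)} (hs : MeasurableSet s)
    (hsub : s ⊆ Ω) (F : (Fin d → ℂ) → ℝ≥0∞) :
    ∫⁻ x in s, F x = ∫⁻ x in Subtype.val ⁻¹' s, F (x : Fin d → ℂ) ∂(leb Ω) := by
  have he := MeasurableEmbedding.subtype_coe hΩ.measurableSet
  have hmap : (leb Ω).map Subtype.val = volume.restrict Ω := by
    rw [leb, he.map_comap, Subtype.range_coe]
  rw [← he.lintegral_map, ← he.restrict_map, hmap, Measure.restrict_restrict hs,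
    Set.inter_eq_left.2 hsub]

/-- Point evaluations on the Bergman space are locally uniformly bounded. -/
theorem exists_norm_le_mul_eLpNorm (hΩ : IsOpen Ω) (hb : Bornology.IsBounded Ω)
    {z : Fin d → ℂ} (hz : z ∈ Ω) : ∃ r > 0, ball z r ⊆ Ω ∧ ∃ C : ℝ, 0 ≤ C ∧
      ∀ f : Ω → ℂ, MemBergman Ω f → ∀ x : Ω, (x : Fin d → ℂ) ∈ ball z r →
        ‖f x‖ ≤ C * (eLpNorm f 2 (leb Ω)).toReal := by
  have := isFiniteMeasure_leb hΩ hb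
  obtain ⟨r, hr, hrΩ⟩ := Metric.isOpen_iff.1 hΩ z hz
  refine ⟨r / 2, by positivity, (ball_subset_ball (by linarith)).trans hrΩ, ?_⟩
  set V : ℝ≥0∞ := volume (ball z (r / 2)) with hV
  have hV0 : V ≠ 0 := (measure_ball_pos _ _ (by positivity)).ne'
  have hVt : V ≠ ∞ := measure_ball_lt_top.ne
  set M : ℝ≥0∞ := leb Ω Set.univ ^ (1 / (1 : ℝ≥0∞).toReal - 1 / (2 : ℝ≥0∞).toReal) with hM
  have hMt : M ≠ ∞ := ENNReal.rpow_ne_top_of_nonneg (by norm_num) (measure_ne_top _ _)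
  refine ⟨(V⁻¹ * M).toReal, ENNReal.toReal_nonneg, fun f hf x hx => ?_⟩
  obtain ⟨⟨F, hF, hFf⟩, hfL⟩ := hf
  have hsub : ball (x : Fin d → ℂ) (r / 2) ⊆ Ω :=
    (ball_subset_ball' (by rw [mem_ball] at hx; linarith)).trans hrΩ
  have h1 := enorm_mul_volume_ball_le (hF.mono hsub)
  rw [setLIntegral_eq_leb hΩ measurableSet_ball hsub, Measure.addHaar_ball_center,
    ← Measure.addHaar_ball_center volume z, ← hV, hFf] at h1
  have h2 : ‖f x‖ₑ * V ≤ eLpNorm f 2 (leb Ω) * M := by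
    refine h1.trans ((setLIntegral_le_lintegral _ _).trans ?_)
    simp only [hFf]
    rw [← eLpNorm_one_eq_lintegral_enorm]
    exact eLpNorm_le_eLpNorm_mul_rpow_measure_univ (by norm_num) hfL.1
  have h3 : ‖f x‖ₑ ≤ V⁻¹ * M * eLpNorm f 2 (leb Ω) := by
    calc ‖f x‖ₑ = V⁻¹ * (‖f x‖ₑ * V) := by
          rw [mul_comm ‖f x‖ₑ, ← mul_assoc, ENNReal.inv_mul_cancel hV0 hVt, one_mul]
      _ ≤ V⁻¹ * (eLpNorm f 2 (leb Ω) * M) := by gcongr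
      _ = _ := by ring
  have h4 := ENNReal.toReal_mono (ENNReal.mul_ne_top
    (ENNReal.mul_ne_top (ENNReal.inv_ne_top.2 hV0) hMt) hfL.2.ne) h3
  rwa [ENNReal.toReal_mul, toReal_enorm] at h4

/-- The Bergman space as a subspace of `L²`. -/
def Berg (Ω : Set (Fin d → ℂ)) : Submodule ℂ (Lp ℂ 2 (leb Ω)) where
  carrier := {u | ∃ f, Holo Ω f ∧ ⇑u =ᵐ[leb Ω] f}
  zero_mem' := ⟨_, holo_const 0, Lp.coeFn_zero ℂ 2 _⟩
  add_mem' := by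
    rintro u v ⟨f, hf, hu⟩ ⟨g, hg, hv⟩
    exact ⟨f + g, hf.add hg, (Lp.coeFn_add u v).trans (hu.add hv)⟩
  smul_mem' := by
    rintro c u ⟨f, hf, hu⟩
    exact ⟨c • f, hf.const_smul c, (Lp.coeFn_smul c u).trans (hu.const_smul c)⟩

theorem memBergman_of_ae {u : Lp ℂ 2 (leb Ω)} {f : Ω → ℂ} (hf : Holo Ω f)
    (hu : ⇑u =ᵐ[leb Ω] f) : MemBergman Ω f :=
  ⟨hf, (memLp_congr_ae hu).1 (Lp.memLp u)⟩

theorem isClosed_berg (hΩ : IsOpen Ω) (hb : Bornology.IsBounded Ω) :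
    IsClosed (Berg Ω : Set (Lp ℂ 2 (leb Ω))) := by
  have := isFiniteMeasure_leb hΩ hb
  refine IsSeqClosed.isClosed fun u v hu huv => ?_
  choose f hf huf using hu
  choose F hF hFf using hf
  have hloc : ∀ z ∈ Ω, ∃ r > 0, ball z r ⊆ Ω ∧ UniformCauchySeqOn F atTop (ball z r) := by
    intro z hz
    obtain ⟨r, hr, hrΩ, C, hC, hbd⟩ := exists_norm_le_mul_eLpNorm hΩ hb hz
    refine ⟨r, hr, hrΩ, ?_⟩
    rw [Metric.uniformCauchySeqOn_iff]
    intro ε hε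
    obtain ⟨N, hN⟩ := Metric.cauchySeq_iff.1 huv.cauchySeq (ε / (C + 1)) (by positivity)
    refine ⟨N, fun m hm n hn x hx => ?_⟩
    have hmem : MemBergman Ω (f m - f n) := by
      refine memBergman_of_ae (u := u m - u n) ?_ ((Lp.coeFn_sub _ _).trans ((huf m).sub (huf n)))
      exact ⟨F m - F n, (hF m).sub (hF n), fun z => by simp [hFf]⟩
    have h1 := hbd _ hmem ⟨x, hrΩ hx⟩ hx
    have h2 : (eLpNorm (f m - f n) 2 (leb Ω)).toReal = dist (u m) (u n) := by
      rw [dist_eq_norm, Lp.norm_def]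
      congr 1
      exact eLpNorm_congr_ae (((Lp.coeFn_sub _ _).trans ((huf m).sub (huf n))).symm)
    rw [h2] at h1
    rw [dist_eq_norm]
    have h3 : F m x - F n x = (f m - f n) ⟨x, hrΩ hx⟩ := by simp [← hFf]
    rw [h3]
    calc _ ≤ _ := h1
      _ ≤ (C + 1) * dist (u m) (u n) := by gcongr; linarith
      _ < (C + 1) * (ε / (C + 1)) := by gcongr; exact hN m hm n hn
      _ = ε := by field_simp
  have hlim : ∀ z ∈ Ω, ∃ y, Tendsto (fun n => F n z) atTop (𝓝 y) := fun z hz => by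
    obtain ⟨r, hr, -, hc⟩ := hloc z hz
    exact cauchySeq_tendsto_of_complete (hc.cauchySeq (mem_ball_self hr))
  choose! G hG using hlim
  have hGd : DifferentiableOn ℂ G Ω := fun z hz => by
    obtain ⟨r, hr, hrΩ, hc⟩ := hloc z hz
    exact (differentiableAt_of_tendstoUniformlyOn_ball hr (fun n => (hF n).mono hrΩ)
      (hc.tendstoUniformlyOn_of_tendsto fun x hx => hG x (hrΩ hx))).differentiableWithinAt
  refine ⟨fun z => G z, ⟨G, hGd, fun _ => rfl⟩, ?_⟩
  obtain ⟨ns, hns, hae⟩ := (tendstoInMeasure_of_tendsto_Lp huv).exists_seq_tendsto_ae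
  filter_upwards [hae, ae_all_iff.2 huf] with z hz hz'
  refine tendsto_nhds_unique hz ?_
  have := (hG z z.2).comp hns.tendsto_atTop
  refine this.congr fun n => ?_
  simp [hFf, hz']

end Leb

section Evaluation

variable {d : ℕ} {Ω : Set (Fin d → ℂ)}

/-- The closed unit ball of `A` for the supremum norm, regarded as a discrete index set. -/
structure UnitBall (A : Subalgebra ℂ (HInfty Ω)) where
  fn : HInfty Ω
  mem : fn ∈ A
  le_one : ∀ x, ‖(fn : Ω → ℂ) x‖ ≤ 1

instance (A : Subalgebra ℂ (HInfty Ω)) : TopologicalSpace (UnitBall A) := ⊥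

instance (A : Subalgebra ℂ (HInfty Ω)) : DiscreteTopology (UnitBall A) := ⟨rfl⟩

/-- Bounded functions on the unit ball of `A`. The predual of `A` embeds isometrically here. -/
abbrev BallFun (A : Subalgebra ℂ (HInfty Ω)) := BoundedContinuousFunction (UnitBall A) ℂ

variable (A : Subalgebra ℂ (HInfty Ω))

/-- Evaluation at a point of `Ω`, as a function on the unit ball of `A`. -/
def ev (z : Ω) : BallFun A :=
  BoundedContinuousFunction.ofNormedAddCommGroupDiscrete (fun ψ => (ψ.fn : Ω → ℂ) z) 1
    fun ψ => ψ.le_one z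

theorem norm_ev_le (z : Ω) : ‖ev A z‖ ≤ 1 :=
  (BoundedContinuousFunction.norm_le zero_le_one).2 fun ψ => ψ.le_one z

open Classical in
theorem differentiableOn_ev (hΩ : IsOpen Ω) :
    DifferentiableOn ℂ (fun x => if h : x ∈ Ω then ev A ⟨x, h⟩ else 0) Ω := by
  intro z hz
  obtain ⟨r, hr, hrΩ⟩ := Metric.isOpen_iff.1 hΩ z hz
  choose F hF hFψ using fun ψ : UnitBall A => ψ.fn.2.1
  refine (differentiableAt_family (F := F) (M := 1) hr (fun ψ => (hF ψ).mono hrΩ)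
    (fun ψ x hx => ?_) (fun x hx ψ => ?_)).differentiableWithinAt
  · rw [hFψ ψ ⟨x, hrΩ hx⟩]
    exact ψ.le_one _
  · simp only [hrΩ hx, dif_pos]
    exact (hFψ ψ ⟨x, hrΩ hx⟩).symm

theorem holo_comp_ev (hΩ : IsOpen Ω) (Λ : BallFun A →L[ℂ] ℂ) : Holo Ω fun z => Λ (ev A z) := by
  classical
  exact ⟨_, Λ.differentiable.comp_differentiableOn (differentiableOn_ev A hΩ),
    fun z => by simp⟩

theorem continuous_ev (hΩ : IsOpen Ω) : Continuous (ev A) := by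
  classical
  have h := (differentiableOn_ev A hΩ).continuousOn.domRestrict
  convert h using 1
  funext z
  simp [Set.domRestrict]

theorem norm_comp_ev_le (Λ : BallFun A →L[ℂ] ℂ) (z : Ω) : ‖Λ (ev A z)‖ ≤ ‖Λ‖ :=
  (Λ.le_opNorm _).trans (mul_le_of_le_one_right (norm_nonneg _) (norm_ev_le A z))

variable {A}

theorem integrable_smul_ev (hΩ : IsOpen Ω) {h : Ω → ℂ} (hh : Integrable h (leb Ω)) :
    Integrable (fun z => h z • ev A z) (leb Ω) := by
  refine Integrable.mono hh
    (hh.1.smul (continuous_ev A hΩ).aestronglyMeasurable) (ae_of_all _ fun z => ?_)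
  rw [norm_smul]
  exact mul_le_of_le_one_right (norm_nonneg _) (norm_ev_le A z)

theorem clm_integral_smul_ev (hΩ : IsOpen Ω) {h : Ω → ℂ} (hh : Integrable h (leb Ω))
    (Λ : BallFun A →L[ℂ] ℂ) :
    Λ (∫ z, h z • ev A z ∂(leb Ω)) = ∫ z, h z * Λ (ev A z) ∂(leb Ω) := by
  rw [← Λ.integral_comp_comm (integrable_smul_ev hΩ hh)]
  simp

theorem integral_smul_ev_apply (hΩ : IsOpen Ω) {h : Ω → ℂ} (hh : Integrable h (leb Ω))
    (ψ : UnitBall A) :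
    (∫ z, h z • ev A z ∂(leb Ω)) ψ = ∫ z, h z * (ψ.fn : Ω → ℂ) z ∂(leb Ω) :=
  clm_integral_smul_ev hΩ hh (BoundedContinuousFunction.evalCLM ℂ ψ)

theorem norm_integral_smul_ev_le {h : Ω → ℂ} (hh : Integrable h (leb Ω)) :
    ‖∫ z, h z • ev A z ∂(leb Ω)‖ ≤ ∫ z, ‖h z‖ ∂(leb Ω) := by
  refine norm_integral_le_of_norm_le hh.norm (ae_of_all _ fun z => ?_)
  rw [norm_smul]
  exact mul_le_of_le_one_right (norm_nonneg _) (norm_ev_le A z)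

theorem integrable_mul_of_mem {φ : HInfty Ω} {h : Ω → ℂ} (hh : Integrable h (leb Ω)) :
    Integrable (fun z => (φ : Ω → ℂ) z * h z) (leb Ω) := by
  obtain ⟨hφ, C, hC⟩ := φ.2
  exact hh.bdd_mul (Holo.continuous hφ).aestronglyMeasurable (ae_of_all _ hC)

/-- A function in `A`, scaled into the unit ball. -/
theorem exists_unitBall_smul {φ : HInfty Ω} (hφ : φ ∈ A) :
    ∃ (C : ℝ) (ψ : UnitBall A), 0 < C ∧ φ = (C : ℂ) • ψ.fn := by
  obtain ⟨C, hC⟩ := φ.2.2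
  have hC1 : 0 < |C| + 1 := by positivity
  refine ⟨|C| + 1, ⟨(((|C| + 1 : ℝ) : ℂ)⁻¹) • φ, A.smul_mem hφ _, fun x => ?_⟩, hC1, ?_⟩
  · have : ‖(φ : Ω → ℂ) x‖ ≤ |C| + 1 := (hC x).trans ((le_abs_self C).trans (by linarith))
    calc _ = (|C| + 1)⁻¹ * ‖(φ : Ω → ℂ) x‖ := by
          rw [Subalgebra.coe_smul, Pi.smul_apply, norm_smul, norm_inv,
            Complex.norm_real, Real.norm_of_nonneg hC1.le]
      _ ≤ 1 := by rw [inv_mul_le_iff₀ hC1]; linarith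
  · rw [smul_smul, mul_inv_cancel₀ (by exact_mod_cast hC1.ne'), one_smul]

/-- Continuous functionals on bounded functions on the unit ball of `A`, restricted to evaluations,
are given by elements of `A`: this is where weak* closedness is used. -/
theorem exists_mem_forall_eq_comp_ev (hΩ : IsOpen Ω)
    (hA : IsClosed[weakStar Ω] (A : Set (HInfty Ω))) (Λ : BallFun A →L[ℂ] ℂ) :
    ∃ φ ∈ A, ∀ z, (φ : Ω → ℂ) z = Λ (ev A z) := by
  set φ₀ : HInfty Ω := ⟨fun z => Λ (ev A z), holo_comp_ev A hΩ Λ, ‖Λ‖, norm_comp_ev_le A Λ⟩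
    with hφ₀
  refine ⟨φ₀, ?_, fun z => rfl⟩
  set I : HInfty Ω → Lp ℂ 1 (leb Ω) → ℂ :=
    fun φ h => ∫ z, (φ : Ω → ℂ) z * h z ∂(leb Ω) with hI
  have hfin : ∀ J : Finset (Lp ℂ 1 (leb Ω)), ∃ φ ∈ A, ∀ h ∈ J, I φ h = I φ₀ h := by
    classical
    intro J
    let Rl : A →ₗ[ℂ] (J → ℂ) :=
      { toFun := fun φ h => I φ h
        map_add' := fun φ ψ => by
          funext h
          simp only [hI, Pi.add_apply]
          rw [← integral_add (integrable_mul_of_mem (L1.integrable_coeFn _))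
            (integrable_mul_of_mem (L1.integrable_coeFn _))]
          refine integral_congr_ae (ae_of_all _ fun z => ?_)
          exact add_mul _ _ _
        map_smul' := fun c φ => by
          funext h
          simp only [hI, Pi.smul_apply, RingHom.id_apply, smul_eq_mul]
          rw [← integral_const_mul]
          refine integral_congr_ae (ae_of_all _ fun z => ?_)
          exact mul_assoc _ _ _ }
    by_contra hne
    have hτ : (fun h : J => I φ₀ h) ∉ LinearMap.range Rl := by
      rintro ⟨φ, hφ⟩
      exact hne ⟨φ, φ.2, fun h hh => congrFun hφ ⟨h, hh⟩⟩
    obtain ⟨a, ha0, ha⟩ := Submodule.exists_le_ker_of_notMem hτ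
    set c : J → ℂ := fun h => a (Pi.single h 1) with hc
    have hac : ∀ v, a v = ∑ h, v h * c h := fun v => by
      conv_lhs => rw [← Finset.univ_sum_single v]
      rw [map_sum]
      refine Finset.sum_congr rfl fun h _ => ?_
      rw [hc, ← smul_eq_mul, ← map_smul, ← Pi.single_smul, smul_eq_mul, mul_one]
    set H : Ω → ℂ := fun z => ∑ h : J, c h * (h : Lp ℂ 1 (leb Ω)) z with hH
    have hHint : Integrable H (leb Ω) :=
      integrable_finsetSum _ fun h _ => (L1.integrable_coeFn _).const_mul _
    have hpair : ∀ φ : HInfty Ω, ∫ z, H z * (φ : Ω → ℂ) z ∂(leb Ω) = a (fun h : J => I φ h) := by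
      intro φ
      rw [hac]
      simp only [hI, ← integral_mul_const]
      rw [← integral_finsetSum]
      · refine integral_congr_ae (ae_of_all _ fun z => ?_)
        simp only [hH, Finset.sum_mul]
        exact Finset.sum_congr rfl fun h _ => by ring
      · exact fun h _ => (integrable_mul_of_mem (L1.integrable_coeFn _)).mul_const _
    have hzero : ∫ z, H z • ev A z ∂(leb Ω) = 0 := by
      ext ψ
      rw [integral_smul_ev_apply hΩ hHint, hpair]
      exact ha ⟨⟨ψ.fn, ψ.mem⟩, rfl⟩
    have h1 := clm_integral_smul_ev hΩ hHint Λ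
    rw [hzero, map_zero] at h1
    exact ha0 ((hpair φ₀).symm.trans h1.symm)
  have hcl : φ₀ ∈ @closure _ (weakStar Ω) (A : Set (HInfty Ω)) := by
    rw [weakStar, closure_induced, mem_closure_iff_nhds]
    intro t ht
    rw [nhds_pi, Filter.mem_pi] at ht
    obtain ⟨J, hJ, s, hs, hst⟩ := ht
    obtain ⟨φ, hφ, hφJ⟩ := hfin hJ.toFinset
    refine ⟨I φ, hst fun h hh => ?_, φ, hφ, rfl⟩
    change I φ h ∈ s h
    rw [hφJ h (by simpa using hh)]
    exact mem_of_mem_nhds (hs h)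
  rwa [@IsClosed.closure_eq _ (weakStar Ω) _ hA] at hcl

end Evaluation

section Pairing

variable {d : ℕ} {Ω : Set (Fin d → ℂ)}

/-- The pairing `∫ |u| |v|`. -/
def absPair (u v : Lp ℂ 2 (leb Ω)) : ℝ := ∫ z, ‖u z‖ * ‖v z‖ ∂(leb Ω)

theorem integrable_absPair (u v : Lp ℂ 2 (leb Ω)) :
    Integrable (fun z => ‖u z‖ * ‖v z‖) (leb Ω) :=
  (Lp.memLp u).norm.integrable_mul (Lp.memLp v).norm

theorem absPair_nonneg (u v : Lp ℂ 2 (leb Ω)) : 0 ≤ absPair u v :=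
  integral_nonneg fun _ => by positivity

theorem absPair_comm (u v : Lp ℂ 2 (leb Ω)) : absPair u v = absPair v u := by
  simp only [absPair, mul_comm]

theorem norm_sq_eq_integral {α : Type*} {m : MeasurableSpace α} {ν : Measure α} (u : Lp ℂ 2 ν) :
    ‖u‖ ^ 2 = ∫ z, ‖u z‖ ^ 2 ∂ν := by
  have h : inner ℂ u u = ((∫ z, ‖u z‖ ^ 2 ∂ν : ℝ) : ℂ) := by
    rw [L2.inner_def, ← integral_complex_ofReal]
    refine integral_congr_ae (ae_of_all _ fun z => ?_)
    simp [inner_self_eq_norm_sq_to_K]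
  rw [← inner_self_eq_norm_sq (𝕜 := ℂ), h]
  rfl

theorem absPair_le (u v : Lp ℂ 2 (leb Ω)) : absPair u v ≤ ‖u‖ * ‖v‖ := by
  have h := integral_mul_le_Lp_mul_Lq_of_nonneg (μ := leb Ω) (f := fun z => ‖u z‖)
    (g := fun z => ‖v z‖) Real.HolderConjugate.two_two (ae_of_all _ fun _ => norm_nonneg _)
    (ae_of_all _ fun _ => norm_nonneg _) (by simpa using (Lp.memLp u).norm)
    (by simpa using (Lp.memLp v).norm)
  refine h.trans_eq ?_
  simp only [Real.rpow_two, ← Real.sqrt_eq_rpow, ← norm_sq_eq_integral,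
    Real.sqrt_sq (norm_nonneg _)]

theorem absPair_add_left (u u' v : Lp ℂ 2 (leb Ω)) :
    absPair (u + u') v ≤ absPair u v + absPair u' v := by
  rw [absPair, absPair, absPair, ← integral_add (integrable_absPair _ _) (integrable_absPair _ _)]
  refine integral_mono_ae (integrable_absPair _ _)
    ((integrable_absPair _ _).add (integrable_absPair _ _)) ?_
  filter_upwards [Lp.coeFn_add u u'] with z hz
  rw [hz, Pi.add_apply, ← add_mul]
  gcongr
  exact norm_add_le _ _

theorem absPair_smul_left (c : ℂ) (u v : Lp ℂ 2 (leb Ω)) :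
    absPair (c • u) v = ‖c‖ * absPair u v := by
  rw [absPair, absPair, ← integral_const_mul]
  refine integral_congr_ae ?_
  filter_upwards [Lp.coeFn_smul c u] with z hz
  rw [hz, Pi.smul_apply, norm_smul, mul_assoc]

theorem integrable_mul_conj (u v : Lp ℂ 2 (leb Ω)) :
    Integrable (fun z => u z * conj (v z)) (leb Ω) := by
  refine (integrable_absPair u v).mono ?_ (ae_of_all _ fun z => ?_)
  · exact (Lp.aestronglyMeasurable u).mul
      (Complex.continuous_conj.comp_aestronglyMeasurable (Lp.aestronglyMeasurable v))
  · simp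

variable (A : Subalgebra ℂ (HInfty Ω))

/-- The functional `φ ↦ ∫ φ u \bar v` as a function on the unit ball of `A`. -/
def rankOne (u v : Lp ℂ 2 (leb Ω)) : BallFun A :=
  ∫ z, (u z * conj (v z)) • ev A z ∂(leb Ω)

variable {A}

theorem rankOne_apply (hΩ : IsOpen Ω) (u v : Lp ℂ 2 (leb Ω)) (ψ : UnitBall A) :
    rankOne A u v ψ = ∫ z, u z * conj (v z) * (ψ.fn : Ω → ℂ) z ∂(leb Ω) :=
  integral_smul_ev_apply hΩ (integrable_mul_conj u v) ψ

theorem norm_rankOne_le_absPair (u v : Lp ℂ 2 (leb Ω)) : ‖rankOne A u v‖ ≤ absPair u v := by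
  refine (norm_integral_smul_ev_le (integrable_mul_conj u v)).trans_eq ?_
  simp [absPair]

theorem norm_rankOne_le (u v : Lp ℂ 2 (leb Ω)) : ‖rankOne A u v‖ ≤ ‖u‖ * ‖v‖ :=
  (norm_rankOne_le_absPair u v).trans (absPair_le u v)

theorem rankOne_add_left (hΩ : IsOpen Ω) (u u' v : Lp ℂ 2 (leb Ω)) :
    rankOne A (u + u') v = rankOne A u v + rankOne A u' v := by
  rw [rankOne, rankOne, rankOne, ← integral_add
    (integrable_smul_ev hΩ (integrable_mul_conj _ _))
    (integrable_smul_ev hΩ (integrable_mul_conj _ _))]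
  refine integral_congr_ae ?_
  filter_upwards [Lp.coeFn_add u u'] with z hz
  rw [hz, Pi.add_apply, ← add_smul, ← add_mul]

theorem rankOne_add_right (hΩ : IsOpen Ω) (u v v' : Lp ℂ 2 (leb Ω)) :
    rankOne A u (v + v') = rankOne A u v + rankOne A u v' := by
  rw [rankOne, rankOne, rankOne, ← integral_add
    (integrable_smul_ev hΩ (integrable_mul_conj _ _))
    (integrable_smul_ev hΩ (integrable_mul_conj _ _))]
  refine integral_congr_ae ?_
  filter_upwards [Lp.coeFn_add v v'] with z hz
  rw [hz, Pi.add_apply, map_add, ← add_smul, ← mul_add]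

theorem rankOne_smul_left (c : ℂ) (u v : Lp ℂ 2 (leb Ω)) :
    rankOne A (c • u) v = c • rankOne A u v := by
  rw [rankOne, rankOne, ← integral_smul]
  refine integral_congr_ae ?_
  filter_upwards [Lp.coeFn_smul c u] with z hz
  rw [hz, Pi.smul_apply, smul_smul, smul_eq_mul, mul_assoc]

theorem rankOne_smul_right (c : ℂ) (u v : Lp ℂ 2 (leb Ω)) :
    rankOne A u (c • v) = conj c • rankOne A u v := by
  rw [rankOne, rankOne, ← integral_smul]
  refine integral_congr_ae ?_
  filter_upwards [Lp.coeFn_smul c v] with z hz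
  rw [hz, Pi.smul_apply, smul_smul, smul_eq_mul, map_mul]
  congr 1; ring

theorem tendsto_rankOne (hΩ : IsOpen Ω) {u v : ℕ → Lp ℂ 2 (leb Ω)} {u' v' : Lp ℂ 2 (leb Ω)}
    (hu : Tendsto u atTop (𝓝 u')) (hv : Tendsto v atTop (𝓝 v')) :
    Tendsto (fun n => rankOne A (u n) (v n)) atTop (𝓝 (rankOne A u' v')) := by
  rw [tendsto_iff_norm_sub_tendsto_zero]
  have hdec : ∀ n, rankOne A (u n) (v n) - rankOne A u' v' =
      rankOne A (u n - u') (v n) + rankOne A u' (v n - v') := fun n => by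
    have h1 := rankOne_add_left (A := A) hΩ (u n - u') u' (v n)
    have h2 := rankOne_add_right (A := A) hΩ u' (v n - v') v'
    rw [sub_add_cancel] at h1 h2
    rw [h1, h2]; abel
  have h1 : Tendsto (fun n => ‖u n - u'‖ * ‖v n‖ + ‖u'‖ * ‖v n - v'‖) atTop (𝓝 0) := by
    have ha := (tendsto_iff_norm_sub_tendsto_zero.1 hu).mul hv.norm
    have hb := (tendsto_iff_norm_sub_tendsto_zero.1 hv).const_mul ‖u'‖
    simpa using ha.add hb
  refine squeeze_zero (fun _ => norm_nonneg _) (fun n => ?_) h1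
  rw [hdec]
  exact (norm_add_le _ _).trans (add_le_add (norm_rankOne_le _ _) (norm_rankOne_le _ _))

/-- The functional of a combination of two almost orthogonal pairs. -/
theorem norm_rankOne_combination_sub_le (hΩ : IsOpen Ω) (a b : ℝ) (ha : 0 ≤ a) (hb : 0 ≤ b)
    (hab : a + b = 1) (u u' v v' : Lp ℂ 2 (leb Ω)) :
    ‖rankOne A ((√a : ℂ) • u + (√b : ℂ) • u') ((√a : ℂ) • v + (√b : ℂ) • v') -
      (a • rankOne A u v + b • rankOne A u' v')‖ ≤ absPair u v' + absPair u' v := by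
  have hsq : ∀ x : ℝ, 0 ≤ x → ((√x : ℂ)) * (√x : ℂ) = (x : ℂ) := fun x hx => by
    rw [← Complex.ofReal_mul, Real.mul_self_sqrt hx]
  have hle : √a * √b ≤ 1 := by
    have h1 : √a ≤ 1 := Real.sqrt_le_one.2 (by linarith)
    have h2 : √b ≤ 1 := Real.sqrt_le_one.2 (by linarith)
    nlinarith [Real.sqrt_nonneg a, Real.sqrt_nonneg b]
  have hexp : rankOne A ((√a : ℂ) • u + (√b : ℂ) • u') ((√a : ℂ) • v + (√b : ℂ) • v') -
      (a • rankOne A u v + b • rankOne A u' v') =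
      ((√a * √b : ℝ) : ℂ) • (rankOne A u v' + rankOne A u' v) := by
    simp only [rankOne_add_left hΩ, rankOne_add_right hΩ, rankOne_smul_left, rankOne_smul_right,
      Complex.conj_ofReal, smul_add, smul_smul, hsq a ha, hsq b hb]
    rw [← Complex.coe_smul a, ← Complex.coe_smul b, Complex.ofReal_mul, mul_comm (√b : ℂ) (√a : ℂ)]
    abel
  rw [hexp, norm_smul, Complex.norm_real, Real.norm_of_nonneg (by positivity)]
  calc _ ≤ 1 * ‖rankOne A u v' + rankOne A u' v‖ := by gcongr
    _ ≤ _ := by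
      rw [one_mul]
      exact (norm_add_le _ _).trans
        (add_le_add (norm_rankOne_le_absPair _ _) (norm_rankOne_le_absPair _ _))

theorem norm_inner_le_absPair (u v : Lp ℂ 2 (leb Ω)) : ‖inner ℂ u v‖ ≤ absPair u v := by
  rw [L2.inner_def]
  refine norm_integral_le_of_norm_le (integrable_absPair u v) (ae_of_all _ fun z => ?_)
  exact norm_inner_le_norm _ _

theorem norm_sq_combination_le (a b : ℝ) (ha : 0 ≤ a) (hb : 0 ≤ b) (hab : a + b = 1)
    (u u' : Lp ℂ 2 (leb Ω)) :
    ‖(√a : ℂ) • u + (√b : ℂ) • u'‖ ^ 2 ≤ a * ‖u‖ ^ 2 + b * ‖u'‖ ^ 2 + 2 * absPair u u' := by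
  have hle : √a * √b ≤ 1 := by
    have h1 : √a ≤ 1 := Real.sqrt_le_one.2 (by linarith)
    have h2 : √b ≤ 1 := Real.sqrt_le_one.2 (by linarith)
    nlinarith [Real.sqrt_nonneg a, Real.sqrt_nonneg b]
  rw [@norm_add_sq ℂ, norm_smul, norm_smul, Complex.norm_real, Complex.norm_real,
    Real.norm_of_nonneg (Real.sqrt_nonneg a), Real.norm_of_nonneg (Real.sqrt_nonneg b),
    mul_pow, mul_pow, Real.sq_sqrt ha, Real.sq_sqrt hb]
  have h3 : RCLike.re (inner ℂ ((√a : ℂ) • u) ((√b : ℂ) • u')) ≤ absPair u u' := by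
    refine (RCLike.re_le_norm _).trans ?_
    rw [inner_smul_left, inner_smul_right, norm_mul, norm_mul, Complex.conj_ofReal,
      Complex.norm_real, Complex.norm_real, Real.norm_of_nonneg (Real.sqrt_nonneg a),
      Real.norm_of_nonneg (Real.sqrt_nonneg b), ← mul_assoc]
    calc _ ≤ 1 * absPair u u' := by
          gcongr
          exact norm_inner_le_absPair u u'
      _ = _ := one_mul _
  linarith

theorem absPair_combination_le (a b : ℝ) (ha : 0 ≤ a) (hb : 0 ≤ b) (hab : a + b = 1)
    (u u' w : Lp ℂ 2 (leb Ω)) :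
    absPair ((√a : ℂ) • u + (√b : ℂ) • u') w ≤ absPair u w + absPair u' w := by
  have h1 : √a ≤ 1 := Real.sqrt_le_one.2 (by linarith)
  have h2 : √b ≤ 1 := Real.sqrt_le_one.2 (by linarith)
  refine (absPair_add_left _ _ _).trans (add_le_add ?_ ?_) <;>
  · rw [absPair_smul_left, Complex.norm_real, Real.norm_of_nonneg (Real.sqrt_nonneg _)]
    exact mul_le_of_le_one_left (absPair_nonneg _ _) ‹_›

variable (A)

/-- Functions on the unit ball of `A` whose pairing with continuous functionals is determined by
the restriction of the functional to point evaluations. -/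
def predual : Submodule ℂ (BallFun A) where
  carrier := {y | ∀ (Λ : BallFun A →L[ℂ] ℂ) (s : ℂ) (ψ : UnitBall A),
    (∀ z, Λ (ev A z) = s * (ψ.fn : Ω → ℂ) z) → Λ y = s * y ψ}
  zero_mem' := fun Λ s ψ _ => by simp
  add_mem' := fun {y y'} hy hy' Λ s ψ h => by
    rw [map_add, hy Λ s ψ h, hy' Λ s ψ h, BoundedContinuousFunction.add_apply, mul_add]
  smul_mem' := fun c y hy Λ s ψ h => by
    rw [map_smul, hy Λ s ψ h, BoundedContinuousFunction.smul_apply, smul_eq_mul, smul_eq_mul]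
    ring

theorem ev_mem_predual (z : Ω) : ev A z ∈ predual A := fun _ _ _ h => h z

theorem rankOne_mem_predual (hΩ : IsOpen Ω) (u v : Lp ℂ 2 (leb Ω)) :
    rankOne A u v ∈ predual A := fun Λ s ψ h => by
  rw [rankOne_apply hΩ, rankOne, clm_integral_smul_ev hΩ (integrable_mul_conj u v),
    ← integral_const_mul]
  refine integral_congr_ae (ae_of_all _ fun z => ?_)
  simp only [h z]; ring

end Pairing

section Approximation

variable {d : ℕ} {Ω : Set (Fin d → ℂ)} (A : Subalgebra ℂ (HInfty Ω))

/-- The function `ψ ↦ |ψ(z)|²` on the unit ball of `A`. -/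
def sqEv (z : Ω) : BoundedContinuousFunction (UnitBall A) ℝ :=
  BoundedContinuousFunction.ofNormedAddCommGroupDiscrete (fun ψ => ‖(ψ.fn : Ω → ℂ) z‖ ^ 2) 1
    fun ψ => by
      rw [Real.norm_of_nonneg (by positivity)]
      exact pow_le_one₀ (norm_nonneg _) (ψ.le_one z)

@[simp]
theorem sqEv_apply (z : Ω) (ψ : UnitBall A) : sqEv A z ψ = ‖(ψ.fn : Ω → ℂ) z‖ ^ 2 := rfl

theorem dist_sqEv_le (z z' : Ω) : dist (sqEv A z) (sqEv A z') ≤ 2 * dist (ev A z) (ev A z') := by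
  rw [BoundedContinuousFunction.dist_le (by positivity)]
  intro ψ
  have h := (ev A z - ev A z').norm_coe_le_norm ψ
  rw [← dist_eq_norm] at h
  have h1 : |‖(ψ.fn : Ω → ℂ) z‖ - ‖(ψ.fn : Ω → ℂ) z'‖| ≤ dist (ev A z) (ev A z') :=
    (abs_norm_sub_norm_le _ _).trans h
  have h2 : |‖(ψ.fn : Ω → ℂ) z‖ + ‖(ψ.fn : Ω → ℂ) z'‖| ≤ 2 := by
    rw [abs_of_nonneg (by positivity)]
    linarith [ψ.le_one z, ψ.le_one z']
  rw [Real.dist_eq, sqEv_apply, sqEv_apply, sq_sub_sq, abs_mul]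
  exact mul_le_mul h2 h1 (abs_nonneg _) zero_le_two

theorem continuous_sqEv (hΩ : IsOpen Ω) : Continuous (sqEv A) := by
  rw [continuous_iff_continuousAt]
  intro z
  rw [ContinuousAt, tendsto_iff_dist_tendsto_zero]
  have h := (tendsto_iff_dist_tendsto_zero.1 ((continuous_ev A hΩ).tendsto z)).const_mul 2
  rw [mul_zero] at h
  exact squeeze_zero (fun _ => dist_nonneg) (fun z' => dist_sqEv_le A z' z) h

theorem norm_sqEv_le (z : Ω) : ‖sqEv A z‖ ≤ 1 := by
  rw [BoundedContinuousFunction.norm_le zero_le_one]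
  intro ψ
  rw [sqEv_apply, Real.norm_of_nonneg (by positivity)]
  exact pow_le_one₀ (norm_nonneg _) (ψ.le_one z)

/-- Evaluation at `z` of `ψ` and of `|ψ|²`. -/
def evSq (z : Ω) : BallFun A × BoundedContinuousFunction (UnitBall A) ℝ := (ev A z, sqEv A z)

theorem integrable_evSq (hΩ : IsOpen Ω) (ρ : Measure Ω) [IsProbabilityMeasure ρ] :
    Integrable (evSq A) ρ := by
  refine Integrable.mono' (integrable_const (1 : ℝ))
    ((continuous_ev A hΩ).prodMk (continuous_sqEv A hΩ)).aestronglyMeasurable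
    (ae_of_all _ fun z => ?_)
  exact max_le (norm_ev_le A z) (norm_sqEv_le A z)

theorem integral_evSq_fst (hΩ : IsOpen Ω) (ρ : Measure Ω) [IsProbabilityMeasure ρ]
    (ψ : UnitBall A) : (∫ z, evSq A z ∂ρ).1 ψ = ∫ z, (ψ.fn : Ω → ℂ) z ∂ρ := by
  exact (((BoundedContinuousFunction.evalCLM ℝ ψ).comp (ContinuousLinearMap.fst ℝ (BallFun A)
    (BoundedContinuousFunction (UnitBall A) ℝ))).integral_comp_comm (integrable_evSq A hΩ ρ)).symm

theorem integral_evSq_snd (hΩ : IsOpen Ω) (ρ : Measure Ω) [IsProbabilityMeasure ρ]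
    (ψ : UnitBall A) : (∫ z, evSq A z ∂ρ).2 ψ = ∫ z, ‖(ψ.fn : Ω → ℂ) z‖ ^ 2 ∂ρ := by
  exact (((BoundedContinuousFunction.evalCLM ℝ ψ).comp (ContinuousLinearMap.snd ℝ (BallFun A)
    (BoundedContinuousFunction (UnitBall A) ℝ))).integral_comp_comm (integrable_evSq A hΩ ρ)).symm

theorem UnitBall.integrable {A : Subalgebra ℂ (HInfty Ω)} (ψ : UnitBall A) (ρ : Measure Ω)
    [IsFiniteMeasure ρ] : Integrable (fun z => (ψ.fn : Ω → ℂ) z) ρ :=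
  Integrable.mono' (integrable_const (1 : ℝ))
    (Holo.continuous ψ.fn.2.1).aestronglyMeasurable (ae_of_all _ ψ.le_one)

theorem UnitBall.integrable_norm_sq {A : Subalgebra ℂ (HInfty Ω)} (ψ : UnitBall A)
    (ρ : Measure Ω) [IsFiniteMeasure ρ] : Integrable (fun z => ‖(ψ.fn : Ω → ℂ) z‖ ^ 2) ρ :=
  Integrable.mono' (integrable_const (1 : ℝ))
    ((Holo.continuous ψ.fn.2.1).norm.pow 2).aestronglyMeasurable (ae_of_all _ fun z => by
      rw [Real.norm_of_nonneg (by positivity)]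
      exact pow_le_one₀ (norm_nonneg _) (ψ.le_one z))

theorem UnitBall.norm_integral_le {A : Subalgebra ℂ (HInfty Ω)} (ψ : UnitBall A) (ρ : Measure Ω)
    [IsProbabilityMeasure ρ] : ‖∫ z, (ψ.fn : Ω → ℂ) z ∂ρ‖ ≤ 1 :=
  (norm_integral_le_of_norm_le_const (ae_of_all _ ψ.le_one)).trans (by simp)

theorem UnitBall.integral_norm_sq_le {A : Subalgebra ℂ (HInfty Ω)} (ψ : UnitBall A)
    (ρ : Measure Ω) [IsProbabilityMeasure ρ] : ∫ z, ‖(ψ.fn : Ω → ℂ) z‖ ^ 2 ∂ρ ≤ 1 := by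
  have := integral_mono (ψ.integrable_norm_sq ρ) (integrable_const (1 : ℝ))
    fun z => pow_le_one₀ (norm_nonneg _) (ψ.le_one z)
  simpa using this

/-- Pairs `(ℓ, q)` such that `ℓ` is approximated by functionals `f ⊗ f` with `f` in the Bergman
space almost orthogonal to any given finite set, where the squared error times `k` is controlled by
the increase of the energy `∫ |ψ|²` from `q` to some probability measure that represents `ℓ`. -/
def EnergyApprox (k : ℕ) : Set (BallFun A × BoundedContinuousFunction (UnitBall A) ℝ) :=
  {e | ∀ (W : Finset (Lp ℂ 2 (leb Ω))) (ε : ℝ), 0 < ε → ∃ f ∈ Berg Ω, ∃ ρ : Measure Ω,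
    IsProbabilityMeasure ρ ∧ ‖f‖ ^ 2 ≤ 1 + ε ∧ (∀ w ∈ W, absPair f w ≤ ε) ∧
    (∀ ψ, ‖∫ z, (ψ.fn : Ω → ℂ) z ∂ρ - e.1 ψ‖ ≤ ε) ∧
    ∀ ψ, k * ‖rankOne A f f ψ - e.1 ψ‖ ^ 2 ≤
      24 * (∫ z, ‖(ψ.fn : Ω → ℂ) z‖ ^ 2 ∂ρ - e.2 ψ) + ε}

theorem norm_sq_convex_add_le {a b η : ℝ} (ha : 0 ≤ a) (hb : 0 ≤ b) (hab : a + b = 1)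
    {x y c : ℂ} (hx : ‖x‖ ≤ 4) (hy : ‖y‖ ≤ 4) (hc : ‖c‖ ≤ η) :
    ‖a • x + b • y + c‖ ^ 2 ≤ a * ‖x‖ ^ 2 + b * ‖y‖ ^ 2 + (8 * η + η ^ 2) := by
  have h1 : ‖a • x + b • y‖ ≤ a * ‖x‖ + b * ‖y‖ := by
    refine (norm_add_le _ _).trans_eq ?_
    rw [norm_smul, norm_smul, Real.norm_of_nonneg ha, Real.norm_of_nonneg hb]
  have h2 : ‖a • x + b • y + c‖ ≤ a * ‖x‖ + b * ‖y‖ + η :=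
    (norm_add_le _ _).trans (add_le_add h1 hc)
  have h3 : a * ‖x‖ + b * ‖y‖ ≤ 4 := by nlinarith
  have hη : 0 ≤ η := (norm_nonneg _).trans hc
  have h4 : (a * ‖x‖ + b * ‖y‖) ^ 2 ≤ a * ‖x‖ ^ 2 + b * ‖y‖ ^ 2 := by
    have hb' : b = 1 - a := by linarith
    subst hb'
    nlinarith [mul_nonneg (mul_nonneg ha hb) (sq_nonneg (‖x‖ - ‖y‖))]
  calc _ ≤ (a * ‖x‖ + b * ‖y‖ + η) ^ 2 := by gcongr
    _ = (a * ‖x‖ + b * ‖y‖) ^ 2 + 2 * (a * ‖x‖ + b * ‖y‖) * η + η ^ 2 := by ring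
    _ ≤ _ := by nlinarith

variable {A}

theorem norm_rankOne_sub_le_four {f : Lp ℂ 2 (leb Ω)} {δ : ℝ} (hδ : δ ≤ 1)
    (hf : ‖f‖ ^ 2 ≤ 1 + δ) (ρ : Measure Ω) [IsProbabilityMeasure ρ] {ψ : UnitBall A} {y : ℂ}
    (hy : ‖∫ z, (ψ.fn : Ω → ℂ) z ∂ρ - y‖ ≤ δ) : ‖rankOne A f f ψ - y‖ ≤ 4 := by
  have h1 : ‖rankOne A f f ψ‖ ≤ 2 := by
    have := ((rankOne A f f).norm_coe_le_norm ψ).trans (norm_rankOne_le f f)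
    nlinarith
  have h2 : ‖y‖ ≤ 2 := by
    have h3 := norm_sub_le (∫ z, (ψ.fn : Ω → ℂ) z ∂ρ) (∫ z, (ψ.fn : Ω → ℂ) z ∂ρ - y)
    rw [sub_sub_cancel] at h3
    linarith [ψ.norm_integral_le ρ]
  linarith [norm_sub_le (rankOne A f f ψ) y]

theorem convex_energyApprox (hΩ : IsOpen Ω) (k : ℕ) : Convex ℝ (EnergyApprox A k) := by
  classical
  intro e he e' he' a b ha hb hab W ε hε
  set δ : ℝ := min 1 (ε / (20 * k + 3)) with hδ
  have hδ0 : 0 < δ := lt_min one_pos (by positivity)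
  have hδ1 : δ ≤ 1 := min_le_left _ _
  have hδε : (20 * k + 3) * δ ≤ ε := by
    have : δ ≤ ε / (20 * k + 3) := min_le_right _ _
    rwa [le_div_iff₀' (by positivity)] at this
  have hk : 0 ≤ (k : ℝ) * δ := by positivity
  obtain ⟨f, hf, ρ, hρ, hfn, hfW, hfl, hfq⟩ := he W δ hδ0
  obtain ⟨f', hf', ρ', hρ', hfn', hfW', hfl', hfq'⟩ := he' (insert f W) δ hδ0
  have hcross : absPair f' f ≤ δ := hfW' f (Finset.mem_insert_self _ _)
  have hcross' : absPair f f' ≤ δ := absPair_comm f f' ▸ hcross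
  set ρ'' : Measure Ω := ENNReal.ofReal a • ρ + ENNReal.ofReal b • ρ' with hρ''
  have hprob : IsProbabilityMeasure ρ'' := ⟨by
    simp [hρ'', ← ENNReal.ofReal_add ha hb, hab]⟩
  have hint : ∀ ψ : UnitBall A, ∫ z, (ψ.fn : Ω → ℂ) z ∂ρ'' =
      a • ∫ z, (ψ.fn : Ω → ℂ) z ∂ρ + b • ∫ z, (ψ.fn : Ω → ℂ) z ∂ρ' := fun ψ => by
    rw [hρ'', integral_add_measure, integral_smul_measure, integral_smul_measure,
      ENNReal.toReal_ofReal ha, ENNReal.toReal_ofReal hb]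
    · exact (ψ.integrable ρ).smul_measure (by simp)
    · exact (ψ.integrable ρ').smul_measure (by simp)
  have hint2 : ∀ ψ : UnitBall A, ∫ z, ‖(ψ.fn : Ω → ℂ) z‖ ^ 2 ∂ρ'' =
      a * ∫ z, ‖(ψ.fn : Ω → ℂ) z‖ ^ 2 ∂ρ + b * ∫ z, ‖(ψ.fn : Ω → ℂ) z‖ ^ 2 ∂ρ' := fun ψ => by
    rw [hρ'', integral_add_measure, integral_smul_measure, integral_smul_measure,
      ENNReal.toReal_ofReal ha, ENNReal.toReal_ofReal hb, smul_eq_mul, smul_eq_mul]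
    · exact (ψ.integrable_norm_sq ρ).smul_measure (by simp)
    · exact (ψ.integrable_norm_sq ρ').smul_measure (by simp)
  refine ⟨(√a : ℂ) • f + (√b : ℂ) • f', add_mem (Submodule.smul_mem _ _ hf)
    (Submodule.smul_mem _ _ hf'), ρ'', hprob, ?_, fun w hw => ?_, fun ψ => ?_, fun ψ => ?_⟩
  · have := norm_sq_combination_le a b ha hb hab f f'
    nlinarith
  · have := absPair_combination_le a b ha hb hab f f' w
    linarith [hfW w hw, hfW' w (Finset.mem_insert_of_mem hw)]
  · have h1 : ∫ z, (ψ.fn : Ω → ℂ) z ∂ρ'' - (a • e + b • e').1 ψ =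
        a • (∫ z, (ψ.fn : Ω → ℂ) z ∂ρ - e.1 ψ) + b • (∫ z, (ψ.fn : Ω → ℂ) z ∂ρ' - e'.1 ψ) := by
      rw [hint, Prod.fst_add, Prod.smul_fst, Prod.smul_fst, BoundedContinuousFunction.add_apply,
        BoundedContinuousFunction.smul_apply, BoundedContinuousFunction.smul_apply, smul_sub,
        smul_sub]
      abel
    rw [h1]
    refine (norm_add_le _ _).trans ?_
    rw [norm_smul, norm_smul, Real.norm_of_nonneg ha, Real.norm_of_nonneg hb]
    nlinarith [hfl ψ, hfl' ψ]
  · set c := rankOne A ((√a : ℂ) • f + (√b : ℂ) • f') ((√a : ℂ) • f + (√b : ℂ) • f') ψ -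
      (a • rankOne A f f ψ + b • rankOne A f' f' ψ) with hc
    have hcn : ‖c‖ ≤ 2 * δ := by
      have h1 := norm_rankOne_combination_sub_le (A := A) hΩ a b ha hb hab f f' f f'
      refine (BoundedContinuousFunction.norm_coe_le_norm (_ - _) ψ).trans (h1.trans ?_)
      linarith
    have h1 : rankOne A ((√a : ℂ) • f + (√b : ℂ) • f') ((√a : ℂ) • f + (√b : ℂ) • f') ψ -
        (a • e + b • e').1 ψ =
        a • (rankOne A f f ψ - e.1 ψ) + b • (rankOne A f' f' ψ - e'.1 ψ) + c := by
      rw [hc, Prod.fst_add, Prod.smul_fst, Prod.smul_fst, BoundedContinuousFunction.add_apply,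
        BoundedContinuousFunction.smul_apply, BoundedContinuousFunction.smul_apply, smul_sub,
        smul_sub]
      abel
    have h2 : (a • e + b • e').2 ψ = a * e.2 ψ + b * e'.2 ψ := rfl
    rw [h1, hint2, h2]
    have h3 := norm_sq_convex_add_le ha hb hab
      (norm_rankOne_sub_le_four hδ1 hfn ρ (hfl ψ)) (norm_rankOne_sub_le_four hδ1 hfn' ρ' (hfl' ψ))
      hcn
    have h4 : (k : ℝ) * (8 * (2 * δ) + (2 * δ) ^ 2) ≤ k * (20 * δ) := by
      gcongr; nlinarith
    have h5 := mul_le_mul_of_nonneg_left h3 (Nat.cast_nonneg (α := ℝ) k)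
    nlinarith [mul_le_mul_of_nonneg_left (hfq ψ) ha, mul_le_mul_of_nonneg_left (hfq' ψ) hb]

theorem isClosed_energyApprox (k : ℕ) : IsClosed (EnergyApprox A k) := by
  refine isClosed_of_closure_subset fun e he W ε hε => ?_
  set δ : ℝ := min 1 (ε / (9 * k + 25)) with hδ
  have hδ0 : 0 < δ := lt_min one_pos (by positivity)
  have hδ1 : δ ≤ 1 := min_le_left _ _
  have hδε : (9 * k + 25) * δ ≤ ε := by
    have : δ ≤ ε / (9 * k + 25) := min_le_right _ _
    rwa [le_div_iff₀' (by positivity)] at this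
  have hk : 0 ≤ (k : ℝ) * δ := by positivity
  obtain ⟨e', he', hee'⟩ := Metric.mem_closure_iff.1 he δ hδ0
  obtain ⟨f, hf, ρ, hρ, hfn, hfW, hfl, hfq⟩ := he' W δ hδ0
  have hd1 : ∀ ψ, ‖e'.1 ψ - e.1 ψ‖ ≤ δ := fun ψ => by
    rw [← dist_eq_norm, dist_comm]
    exact (BoundedContinuousFunction.dist_coe_le_dist ψ).trans
      ((le_max_left _ _).trans hee'.le)
  have hd2 : ∀ ψ, |e.2 ψ - e'.2 ψ| ≤ δ := fun ψ => by
    rw [← Real.dist_eq]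
    exact (BoundedContinuousFunction.dist_coe_le_dist ψ).trans
      ((le_max_right _ _).trans hee'.le)
  refine ⟨f, hf, ρ, hρ, by linarith, fun w hw => by linarith [hfW w hw], fun ψ => ?_,
    fun ψ => ?_⟩
  · have := norm_add_le (∫ z, (ψ.fn : Ω → ℂ) z ∂ρ - e'.1 ψ) (e'.1 ψ - e.1 ψ)
    rw [sub_add_sub_cancel] at this
    linarith [hfl ψ, hd1 ψ]
  · have h3 := norm_sq_convex_add_le (a := 1) (b := 0) zero_le_one le_rfl (by simp)
      (norm_rankOne_sub_le_four hδ1 hfn ρ (hfl ψ)) (y := 0) (by simp) (hd1 ψ)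
    have h4 : (1 : ℝ) • (rankOne A f f ψ - e'.1 ψ) + (0 : ℝ) • (0 : ℂ) + (e'.1 ψ - e.1 ψ) =
        rankOne A f f ψ - e.1 ψ := by simp
    rw [h4] at h3
    have h5 : (k : ℝ) * (8 * δ + δ ^ 2) ≤ k * (9 * δ) := by
      gcongr; nlinarith
    have h6 := mul_le_mul_of_nonneg_left h3 (Nat.cast_nonneg (α := ℝ) k)
    nlinarith [hfq ψ, abs_le.1 (hd2 ψ)]

theorem integral_mem_energyApprox (hΩ : IsOpen Ω) {k : ℕ} (h : ∀ z, evSq A z ∈ EnergyApprox A k)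
    (ρ : Measure Ω) [IsProbabilityMeasure ρ] : ∫ z, evSq A z ∂ρ ∈ EnergyApprox A k :=
  (convex_energyApprox hΩ k).integral_mem (isClosed_energyApprox k) (ae_of_all _ h)
    (integrable_evSq A hΩ ρ)

theorem evSq_mem_energyApprox_succ (hΩ : IsOpen Ω) {k : ℕ}
    (h1 : ∀ z, evSq A z ∈ EnergyApprox A 1) (h : ∀ z, evSq A z ∈ EnergyApprox A k) (z : Ω) :
    evSq A z ∈ EnergyApprox A (k + 1) := by
  classical
  intro W ε hε
  set δ : ℝ := min 1 (ε / (33 * (k + 1) + 3)) with hδ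
  have hδ0 : 0 < δ := lt_min one_pos (by positivity)
  have hδ1 : δ ≤ 1 := min_le_left _ _
  have hδε : (33 * (k + 1) + 3) * δ ≤ ε := by
    have : δ ≤ ε / (33 * (k + 1) + 3) := min_le_right _ _
    rwa [le_div_iff₀' (by positivity)] at this
  have hk : 0 ≤ (k : ℝ) * δ := by positivity
  have hk1 : (0 : ℝ) < k + 1 := by positivity
  obtain ⟨f, hf, ρ, hρ, hfn, hfW, hfl, hfq⟩ := h1 z W δ hδ0
  obtain ⟨f', hf', ρ', hρ', hfn', hfW', hfl', hfq'⟩ :=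
    integral_mem_energyApprox hΩ h ρ (insert f W) δ hδ0
  simp only [integral_evSq_fst A hΩ, integral_evSq_snd A hΩ] at hfl' hfq'
  have hcross : absPair f' f ≤ δ := hfW' f (Finset.mem_insert_self _ _)
  have hcross' : absPair f f' ≤ δ := absPair_comm f f' ▸ hcross
  set a : ℝ := 1 / (k + 1) with ha_def
  set b : ℝ := k / (k + 1) with hb_def
  have ha : 0 ≤ a := by positivity
  have hb : 0 ≤ b := by positivity
  have hab : a + b = 1 := by rw [ha_def, hb_def]; field_simp; ring
  refine ⟨(√a : ℂ) • f + (√b : ℂ) • f', add_mem (Submodule.smul_mem _ _ hf)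
    (Submodule.smul_mem _ _ hf'), ρ', hρ', ?_, fun w hw => ?_, fun ψ => ?_, fun ψ => ?_⟩
  · have := norm_sq_combination_le a b ha hb hab f f'
    nlinarith
  · have := absPair_combination_le a b ha hb hab f f' w
    linarith [hfW w hw, hfW' w (Finset.mem_insert_of_mem hw)]
  · have := norm_add_le (∫ z, (ψ.fn : Ω → ℂ) z ∂ρ' - ∫ z, (ψ.fn : Ω → ℂ) z ∂ρ)
      (∫ z, (ψ.fn : Ω → ℂ) z ∂ρ - (evSq A z).1 ψ)
    rw [sub_add_sub_cancel] at this
    linarith [hfl ψ, hfl' ψ]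
  · set m := ∫ z, (ψ.fn : Ω → ℂ) z ∂ρ with hm
    set y := (evSq A z).1 ψ with hy
    set c := (rankOne A ((√a : ℂ) • f + (√b : ℂ) • f') ((√a : ℂ) • f + (√b : ℂ) • f') ψ -
      (a • rankOne A f f ψ + b • rankOne A f' f' ψ)) + b • (m - y) with hc
    have hcn : ‖c‖ ≤ 3 * δ := by
      have h1 := norm_rankOne_combination_sub_le (A := A) hΩ a b ha hb hab f f' f f'
      have h2 := (BoundedContinuousFunction.norm_coe_le_norm (_ - _) ψ).trans h1
      have h3 : ‖b • (m - y)‖ ≤ δ := by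
        rw [norm_smul, Real.norm_of_nonneg hb]
        nlinarith [hfl ψ]
      refine (norm_add_le _ _).trans ?_
      refine (add_le_add h2 h3).trans ?_
      linarith
    have h1 : rankOne A ((√a : ℂ) • f + (√b : ℂ) • f') ((√a : ℂ) • f + (√b : ℂ) • f') ψ - y =
        a • (rankOne A f f ψ - y) + b • (rankOne A f' f' ψ - m) + c := by
      have hy1 : y = a • y + b • y := by rw [← add_smul, hab, one_smul]
      simp only [hc, smul_sub]
      nth_rewrite 1 [hy1]
      abel
    rw [h1]
    have h3 := norm_sq_convex_add_le ha hb hab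
      (norm_rankOne_sub_le_four hδ1 hfn ρ (hfl ψ)) (norm_rankOne_sub_le_four hδ1 hfn' ρ' (hfl' ψ))
      hcn
    have h4 : ((k : ℝ) + 1) * (8 * (3 * δ) + (3 * δ) ^ 2) ≤ (k + 1) * (33 * δ) := by
      gcongr; nlinarith
    have h5 := mul_le_mul_of_nonneg_left h3 hk1.le
    have h6 : ((k : ℝ) + 1) * a = 1 := by rw [ha_def]; field_simp
    have h7 : ((k : ℝ) + 1) * b = k := by rw [hb_def]; field_simp
    have h8 := hfq ψ
    have h9 := hfq' ψ
    simp only [Nat.cast_one, one_mul] at h8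
    push_cast
    rw [mul_add, mul_add, ← mul_assoc, ← mul_assoc, h6, h7] at h5
    linarith

theorem evSq_mem_energyApprox (hΩ : IsOpen Ω) (h1 : ∀ z, evSq A z ∈ EnergyApprox A 1) (k : ℕ)
    (z : Ω) : evSq A z ∈ EnergyApprox A (k + 1) := by
  induction k generalizing z with
  | zero => exact h1 z
  | succ k ih => exact evSq_mem_energyApprox_succ hΩ h1 ih z

end Approximation

section Factorization

variable {d : ℕ} {Ω : Set (Fin d → ℂ)} (A : Subalgebra ℂ (HInfty Ω))

/-- Functionals that are approximated by `f ⊗ g` with `f`, `g` of norm about one in the Bergman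
space and almost orthogonal to any given finite set. -/
def ApproxFactor : Set (BallFun A) :=
  {y | ∀ (W : Finset (Lp ℂ 2 (leb Ω))) (ε : ℝ), 0 < ε → ∃ f ∈ Berg Ω, ∃ g ∈ Berg Ω,
    ‖f‖ ^ 2 ≤ 1 + ε ∧ ‖g‖ ^ 2 ≤ 1 + ε ∧ (∀ w ∈ W, absPair f w ≤ ε ∧ absPair g w ≤ ε) ∧
    ‖rankOne A f g - y‖ ≤ ε}

variable {A}

theorem convex_approxFactor (hΩ : IsOpen Ω) : Convex ℝ (ApproxFactor A) := by
  classical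
  intro y hy y' hy' a b ha hb hab W ε hε
  have hδ0 : 0 < ε / 3 := by positivity
  obtain ⟨f, hf, g, hg, hfn, hgn, hW, hfg⟩ := hy W (ε / 3) hδ0
  obtain ⟨f', hf', g', hg', hfn', hgn', hW', hfg'⟩ := hy' (insert f (insert g W)) (ε / 3) hδ0
  have hff := (hW' f (by simp)).1
  have hgf := (hW' f (by simp)).2
  have hfg2 := (hW' g (by simp)).1
  have hgg := (hW' g (by simp)).2
  rw [absPair_comm] at hff hgf hgg
  refine ⟨(√a : ℂ) • f + (√b : ℂ) • f', add_mem (Submodule.smul_mem _ _ hf)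
    (Submodule.smul_mem _ _ hf'), (√a : ℂ) • g + (√b : ℂ) • g',
    add_mem (Submodule.smul_mem _ _ hg) (Submodule.smul_mem _ _ hg'), ?_, ?_, fun w hw => ?_, ?_⟩
  · have := norm_sq_combination_le a b ha hb hab f f'
    nlinarith
  · have := norm_sq_combination_le a b ha hb hab g g'
    nlinarith
  · have h1 := absPair_combination_le a b ha hb hab f f' w
    have h2 := absPair_combination_le a b ha hb hab g g' w
    have h3 := hW w hw
    have h4 := hW' w (by simp [hw])
    constructor <;> linarith
  · have h1 := norm_rankOne_combination_sub_le (A := A) hΩ a b ha hb hab f f' g g'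
    have h2 : ‖a • rankOne A f g + b • rankOne A f' g' - (a • y + b • y')‖ ≤ ε / 3 := by
      have h3 : a • rankOne A f g + b • rankOne A f' g' - (a • y + b • y') =
          a • (rankOne A f g - y) + b • (rankOne A f' g' - y') := by
        rw [smul_sub, smul_sub]; abel
      rw [h3]
      refine (norm_add_le _ _).trans ?_
      rw [norm_smul, norm_smul, Real.norm_of_nonneg ha, Real.norm_of_nonneg hb]
      nlinarith
    have h3 := norm_add_le
      (rankOne A ((√a : ℂ) • f + (√b : ℂ) • f') ((√a : ℂ) • g + (√b : ℂ) • g') -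
        (a • rankOne A f g + b • rankOne A f' g'))
      (a • rankOne A f g + b • rankOne A f' g' - (a • y + b • y'))
    rw [sub_add_sub_cancel] at h3
    linarith

theorem isClosed_approxFactor : IsClosed (ApproxFactor A) := by
  refine isClosed_of_closure_subset fun y hy W ε hε => ?_
  obtain ⟨y', hy', hyy'⟩ := Metric.mem_closure_iff.1 hy (ε / 2) (by positivity)
  obtain ⟨f, hf, g, hg, hfn, hgn, hW, hfg⟩ := hy' W (ε / 2) (by positivity)
  refine ⟨f, hf, g, hg, by linarith, by linarith, fun w hw => ?_, ?_⟩
  · constructor <;> linarith [(hW w hw).1, (hW w hw).2]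
  · rw [dist_comm, dist_eq_norm] at hyy'
    have := norm_add_le (rankOne A f g - y') (y' - y)
    rw [sub_add_sub_cancel] at this
    linarith

theorem smul_mem_approxFactor {y : BallFun A} (hy : y ∈ ApproxFactor A) {a : ℂ} (ha : ‖a‖ = 1) :
    a • y ∈ ApproxFactor A := by
  intro W ε hε
  obtain ⟨f, hf, g, hg, hfn, hgn, hW, hfg⟩ := hy W ε hε
  refine ⟨a • f, Submodule.smul_mem _ _ hf, g, hg, by rwa [norm_smul, ha, one_mul], hgn,
    fun w hw => ?_, ?_⟩
  · rw [absPair_smul_left, ha, one_mul]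
    exact hW w hw
  · rwa [rankOne_smul_left, ← smul_sub, norm_smul, ha, one_mul]

theorem zero_mem_approxFactor : (0 : BallFun A) ∈ ApproxFactor A := by
  intro W ε hε
  have h0 : ∀ w : Lp ℂ 2 (leb Ω), absPair 0 w = 0 := fun w => by
    have := absPair_smul_left 0 (0 : Lp ℂ 2 (leb Ω)) w
    simpa using this
  have h1 : rankOne A (0 : Lp ℂ 2 (leb Ω)) 0 = 0 := by
    have := rankOne_smul_left (A := A) 0 (0 : Lp ℂ 2 (leb Ω)) 0
    simpa using this
  refine ⟨0, zero_mem _, 0, zero_mem _, by simp; linarith, by simp; linarith,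
    fun w _ => ⟨by rw [h0]; exact hε.le, by rw [h0]; exact hε.le⟩, by simp [h1, hε.le]⟩

theorem ev_mem_approxFactor (hΩ : IsOpen Ω) (h1 : ∀ z, evSq A z ∈ EnergyApprox A 1) (z : Ω) :
    ev A z ∈ ApproxFactor A := by
  intro W ε hε
  obtain ⟨k, hk⟩ := exists_nat_ge ((24 + ε) / ε ^ 2)
  obtain ⟨f, hf, ρ, hρ, hfn, hfW, -, hfq⟩ := evSq_mem_energyApprox hΩ h1 k z W ε hε
  refine ⟨f, hf, f, hf, hfn, hfn, fun w hw => ⟨hfW w hw, hfW w hw⟩, ?_⟩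
  rw [BoundedContinuousFunction.norm_le hε.le]
  intro ψ
  have h2 := hfq ψ
  have h3 := ψ.integral_norm_sq_le ρ
  have h4 : (evSq A z).2 ψ = ‖(ψ.fn : Ω → ℂ) z‖ ^ 2 := rfl
  have h5 : (evSq A z).1 ψ = ev A z ψ := rfl
  rw [h4, h5] at h2
  rw [BoundedContinuousFunction.sub_apply]
  rw [div_le_iff₀ (by positivity)] at hk
  push_cast at h2
  set x := ‖rankOne A f f ψ - ev A z ψ‖ with hx
  by_contra hlt
  push Not at hlt
  have h6 : ε ^ 2 < x ^ 2 := by gcongr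
  have h7 : 0 ≤ (k : ℝ) := by positivity
  nlinarith [sq_nonneg ‖(ψ.fn : Ω → ℂ) z‖, mul_le_mul_of_nonneg_left h6.le h7, sq_nonneg x,
    sq_pos_of_pos hε]

/-- The unit ball of the predual consists of approximately factorable functionals. -/
theorem mem_approxFactor_of_norm_le_one (hΩ : IsOpen Ω)
    (hA : IsClosed[weakStar Ω] (A : Set (HInfty Ω)))
    (h1 : ∀ z, evSq A z ∈ EnergyApprox A 1) {y : BallFun A} (hy : y ∈ predual A)
    (hy1 : ‖y‖ ≤ 1) : y ∈ ApproxFactor A := by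
  by_contra hne
  obtain ⟨Λ, u, hΛ, hu⟩ := RCLike.geometric_hahn_banach_closed_point (𝕜 := ℂ)
    (convex_approxFactor hΩ) isClosed_approxFactor hne
  have hu0 : 0 < u := by simpa using hΛ 0 zero_mem_approxFactor
  have hbd : ∀ z, ‖Λ (ev A z)‖ ≤ u := fun z => by
    rcases eq_or_ne (Λ (ev A z)) 0 with h0 | h0
    · rw [h0, norm_zero]; exact hu0.le
    set a : ℂ := (‖Λ (ev A z)‖ : ℂ) / Λ (ev A z) with ha
    have ha1 : ‖a‖ = 1 := by
      rw [ha, norm_div, Complex.norm_real, norm_norm, div_self (norm_ne_zero_iff.2 h0)]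
    have h2 := hΛ _ (smul_mem_approxFactor (ev_mem_approxFactor hΩ h1 z) ha1)
    rw [map_smul, smul_eq_mul, ha, div_mul_cancel₀ _ h0] at h2
    exact (by simpa using h2 : ‖Λ (ev A z)‖ < u).le
  obtain ⟨φ, hφ, hφΛ⟩ := exists_mem_forall_eq_comp_ev hΩ hA Λ
  let ψ : UnitBall A := ⟨((u : ℂ)⁻¹) • φ, A.smul_mem hφ _, fun x => by
    rw [Subalgebra.coe_smul, Pi.smul_apply, norm_smul, norm_inv, Complex.norm_real,
      Real.norm_of_nonneg hu0.le, hφΛ, inv_mul_le_iff₀ hu0, mul_one]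
    exact hbd x⟩
  have huC : (u : ℂ) ≠ 0 := by exact_mod_cast hu0.ne'
  have h2 : Λ y = u * y ψ := hy Λ u ψ fun z => by
    change _ = (u : ℂ) * ((u : ℂ)⁻¹ * (φ : Ω → ℂ) z)
    rw [hφΛ, mul_inv_cancel_left₀ huC]
  have h3 : ‖Λ y‖ ≤ u := by
    rw [h2, norm_mul, Complex.norm_real, Real.norm_of_nonneg hu0.le]
    exact mul_le_of_le_one_right hu0.le ((y.norm_coe_le_norm ψ).trans hy1)
  exact absurd hu (not_lt.2 ((RCLike.re_le_norm _).trans h3))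

theorem exists_rankOne_step (hΩ : IsOpen Ω) (hA : IsClosed[weakStar Ω] (A : Set (HInfty Ω)))
    (h1 : ∀ z, evSq A z ∈ EnergyApprox A 1) {y : BallFun A} (hy : y ∈ predual A)
    {f g : Lp ℂ 2 (leb Ω)} (hf : f ∈ Berg Ω) (hg : g ∈ Berg Ω) {t : ℝ} (ht : 0 < t)
    (hfg : ‖y - rankOne A f g‖ ≤ t ^ 2) :
    ∃ f' ∈ Berg Ω, ∃ g' ∈ Berg Ω, ‖f' - f‖ ≤ 2 * t ∧ ‖g' - g‖ ≤ 2 * t ∧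
      ‖y - rankOne A f' g'‖ ≤ (t / 2) ^ 2 := by
  classical
  have htC : (t : ℂ) ≠ 0 := by exact_mod_cast ht.ne'
  set R : BallFun A := ((t : ℂ) ^ 2)⁻¹ • (y - rankOne A f g) with hR
  have hRp : R ∈ predual A :=
    Submodule.smul_mem _ _ (sub_mem hy (rankOne_mem_predual A hΩ f g))
  have hRn : ‖R‖ ≤ 1 := by
    rw [hR, norm_smul, norm_inv, norm_pow, Complex.norm_real, Real.norm_of_nonneg ht.le,
      inv_mul_le_iff₀ (by positivity), mul_one]
    exact hfg
  set ε : ℝ := min 1 ((t ^ 2 / 4) / (t ^ 2 + 2 * t)) with hε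
  have hε0 : 0 < ε := lt_min one_pos (by positivity)
  have hε1 : ε ≤ 1 := min_le_left _ _
  have hεt : (t ^ 2 + 2 * t) * ε ≤ t ^ 2 / 4 := by
    have : ε ≤ (t ^ 2 / 4) / (t ^ 2 + 2 * t) := min_le_right _ _
    rwa [le_div_iff₀' (by positivity)] at this
  obtain ⟨h, hh, k, hk, hhn, hkn, hW, hhk⟩ :=
    mem_approxFactor_of_norm_le_one hΩ hA h1 hRp hRn {f, g} ε hε0
  have hhg : absPair h g ≤ ε := (hW g (by simp)).1
  have hfk : absPair f k ≤ ε := by rw [absPair_comm]; exact (hW f (by simp)).2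
  have hn : ∀ x : Lp ℂ 2 (leb Ω), ‖x‖ ^ 2 ≤ 1 + ε → ‖(t : ℂ) • x‖ ≤ 2 * t := fun x hx => by
    rw [norm_smul, Complex.norm_real, Real.norm_of_nonneg ht.le]
    have : ‖x‖ ≤ 2 := by nlinarith [norm_nonneg x]
    nlinarith
  refine ⟨f + (t : ℂ) • h, add_mem hf (Submodule.smul_mem _ _ hh), g + (t : ℂ) • k,
    add_mem hg (Submodule.smul_mem _ _ hk), ?_, ?_, ?_⟩
  · rw [add_sub_cancel_left]; exact hn h hhn
  · rw [add_sub_cancel_left]; exact hn k hkn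
  have hyR : y - rankOne A f g = ((t : ℂ) ^ 2) • R := by
    rw [hR, smul_smul, mul_inv_cancel₀ (pow_ne_zero 2 htC), one_smul]
  have hexp : y - rankOne A (f + (t : ℂ) • h) (g + (t : ℂ) • k) =
      ((t : ℂ) ^ 2) • (R - rankOne A h k) - (t : ℂ) • (rankOne A f k + rankOne A h g) := by
    rw [smul_sub, ← hyR]
    simp only [rankOne_add_left hΩ, rankOne_add_right hΩ, rankOne_smul_left, rankOne_smul_right,
      Complex.conj_ofReal, smul_add, smul_smul, pow_two]
    abel
  rw [hexp]
  refine (norm_sub_le _ _).trans ?_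
  rw [norm_smul, norm_smul, norm_pow, Complex.norm_real, Real.norm_of_nonneg ht.le]
  have e1 : ‖R - rankOne A h k‖ ≤ ε := by rw [norm_sub_rev]; exact hhk
  have e2 : ‖rankOne A f k + rankOne A h g‖ ≤ 2 * ε := by
    refine (norm_add_le _ _).trans ?_
    linarith [norm_rankOne_le_absPair (A := A) f k, norm_rankOne_le_absPair (A := A) h g]
  calc _ ≤ t ^ 2 * ε + t * (2 * ε) := by gcongr
    _ = (t ^ 2 + 2 * t) * ε := by ring
    _ ≤ t ^ 2 / 4 := hεt
    _ = (t / 2) ^ 2 := by ring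

/-- Every functional in the unit ball of the predual is `φ ↦ ∫ φ f \bar g` with `f`, `g` in the
Bergman space of norm at most `1 + ε`. -/
theorem exists_rankOne_eq (hΩ : IsOpen Ω) (hb : Bornology.IsBounded Ω)
    (hA : IsClosed[weakStar Ω] (A : Set (HInfty Ω)))
    (h1 : ∀ z, evSq A z ∈ EnergyApprox A 1) {y : BallFun A} (hy : y ∈ predual A)
    (hy1 : ‖y‖ ≤ 1) {ε : ℝ} (hε : 0 < ε) :
    ∃ f ∈ Berg Ω, ∃ g ∈ Berg Ω, ‖f‖ ≤ 1 + ε ∧ ‖g‖ ≤ 1 + ε ∧ rankOne A f g = y := by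
  set s : ℝ := min 1 (ε / 5) with hs
  have hs0 : 0 < s := lt_min one_pos (by positivity)
  have hs1 : s ≤ 1 := min_le_left _ _
  have hsε : 5 * s ≤ ε := by
    have : s ≤ ε / 5 := min_le_right _ _
    linarith
  obtain ⟨f₀, hf₀, g₀, hg₀, hfn, hgn, -, hfg⟩ :=
    mem_approxFactor_of_norm_le_one hΩ hA h1 hy hy1 ∅ (s ^ 2) (by positivity)
  set P : ℕ → Lp ℂ 2 (leb Ω) × Lp ℂ 2 (leb Ω) → Prop := fun n p =>
    p.1 ∈ Berg Ω ∧ p.2 ∈ Berg Ω ∧ ‖y - rankOne A p.1 p.2‖ ≤ (s * (1 / 2) ^ n) ^ 2 with hP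
  have hstep : ∀ n p, P n p → ∃ q, P (n + 1) q ∧ ‖q.1 - p.1‖ ≤ 2 * s * (1 / 2) ^ n ∧
      ‖q.2 - p.2‖ ≤ 2 * s * (1 / 2) ^ n := by
    rintro n p ⟨hp1, hp2, hp3⟩
    obtain ⟨f', hf', g', hg', h2, h3, h4⟩ :=
      exists_rankOne_step hΩ hA h1 hy hp1 hp2 (t := s * (1 / 2) ^ n) (by positivity) hp3
    refine ⟨(f', g'), ⟨hf', hg', h4.trans_eq ?_⟩, h2.trans_eq (by ring), h3.trans_eq (by ring)⟩
    rw [pow_succ]; ring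
  choose! step hstep1 hstep2 hstep3 using hstep
  let u : ℕ → Lp ℂ 2 (leb Ω) × Lp ℂ 2 (leb Ω) := fun n =>
    Nat.rec (f₀, g₀) (fun n p => step n p) n
  have hu : ∀ n, P n (u n) := fun n => by
    induction n with
    | zero =>
      refine ⟨hf₀, hg₀, ?_⟩
      rw [norm_sub_rev, pow_zero, mul_one]
      exact hfg
    | succ n ih => exact hstep1 n _ ih
  have hd1 : ∀ n, dist (u n).1 (u (n + 1)).1 ≤ 2 * s * (1 / 2) ^ n := fun n => by
    rw [dist_comm, dist_eq_norm]; exact hstep2 n _ (hu n)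
  have hd2 : ∀ n, dist (u n).2 (u (n + 1)).2 ≤ 2 * s * (1 / 2) ^ n := fun n => by
    rw [dist_comm, dist_eq_norm]; exact hstep3 n _ (hu n)
  obtain ⟨f, hf⟩ := cauchySeq_tendsto_of_complete
    (cauchySeq_of_le_geometric (1 / 2) (2 * s) (by norm_num) hd1)
  obtain ⟨g, hg⟩ := cauchySeq_tendsto_of_complete
    (cauchySeq_of_le_geometric (1 / 2) (2 * s) (by norm_num) hd2)
  have hcl := isClosed_berg hΩ hb
  have hnorm : ∀ x₀ x : Lp ℂ 2 (leb Ω), ‖x₀‖ ^ 2 ≤ 1 + s ^ 2 →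
      dist x₀ x ≤ 2 * s / (1 - 1 / 2) → ‖x‖ ≤ 1 + ε := fun x₀ x hx₀ hx => by
    rw [dist_comm, dist_eq_norm] at hx
    have h2 : ‖x₀‖ ≤ 1 + s := by nlinarith [norm_nonneg x₀]
    have h3 := norm_add_le (x - x₀) x₀
    rw [sub_add_cancel] at h3
    have h4 : 2 * s / (1 - 1 / 2) = 4 * s := by ring
    linarith
  refine ⟨f, hcl.mem_of_tendsto hf (Eventually.of_forall fun n => (hu n).1), g,
    hcl.mem_of_tendsto hg (Eventually.of_forall fun n => (hu n).2.1),
    hnorm _ _ hfn (dist_le_of_le_geometric_of_tendsto₀ (1 / 2) (2 * s) (by norm_num) hd1 hf),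
    hnorm _ _ hgn (dist_le_of_le_geometric_of_tendsto₀ (1 / 2) (2 * s) (by norm_num) hd2 hg), ?_⟩
  have hlim := tendsto_rankOne (A := A) hΩ hf hg
  refine tendsto_nhds_unique hlim ?_
  rw [tendsto_iff_norm_sub_tendsto_zero]
  have h0 : Tendsto (fun n : ℕ => (s * (1 / 2 : ℝ) ^ n) ^ 2) atTop (𝓝 0) := by
    have := ((tendsto_pow_atTop_nhds_zero_of_lt_one (r := (1 / 2 : ℝ)) (by norm_num)
      (by norm_num)).const_mul s).pow 2
    simpa using this
  refine squeeze_zero (fun _ => norm_nonneg _) (fun n => ?_) h0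
  rw [norm_sub_rev]
  exact (hu n).2.2

end Factorization

section Signs

variable {ι : Type*} [DecidableEq ι]

/-- The signed sum `∑ i ∈ t, ± a i`, with minus signs on `s`. -/
def signedSum {E : Type*} [AddCommGroup E] (a : ι → E) (t s : Finset ι) : E :=
  ∑ i ∈ t, if i ∈ s then -a i else a i

theorem signedSum_insert {E : Type*} [AddCommGroup E] (a : ι → E) {t s : Finset ι} {j : ι}
    (hj : j ∉ t) (hs : s ⊆ t) :
    signedSum a (insert j t) s = signedSum a t s + a j ∧
      signedSum a (insert j t) (insert j s) = signedSum a t s - a j := by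
  have hjs : j ∉ s := fun h => hj (hs h)
  constructor
  · rw [signedSum, Finset.sum_insert hj, if_neg hjs, add_comm, signedSum]
  · rw [signedSum, Finset.sum_insert hj, if_pos (Finset.mem_insert_self _ _), signedSum,
      neg_add_eq_sub]
    congr 1
    refine Finset.sum_congr rfl fun i hi => ?_
    have : i ≠ j := fun h => hj (h ▸ hi)
    simp [this]

theorem sum_norm_sq_signedSum (a : ι → ℂ) (t : Finset ι) :
    ∑ s ∈ t.powerset, ‖signedSum a t s‖ ^ 2 = 2 ^ t.card * ∑ i ∈ t, ‖a i‖ ^ 2 := by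
  induction t using Finset.induction_on with
  | empty => simp [signedSum]
  | insert j t hj ih =>
    rw [Finset.sum_powerset_insert hj, ← Finset.sum_add_distrib]
    have h : ∀ s ∈ t.powerset, ‖signedSum a (insert j t) s‖ ^ 2 +
        ‖signedSum a (insert j t) (insert j s)‖ ^ 2 =
        2 * ‖signedSum a t s‖ ^ 2 + 2 * ‖a j‖ ^ 2 := fun s hs => by
      obtain ⟨h1, h2⟩ := signedSum_insert a hj (Finset.mem_powerset.1 hs)
      rw [h1, h2]
      have := parallelogram_law_with_norm ℝ (signedSum a t s) (a j)
      nlinarith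
    rw [Finset.sum_congr rfl h, Finset.sum_add_distrib, ← Finset.mul_sum, ih, Finset.sum_const,
      Finset.card_powerset, Finset.card_insert_of_notMem hj, Finset.sum_insert hj, nsmul_eq_mul]
    push_cast
    ring

theorem norm_pow_four_add_le (x y : ℂ) :
    ‖x + y‖ ^ 4 + ‖x - y‖ ^ 4 ≤ 2 * ‖x‖ ^ 4 + 12 * (‖x‖ ^ 2 * ‖y‖ ^ 2) + 2 * ‖y‖ ^ 4 := by
  have h1 := @norm_add_sq ℂ _ _ _ _ x y
  have h2 := @norm_sub_sq ℂ _ _ _ _ x y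
  have h3 : |RCLike.re (inner ℂ x y)| ≤ ‖x‖ * ‖y‖ :=
    (RCLike.abs_re_le_norm _).trans (norm_inner_le_norm x y)
  have h4 : (RCLike.re (inner ℂ x y)) ^ 2 ≤ ‖x‖ ^ 2 * ‖y‖ ^ 2 := by
    rw [← mul_pow, ← sq_abs]
    gcongr
  have e1 : ‖x + y‖ ^ 4 = (‖x + y‖ ^ 2) ^ 2 := by ring
  have e2 : ‖x - y‖ ^ 4 = (‖x - y‖ ^ 2) ^ 2 := by ring
  rw [e1, e2, h1, h2]
  nlinarith

theorem sum_norm_pow_four_signedSum (a : ι → ℂ) (t : Finset ι) :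
    ∑ s ∈ t.powerset, ‖signedSum a t s‖ ^ 4 ≤ 3 * 2 ^ t.card * (∑ i ∈ t, ‖a i‖ ^ 2) ^ 2 := by
  induction t using Finset.induction_on with
  | empty => simp [signedSum]
  | insert j t hj ih =>
    rw [Finset.sum_powerset_insert hj, ← Finset.sum_add_distrib]
    have h : ∀ s ∈ t.powerset, ‖signedSum a (insert j t) s‖ ^ 4 +
        ‖signedSum a (insert j t) (insert j s)‖ ^ 4 ≤
        2 * ‖signedSum a t s‖ ^ 4 + 12 * ‖a j‖ ^ 2 * ‖signedSum a t s‖ ^ 2 + 2 * ‖a j‖ ^ 4 :=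
      fun s hs => by
      obtain ⟨h1, h2⟩ := signedSum_insert a hj (Finset.mem_powerset.1 hs)
      rw [h1, h2]
      exact (norm_pow_four_add_le _ _).trans_eq (by ring)
    refine (Finset.sum_le_sum h).trans ?_
    rw [Finset.sum_add_distrib, Finset.sum_add_distrib, ← Finset.mul_sum, ← Finset.mul_sum,
      sum_norm_sq_signedSum, Finset.sum_const, Finset.card_powerset,
      Finset.card_insert_of_notMem hj, Finset.sum_insert hj, nsmul_eq_mul]
    push_cast
    have h2 : (0 : ℝ) ≤ 2 ^ t.card * ‖a j‖ ^ 4 := by positivity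
    calc _ ≤ 2 * (3 * 2 ^ t.card * (∑ i ∈ t, ‖a i‖ ^ 2) ^ 2) +
          12 * ‖a j‖ ^ 2 * (2 ^ t.card * ∑ i ∈ t, ‖a i‖ ^ 2) + 2 ^ t.card * (2 * ‖a j‖ ^ 4) := by
          gcongr
      _ ≤ 3 * (2 ^ t.card * 2) * (‖a j‖ ^ 2 + ∑ i ∈ t, ‖a i‖ ^ 2) ^ 2 := by nlinarith
      _ = _ := by rw [pow_succ 2]

end Signs

section Concentration

variable {d : ℕ} {Ω : Set (Fin d → ℂ)}

theorem exists_setIntegral_exp_le (hΩ : IsOpen Ω) (hb : Bornology.IsBounded Ω) {u : Ω → ℝ}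
    (hu : Continuous u) {M : ℝ} (hM : ∀ x, u x ≤ M) {a : ℝ} {x₀ : Ω} (hx₀ : a < u x₀)
    {ε : ℝ} (hε : 0 < ε) :
    ∃ n : ℕ, ∫ x in {x | u x ≤ a}, Real.exp (2 * n * u x) ∂(leb Ω) ≤
      ε * ∫ x, Real.exp (2 * n * u x) ∂(leb Ω) := by
  have := isFiniteMeasure_leb hΩ hb
  have := isOpenPosMeasure_leb hΩ
  obtain ⟨b, hab, hbx⟩ := exists_between hx₀
  set U : Set Ω := {x | b < u x} with hU
  have hUo : IsOpen U := isOpen_lt continuous_const hu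
  have hUpos : 0 < (leb Ω).real U :=
    ENNReal.toReal_pos (hUo.measure_pos _ ⟨x₀, hbx⟩).ne' (measure_ne_top _ _)
  have hint : ∀ n : ℕ, Integrable (fun x => Real.exp (2 * n * u x)) (leb Ω) := fun n => by
    refine Integrable.mono' (integrable_const (Real.exp (2 * n * M)))
      (Real.continuous_exp.comp (continuous_const.mul hu)).aestronglyMeasurable
      (ae_of_all _ fun x => ?_)
    rw [Real.norm_of_nonneg (Real.exp_pos _).le]
    exact Real.exp_le_exp.2 (by have := hM x; gcongr)
  have hup : ∀ n : ℕ, ∫ x in {x | u x ≤ a}, Real.exp (2 * n * u x) ∂(leb Ω) ≤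
      Real.exp (2 * n * a) * (leb Ω).real Set.univ := fun n => by
    calc _ ≤ ∫ x in {x | u x ≤ a}, Real.exp (2 * n * a) ∂(leb Ω) := by
          refine setIntegral_mono_on (hint n).integrableOn (integrable_const _).integrableOn
            (measurableSet_le hu.measurable measurable_const) fun x hx => ?_
          exact Real.exp_le_exp.2 (by have : u x ≤ a := hx; gcongr)
      _ = (leb Ω).real {x | u x ≤ a} * Real.exp (2 * n * a) := by
          rw [setIntegral_const, smul_eq_mul]
      _ ≤ _ := by
          rw [mul_comm]
          gcongr
          · exact measure_ne_top _ _
          · exact Set.subset_univ _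
  have hlow : ∀ n : ℕ, Real.exp (2 * n * b) * (leb Ω).real U ≤
      ∫ x, Real.exp (2 * n * u x) ∂(leb Ω) := fun n => by
    calc _ = ∫ x in U, Real.exp (2 * n * b) ∂(leb Ω) := by
          rw [setIntegral_const, smul_eq_mul, mul_comm]
      _ ≤ ∫ x in U, Real.exp (2 * n * u x) ∂(leb Ω) := by
          refine setIntegral_mono_on (integrable_const _).integrableOn (hint n).integrableOn
            hUo.measurableSet fun x hx => ?_
          exact Real.exp_le_exp.2 (by have : b ≤ u x := le_of_lt hx; gcongr)
      _ ≤ _ := setIntegral_le_integral (hint n) (ae_of_all _ fun x => (Real.exp_pos _).le)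
  have hlim : Tendsto (fun n : ℕ => Real.exp (2 * n * (a - b)) * (leb Ω).real Set.univ)
      atTop (𝓝 0) := by
    have h1 : Tendsto (fun n : ℕ => 2 * (n : ℝ) * (a - b)) atTop atBot := by
      refine Tendsto.atTop_mul_const_of_neg (by linarith) ?_
      exact tendsto_natCast_atTop_atTop.const_mul_atTop two_pos
    simpa using (Real.tendsto_exp_atBot.comp h1).mul_const ((leb Ω).real Set.univ)
  obtain ⟨n, hn⟩ :=
    (hlim.eventually (ge_mem_nhds (show 0 < ε * (leb Ω).real U by positivity))).exists
  refine ⟨n, (hup n).trans ?_⟩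
  have h2 : Real.exp (2 * n * a) = Real.exp (2 * n * (a - b)) * Real.exp (2 * n * b) := by
    rw [← Real.exp_add]; ring_nf
  calc _ = (Real.exp (2 * n * (a - b)) * (leb Ω).real Set.univ) * Real.exp (2 * n * b) := by
        rw [h2]; ring
    _ ≤ (ε * (leb Ω).real U) * Real.exp (2 * n * b) := by gcongr
    _ = ε * (Real.exp (2 * n * b) * (leb Ω).real U) := by ring
    _ ≤ _ := by gcongr; exact hlow n

/-- Normalized powers of `exp φ` concentrate where `Re φ` is close to its supremum. -/
theorem exists_berg_concentrated_of_not_attained (hΩ : IsOpen Ω) (hb : Bornology.IsBounded Ω)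
    {φ : Ω → ℂ} (hφ : Holo Ω φ) {M : ℝ} (hM : ∀ x, ‖φ x‖ ≤ M)
    (hna : ∀ x, ∃ x', (φ x).re < (φ x').re) {K : Set Ω} (hK : IsCompact K) (z : Ω) {ε : ℝ}
    (hε : 0 < ε) :
    ∃ x ∈ Berg Ω, ‖x‖ = 1 ∧ ∫ y in K, ‖x y‖ ^ 2 ∂(leb Ω) ≤ ε ∧
      (φ z).re ≤ ∫ y, (φ y).re * ‖x y‖ ^ 2 ∂(leb Ω) := by
  have := isFiniteMeasure_leb hΩ hb
  set u : Ω → ℝ := fun y => (φ y).re with hu_def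
  have hu : Continuous u := Complex.continuous_re.comp hφ.continuous
  have huM : ∀ y, |u y| ≤ M := fun y => (Complex.abs_re_le_norm _).trans (hM y)
  obtain ⟨y₀, hzy, hKy⟩ : ∃ y₀, u z < u y₀ ∧ ∀ k ∈ K, u k < u y₀ := by
    have hK' : IsCompact (insert z K) := hK.insert z
    obtain ⟨k₀, -, hk₀⟩ := hK'.exists_isMaxOn ⟨z, Set.mem_insert _ _⟩ hu.continuousOn
    obtain ⟨y₀, hy₀⟩ := hna k₀
    exact ⟨y₀, (hk₀ (Set.mem_insert _ _)).trans_lt hy₀,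
      fun k hk => (hk₀ (Set.mem_insert_of_mem _ hk)).trans_lt hy₀⟩
  obtain ⟨a, hza, hay, hKa⟩ : ∃ a, u z < a ∧ a < u y₀ ∧ ∀ k ∈ K, u k ≤ a := by
    have hK' : IsCompact (insert z K) := hK.insert z
    obtain ⟨k₀, hk₀m, hk₀⟩ := hK'.exists_isMaxOn ⟨z, Set.mem_insert _ _⟩ hu.continuousOn
    have hk₀y : u k₀ < u y₀ := by
      rcases hk₀m with rfl | h
      exacts [hzy, hKy _ h]
    obtain ⟨a, h1, h2⟩ := exists_between hk₀y
    exact ⟨a, (hk₀ (Set.mem_insert _ _)).trans_lt h1, h2,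
      fun k hk => (hk₀ (Set.mem_insert_of_mem _ hk)).trans h1.le⟩
  have hM0 : 0 ≤ M := (norm_nonneg _).trans (hM z)
  set η : ℝ := min ε ((a - u z) / (M + |a| + 1)) with hη
  have hη0 : 0 < η := lt_min hε (div_pos (by linarith) (by positivity))
  have hηε : η ≤ ε := min_le_left _ _
  have hηa : (M + |a| + 1) * η ≤ a - u z := by
    have : η ≤ (a - u z) / (M + |a| + 1) := min_le_right _ _
    rwa [le_div_iff₀' (by positivity)] at this
  obtain ⟨n, hn⟩ := exists_setIntegral_exp_le hΩ hb hu (fun y => (le_abs_self _).trans (huM y))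
    hay hη0
  set E : Ω → ℂ := fun y => Complex.exp (((n : ℂ) • φ) y) with hE
  have hEh : Holo Ω E := (hφ.const_smul _).cexp
  have hEn : ∀ y, ‖E y‖ ^ 2 = Real.exp (2 * n * u y) := fun y => by
    rw [hE, Complex.norm_exp, ← Real.exp_nat_mul]
    congr 1
    simp [hu_def]; ring
  have hEL : MemLp E 2 (leb Ω) := by
    refine MemLp.of_bound hEh.continuous.aestronglyMeasurable (Real.exp (n * M))
      (ae_of_all _ fun y => ?_)
    rw [hE, Complex.norm_exp]
    refine Real.exp_le_exp.2 ?_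
    have h1 : ((n : ℂ) • φ) y = (n : ℂ) * φ y := rfl
    have h2 : ((n : ℂ) * φ y).re = n * u y := by simp [hu_def]
    rw [h1, h2]
    have := (le_abs_self _).trans (huM y)
    gcongr
  set e : Lp ℂ 2 (leb Ω) := hEL.toLp E with he
  have heE : ⇑e =ᵐ[leb Ω] E := hEL.coeFn_toLp
  have heB : e ∈ Berg Ω := ⟨E, hEh, heE⟩
  have hen : ‖e‖ ^ 2 = ∫ y, Real.exp (2 * n * u y) ∂(leb Ω) := by
    rw [norm_sq_eq_integral]
    refine integral_congr_ae ?_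
    filter_upwards [heE] with y hy
    rw [hy, hEn]
  have hint : Integrable (fun y => Real.exp (2 * n * u y)) (leb Ω) := by
    refine (hEL.integrable_norm_pow (p := 2) (by norm_num)).congr (ae_of_all _ fun y => ?_)
    exact hEn y
  have hpos : 0 < ‖e‖ ^ 2 := by
    rw [hen]
    have : (leb Ω).IsOpenPosMeasure := isOpenPosMeasure_leb hΩ
    have hne : NeZero (leb Ω) := ⟨fun h => by
      have := isOpen_univ.measure_pos (leb Ω) ⟨z, trivial⟩
      simp [h] at this⟩
    exact integral_exp_pos hint
  have he0 : ‖e‖ ≠ 0 := fun h => by simp [h] at hpos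
  set x : Lp ℂ 2 (leb Ω) := ((‖e‖ : ℂ)⁻¹) • e with hx
  have hxe : ∀ᵐ y ∂(leb Ω), ‖x y‖ ^ 2 = (‖e‖ ^ 2)⁻¹ * Real.exp (2 * n * u y) := by
    filter_upwards [heE, Lp.coeFn_smul ((‖e‖ : ℂ)⁻¹) e] with y hy hy'
    rw [hx, hy', Pi.smul_apply, norm_smul, hy, mul_pow, hEn, norm_inv, Complex.norm_real, norm_norm,
      inv_pow]
  have hxn : ‖x‖ = 1 := by
    rw [hx, norm_smul, norm_inv, Complex.norm_real, norm_norm, inv_mul_cancel₀ he0]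
  have hxint : Integrable (fun y => ‖x y‖ ^ 2) (leb Ω) :=
    (Lp.memLp x).integrable_norm_pow (p := 2) (by norm_num)
  have hSm : MeasurableSet {y | u y ≤ a} := measurableSet_le hu.measurable measurable_const
  have hS : ∫ y in {y | u y ≤ a}, ‖x y‖ ^ 2 ∂(leb Ω) ≤ η := by
    rw [setIntegral_congr_ae hSm (hxe.mono fun y hy _ => hy), integral_const_mul,
      inv_mul_le_iff₀ hpos, hen, mul_comm _ η]
    exact hn
  refine ⟨x, Submodule.smul_mem _ _ heB, hxn, ?_, ?_⟩
  · refine le_trans ?_ (hS.trans hηε)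
    exact setIntegral_mono_set hxint.integrableOn (ae_of_all _ fun y => by positivity)
      (Eventually.of_forall fun k hk => hKa k hk)
  · have huint : Integrable (fun y => u y * ‖x y‖ ^ 2) (leb Ω) :=
      hxint.bdd_mul hu.aestronglyMeasurable (ae_of_all _ huM)
    have htot : ∫ y, ‖x y‖ ^ 2 ∂(leb Ω) = 1 := by rw [← norm_sq_eq_integral, hxn, one_pow]
    have hsplit := integral_add_compl hSm hxint
    have hsplit2 := integral_add_compl hSm huint
    have h1 : -(M * η) ≤ ∫ y in {y | u y ≤ a}, u y * ‖x y‖ ^ 2 ∂(leb Ω) := by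
      have : ∫ y in {y | u y ≤ a}, -M * ‖x y‖ ^ 2 ∂(leb Ω) ≤
          ∫ y in {y | u y ≤ a}, u y * ‖x y‖ ^ 2 ∂(leb Ω) := by
        refine integral_mono (hxint.integrableOn.const_mul _) huint.integrableOn fun y => ?_
        have := (abs_le.1 (huM y)).1
        dsimp only
        gcongr
      rw [integral_const_mul] at this
      nlinarith
    have h2 : a * ∫ y in {y | u y ≤ a}ᶜ, ‖x y‖ ^ 2 ∂(leb Ω) ≤
        ∫ y in {y | u y ≤ a}ᶜ, u y * ‖x y‖ ^ 2 ∂(leb Ω) := by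
      rw [← integral_const_mul]
      refine setIntegral_mono_on (hxint.integrableOn.const_mul _) huint.integrableOn hSm.compl
        fun y hy => ?_
      have : a ≤ u y := le_of_lt (not_le.1 hy)
      gcongr
    have h3 : 0 ≤ ∫ y in {y | u y ≤ a}, ‖x y‖ ^ 2 ∂(leb Ω) :=
      integral_nonneg fun y => by positivity
    set p := ∫ y in {y | u y ≤ a}, ‖x y‖ ^ 2 ∂(leb Ω)
    have h4 : a * p ≤ |a| * η := (le_abs_self _).trans (by
      rw [abs_mul, abs_of_nonneg h3]; gcongr)
    change u z ≤ ∫ y, u y * ‖x y‖ ^ 2 ∂(leb Ω)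
    have h5 : ∫ y in {y | u y ≤ a}ᶜ, ‖x y‖ ^ 2 ∂(leb Ω) = 1 - p := by linarith
    rw [h5] at h2
    nlinarith

theorem re_eq_of_isMax (hΩ : IsOpen Ω) (hc : IsConnected Ω) {φ : Ω → ℂ} (hφ : Holo Ω φ) {x : Ω}
    (hx : ∀ x', (φ x').re ≤ (φ x).re) (y : Ω) : (φ y).re = (φ x).re := by
  obtain ⟨F, hF, hFφ⟩ := hφ
  have h := Complex.norm_eqOn_of_isPreconnected_of_isMaxOn (f := fun z => Complex.exp (F z))
    (U := Ω) (c := x) hc.isPreconnected hΩ hF.cexp x.2 (fun z hz => by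
      have := hx ⟨z, hz⟩
      rw [← hFφ, ← hFφ] at this
      simpa [Complex.norm_exp] using this)
  have h1 := h y.2
  simp only [Function.comp_apply, Function.const_apply, Complex.norm_exp, Real.exp_eq_exp] at h1
  rwa [hFφ, hFφ] at h1

/-- For every bounded holomorphic `φ` there are unit vectors in the Bergman space with little mass
on a given compact set for which the mean of `Re φ` is at least its value at a given point. -/
theorem exists_berg_concentrated (hΩ : IsOpen Ω) (hc : IsConnected Ω) (hb : Bornology.IsBounded Ω)
    (i : Fin d) {φ : Ω → ℂ} (hφ : Holo Ω φ) {M : ℝ} (hM : ∀ x, ‖φ x‖ ≤ M) {K : Set Ω}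
    (hK : IsCompact K) (z : Ω) {ε : ℝ} (hε : 0 < ε) :
    ∃ x ∈ Berg Ω, ‖x‖ = 1 ∧ ∫ y in K, ‖x y‖ ^ 2 ∂(leb Ω) ≤ ε ∧
      (φ z).re ≤ ∫ y, (φ y).re * ‖x y‖ ^ 2 ∂(leb Ω) := by
  by_cases hna : ∀ x, ∃ x', (φ x).re < (φ x').re
  · exact exists_berg_concentrated_of_not_attained hΩ hb hφ hM hna hK z hε
  push Not at hna
  obtain ⟨x₀, hx₀⟩ := hna
  have hconst := re_eq_of_isMax hΩ hc hφ hx₀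
  obtain ⟨C, hC⟩ := hb.exists_norm_le
  obtain ⟨x, hxB, hxn, hxK, -⟩ := exists_berg_concentrated_of_not_attained hΩ hb
    (holo_coord (Ω := Ω) i) (M := C) (fun y => (norm_le_pi_norm _ i).trans (hC y y.2))
    (fun y => by
      obtain ⟨r, hr, hrΩ⟩ := Metric.isOpen_iff.1 hΩ y y.2
      have hmem : (y : Fin d → ℂ) + Pi.single i ((r / 2 : ℝ) : ℂ) ∈ Ω := by
        refine hrΩ ?_
        rw [mem_ball_iff_norm, add_sub_cancel_left, Pi.norm_single, Complex.norm_real,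
          Real.norm_of_nonneg (by positivity)]
        linarith
      refine ⟨⟨_, hmem⟩, ?_⟩
      simp only [Pi.add_apply, Pi.single_eq_same, Complex.add_re, Complex.ofReal_re]
      linarith) hK z hε
  refine ⟨x, hxB, hxn, hxK, ?_⟩
  simp only [hconst]
  rw [integral_const_mul, ← norm_sq_eq_integral, hxn]
  simp

end Concentration

section EnergyBase

variable {d : ℕ} {Ω : Set (Fin d → ℂ)}

theorem coeFn_sum_Lp {α ι : Type*} {m : MeasurableSpace α} {ν : Measure α} (t : Finset ι)
    (x : ι → Lp ℂ 2 ν) : ⇑(∑ i ∈ t, x i) =ᵐ[ν] fun z => ∑ i ∈ t, x i z := by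
  classical
  induction t using Finset.induction_on with
  | empty =>
    simp only [Finset.sum_empty]
    exact Lp.coeFn_zero ℂ 2 ν
  | insert j t hj ih =>
    rw [Finset.sum_insert hj]
    filter_upwards [Lp.coeFn_add (x j) (∑ i ∈ t, x i), ih] with z hz hz'
    rw [hz, Pi.add_apply, hz', Finset.sum_insert hj]

theorem integrable_norm_sq_Lp {α : Type*} {m : MeasurableSpace α} {ν : Measure α}
    (x : Lp ℂ 2 ν) : Integrable (fun z => ‖x z‖ ^ 2) ν :=
  (Lp.memLp x).integrable_norm_pow (p := 2) (by norm_num)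

/-- A suitable choice of signs in `∑ ± √(w i) x i` gives a vector whose fourth power is integrable
against the inverse of the density `∑ w i |x i|²`. -/
theorem exists_signed_combination {ι : Type*} (t : Finset ι) {w : ι → ℝ} (hw : ∀ i ∈ t, 0 ≤ w i)
    (hw1 : ∑ i ∈ t, w i = 1) {x : ι → Lp ℂ 2 (leb Ω)} (hxB : ∀ i ∈ t, x i ∈ Berg Ω)
    (hx1 : ∀ i ∈ t, ‖x i‖ = 1) {K : Set Ω} {ε : ℝ} (hε : 0 < ε)
    (hxK : ∀ i ∈ t, ∫ y in K, ‖x i y‖ ^ 2 ∂(leb Ω) ≤ ε) {g : Ω → ℝ}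
    (hg : ∀ z, g z = ∑ i ∈ t, w i * ‖x i z‖ ^ 2) :
    ∃ f ∈ Berg Ω, ‖f‖ = 1 ∧ ∫ y in K, ‖f y‖ ^ 2 ∂(leb Ω) ≤ 4 * ε ∧
      (∀ᵐ z ∂(leb Ω), g z = 0 → f z = 0) ∧
      Integrable (fun z => ‖f z‖ ^ 4 / g z) (leb Ω) ∧
      ∫ z, ‖f z‖ ^ 4 / g z ∂(leb Ω) ≤ 24 := by
  classical
  set F : Finset ι → Lp ℂ 2 (leb Ω) := fun s => signedSum (fun i => (√(w i) : ℂ) • x i) t s with hF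
  have hFB : ∀ s, F s ∈ Berg Ω := fun s => by
    refine Submodule.sum_mem _ fun i hi => ?_
    have := Submodule.smul_mem _ (√(w i) : ℂ) (hxB i hi)
    split_ifs
    exacts [neg_mem this, this]
  set b : ℝ := 2 ^ t.card with hb
  have hb0 : 0 < b := by positivity
  have hFco : ∀ᵐ z ∂(leb Ω), ∀ s ∈ t.powerset,
      F s z = signedSum (fun i => (√(w i) : ℂ) * x i z) t s := by
    refine (ae_ball_iff (Finset.countable_toSet _)).2 fun s _ => ?_
    have h1 := coeFn_sum_Lp t (fun i => if i ∈ s then -((√(w i) : ℂ) • x i) else (√(w i) : ℂ) • x i)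
    have h2 : ∀ᵐ z ∂(leb Ω), ∀ i ∈ t, ((√(w i) : ℂ) • x i) z = (√(w i) : ℂ) * x i z ∧
        (-((√(w i) : ℂ) • x i)) z = -((√(w i) : ℂ) * x i z) := by
      refine (ae_ball_iff (Finset.countable_toSet _)).2 fun i _ => ?_
      filter_upwards [Lp.coeFn_smul (√(w i) : ℂ) (x i), Lp.coeFn_neg ((√(w i) : ℂ) • x i)]
        with z hz hz'
      rw [hz', Pi.neg_apply, hz]
      exact ⟨rfl, rfl⟩
    filter_upwards [h1, h2] with z hz hz'
    refine hz.trans ?_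
    rw [signedSum]
    refine Finset.sum_congr rfl fun i hi => ?_
    split_ifs
    exacts [(hz' i hi).2, (hz' i hi).1]
  have hga : ∀ z, ∑ i ∈ t, ‖(√(w i) : ℂ) * x i z‖ ^ 2 = g z := fun z => by
    rw [hg]
    refine Finset.sum_congr rfl fun i hi => ?_
    rw [norm_mul, mul_pow, Complex.norm_real, Real.norm_of_nonneg (Real.sqrt_nonneg _),
      Real.sq_sqrt (hw i hi)]
  have hg0 : ∀ z, 0 ≤ g z := fun z => by
    rw [← hga]; positivity
  have hsum2 : ∀ᵐ z ∂(leb Ω), ∑ s ∈ t.powerset, ‖F s z‖ ^ 2 = b * g z := by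
    filter_upwards [hFco] with z hz
    rw [← hga, hb, ← sum_norm_sq_signedSum]
    exact Finset.sum_congr rfl fun s hs => by rw [hz s hs]
  have hsum4 : ∀ᵐ z ∂(leb Ω), ∑ s ∈ t.powerset, ‖F s z‖ ^ 4 ≤ 3 * b * g z ^ 2 := by
    filter_upwards [hFco] with z hz
    rw [← hga, hb]
    refine le_trans (le_of_eq ?_) (sum_norm_pow_four_signedSum _ t)
    exact Finset.sum_congr rfl fun s hs => by rw [hz s hs]
  have hbd : ∀ s ∈ t.powerset, ∀ᵐ z ∂(leb Ω), ‖F s z‖ ^ 2 ≤ b * g z := fun s hs => by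
    filter_upwards [hsum2] with z hz
    rw [← hz]
    exact Finset.single_le_sum (f := fun s => ‖F s z‖ ^ 2) (fun _ _ => by positivity) hs
  have hgeq : g = fun z => ∑ i ∈ t, w i * ‖x i z‖ ^ 2 := funext hg
  have hgint : Integrable g (leb Ω) := by
    rw [hgeq]
    exact integrable_finsetSum _ fun i _ => (integrable_norm_sq_Lp _).const_mul _
  have hgtot : ∫ z, g z ∂(leb Ω) = 1 := by
    rw [hgeq, integral_finsetSum _ fun i _ => (integrable_norm_sq_Lp _).const_mul _, ← hw1]
    refine Finset.sum_congr rfl fun i hi => ?_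
    rw [integral_const_mul, ← norm_sq_eq_integral, hx1 i hi]; ring
  have hgK : ∫ z in K, g z ∂(leb Ω) ≤ ε := by
    rw [hgeq, integral_finsetSum _ fun i _ =>
      ((integrable_norm_sq_Lp _).const_mul _).integrableOn]
    calc _ ≤ ∑ i ∈ t, w i * ε := by
          refine Finset.sum_le_sum fun i hi => ?_
          rw [integral_const_mul]
          exact mul_le_mul_of_nonneg_left (hxK i hi) (hw i hi)
      _ = ε := by rw [← Finset.sum_mul, hw1, one_mul]
  have hQint : ∀ s ∈ t.powerset, Integrable (fun z => ‖F s z‖ ^ 4 / g z) (leb Ω) := fun s hs => by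
    refine (hgint.const_mul (b ^ 2)).mono' ?_ ?_
    · exact (((Lp.aestronglyMeasurable (F s)).norm.pow 4).aemeasurable.div
        hgint.1.aemeasurable).aestronglyMeasurable
    · filter_upwards [hbd s hs] with z hz
      rw [Real.norm_of_nonneg (div_nonneg (by positivity) (hg0 z))]
      rcases (hg0 z).eq_or_lt with h0 | h0
      · rw [← h0]; simp
      · rw [div_le_iff₀ h0]
        calc ‖F s z‖ ^ 4 = (‖F s z‖ ^ 2) ^ 2 := by ring
          _ ≤ (b * g z) ^ 2 := by gcongr
          _ = _ := by ring
  have hS2 : ∑ s ∈ t.powerset, ∫ z, ‖F s z‖ ^ 2 ∂(leb Ω) = b := by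
    rw [← integral_finsetSum _ fun s _ => integrable_norm_sq_Lp _, integral_congr_ae hsum2,
      integral_const_mul, hgtot, mul_one]
  have hS4 : ∑ s ∈ t.powerset, ∫ z, ‖F s z‖ ^ 4 / g z ∂(leb Ω) ≤ 3 * b := by
    rw [← integral_finsetSum _ hQint]
    calc _ ≤ ∫ z, 3 * b * g z ∂(leb Ω) := by
          refine integral_mono_ae (integrable_finsetSum _ hQint) (hgint.const_mul _) ?_
          filter_upwards [hsum4] with z hz
          rw [← Finset.sum_div]
          rcases (hg0 z).eq_or_lt with h0 | h0
          · rw [← h0]; simp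
          · rw [div_le_iff₀ h0]
            exact hz.trans_eq (by ring)
      _ = 3 * b := by rw [integral_const_mul, hgtot, mul_one]
  have hSK : ∑ s ∈ t.powerset, ∫ z in K, ‖F s z‖ ^ 2 ∂(leb Ω) ≤ b * ε := by
    rw [← integral_finsetSum _ fun s _ => (integrable_norm_sq_Lp _).integrableOn,
      integral_congr_ae (ae_restrict_of_ae hsum2), integral_const_mul]
    gcongr
  obtain ⟨s, hs, hZ⟩ : ∃ s ∈ t.powerset, 1 / 4 ≤ ∫ z, ‖F s z‖ ^ 2 ∂(leb Ω) -
      (∫ z, ‖F s z‖ ^ 4 / g z ∂(leb Ω)) / 6 - (∫ z in K, ‖F s z‖ ^ 2 ∂(leb Ω)) / (4 * ε) := by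
    refine Finset.exists_le_of_sum_le ⟨∅, Finset.empty_mem_powerset t⟩ ?_
    rw [Finset.sum_const, Finset.card_powerset, Finset.sum_sub_distrib, Finset.sum_sub_distrib,
      ← Finset.sum_div, ← Finset.sum_div, hS2, nsmul_eq_mul]
    push_cast
    rw [← hb]
    have h1 : (∑ s ∈ t.powerset, ∫ z in K, ‖F s z‖ ^ 2 ∂(leb Ω)) / (4 * ε) ≤ b / 4 := by
      rw [div_le_iff₀ (by positivity)]
      linarith
    linarith
  have hQ0 : 0 ≤ ∫ z, ‖F s z‖ ^ 4 / g z ∂(leb Ω) :=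
    integral_nonneg fun z => div_nonneg (by positivity) (hg0 z)
  have hK0 : 0 ≤ (∫ z in K, ‖F s z‖ ^ 2 ∂(leb Ω)) / (4 * ε) :=
    div_nonneg (integral_nonneg fun z => by positivity) (by positivity)
  rw [← norm_sq_eq_integral] at hZ
  set N : ℝ := ‖F s‖ ^ 2 with hN
  have hN4 : 1 / 4 ≤ N := by linarith
  have hF0 : ‖F s‖ ≠ 0 := fun h => by rw [hN, h] at hN4; norm_num at hN4
  have hco : ∀ᵐ z ∂(leb Ω), ‖(((‖F s‖ : ℂ)⁻¹) • F s) z‖ ^ 2 = N⁻¹ * ‖F s z‖ ^ 2 := by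
    filter_upwards [Lp.coeFn_smul ((‖F s‖ : ℂ)⁻¹) (F s)] with z hz
    rw [hz, Pi.smul_apply, norm_smul, mul_pow, norm_inv, Complex.norm_real, norm_norm, inv_pow]
  have hco4 : ∀ᵐ z ∂(leb Ω), ‖(((‖F s‖ : ℂ)⁻¹) • F s) z‖ ^ 4 / g z =
      (N⁻¹) ^ 2 * (‖F s z‖ ^ 4 / g z) := by
    filter_upwards [hco] with z hz
    have h1 : ‖(((‖F s‖ : ℂ)⁻¹) • F s) z‖ ^ 4 = (‖(((‖F s‖ : ℂ)⁻¹) • F s) z‖ ^ 2) ^ 2 := by ring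
    rw [h1, hz]; ring
  refine ⟨((‖F s‖ : ℂ)⁻¹) • F s, Submodule.smul_mem _ _ (hFB s), ?_, ?_, ?_, ?_, ?_⟩
  · rw [norm_smul, norm_inv, Complex.norm_real, norm_norm, inv_mul_cancel₀ hF0]
  · rw [integral_congr_ae (ae_restrict_of_ae hco), integral_const_mul,
      inv_mul_le_iff₀ (by linarith), ← div_le_iff₀ (by positivity)]
    linarith
  · filter_upwards [hbd s hs, Lp.coeFn_smul ((‖F s‖ : ℂ)⁻¹) (F s)] with z hz hz' hgz
    rw [hgz, mul_zero] at hz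
    have : F s z = 0 := by
      have : ‖F s z‖ ^ 2 = 0 := le_antisymm hz (by positivity)
      simpa using this
    rw [hz', Pi.smul_apply, this, smul_zero]
  · exact ((hQint s hs).const_mul _).congr (hco4.mono fun z hz => hz.symm)
  · rw [integral_congr_ae hco4, integral_const_mul]
    have h1 : ∫ z, ‖F s z‖ ^ 4 / g z ∂(leb Ω) ≤ 6 * N := by linarith
    have h2 : N⁻¹ ≤ 4 := by
      rw [inv_le_comm₀ (by linarith) (by norm_num)]; linarith
    have h3 : N⁻¹ * N = 1 := inv_mul_cancel₀ (by linarith)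
    have h4 : 0 ≤ N⁻¹ := inv_nonneg.2 (by linarith)
    calc _ ≤ (N⁻¹) ^ 2 * (6 * N) := by gcongr
      _ = 6 * N⁻¹ * (N⁻¹ * N) := by ring
      _ ≤ 24 := by rw [h3]; linarith

variable {A : Subalgebra ℂ (HInfty Ω)}

theorem clm_rankOne_self (hΩ : IsOpen Ω) (Λ : BallFun A →L[ℂ] ℂ) (x : Lp ℂ 2 (leb Ω)) :
    (Λ (rankOne A x x)).re = ∫ z, (Λ (ev A z)).re * ‖x z‖ ^ 2 ∂(leb Ω) := by
  rw [rankOne, clm_integral_smul_ev hΩ (integrable_mul_conj x x)]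
  have hint : Integrable (fun z => x z * conj (x z) * Λ (ev A z)) (leb Ω) := by
    refine (integrable_mul_conj x x).mul_bdd
      (Λ.continuous.comp (continuous_ev A hΩ)).aestronglyMeasurable
      (ae_of_all _ (norm_comp_ev_le A Λ))
  have h := integral_re hint
  rw [RCLike.re_eq_complex_re] at h
  rw [← h]
  refine integral_congr_ae (ae_of_all _ fun z => ?_)
  simp only [Complex.mul_conj, Complex.normSq_eq_norm_sq]
  rw [Complex.re_ofReal_mul, mul_comm]

/-- Point evaluations are limits of convex combinations of functionals `x ⊗ x` with `x`
concentrated off a given compact set. -/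
theorem ev_mem_closure_convexHull (hΩ : IsOpen Ω) (hc : IsConnected Ω)
    (hb : Bornology.IsBounded Ω) (i : Fin d) {K : Set Ω} (hK : IsCompact K) {ε : ℝ} (hε : 0 < ε)
    (z : Ω) :
    ev A z ∈ closure (convexHull ℝ {y | ∃ x ∈ Berg Ω, ‖x‖ = 1 ∧
      ∫ y in K, ‖x y‖ ^ 2 ∂(leb Ω) ≤ ε ∧ rankOne A x x = y}) := by
  by_contra hne
  obtain ⟨Λ, u, hΛ, hu⟩ := RCLike.geometric_hahn_banach_closed_point (𝕜 := ℂ)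
    (convex_convexHull ℝ _).closure isClosed_closure hne
  obtain ⟨x, hxB, hx1, hxK, hx⟩ := exists_berg_concentrated hΩ hc hb i (holo_comp_ev A hΩ Λ)
    (norm_comp_ev_le A Λ) hK z hε
  have h1 := hΛ _ (subset_closure (subset_convexHull ℝ _ ⟨x, hxB, hx1, hxK, rfl⟩))
  rw [RCLike.re_eq_complex_re] at h1 hu
  rw [clm_rankOne_self hΩ] at h1
  linarith

theorem exists_compact_forall_setIntegral_compl_le (hΩ : IsOpen Ω) (hb : Bornology.IsBounded Ω)
    (W : Finset (Lp ℂ 2 (leb Ω))) {ε : ℝ} (hε : 0 < ε) :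
    ∃ K : Set Ω, IsCompact K ∧ ∀ w ∈ W, ∫ y in Kᶜ, ‖w y‖ ^ 2 ∂(leb Ω) ≤ ε := by
  have := isFiniteMeasure_leb hΩ hb
  have : LocallyCompactSpace Ω := hΩ.locallyCompactSpace
  let E : CompactExhaustion Ω := default
  have h : ∀ w ∈ W, ∀ᶠ n in atTop, ∫ y in (E n)ᶜ, ‖w y‖ ^ 2 ∂(leb Ω) ≤ ε := fun w _ => by
    have h1 := tendsto_setIntegral_of_antitone (μ := leb Ω) (f := fun y => ‖w y‖ ^ 2)
      (s := fun n => (E n)ᶜ) (fun n => (E.isCompact n).measurableSet.compl)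
      (fun m n hmn => Set.compl_subset_compl.2 (E.subset hmn))
      ⟨0, (integrable_norm_sq_Lp w).integrableOn⟩
    have h2 : (⋂ n, (E n)ᶜ) = ∅ := by
      rw [← Set.compl_iUnion, E.iUnion_eq, Set.compl_univ]
    rw [h2, setIntegral_empty] at h1
    exact h1.eventually (ge_mem_nhds hε)
  obtain ⟨n, hn⟩ := ((eventually_all_finset W).2 h).exists
  exact ⟨E n, E.isCompact n, hn⟩

theorem absPair_le_of_concentrated {f w : Lp ℂ 2 (leb Ω)} {K : Set Ω} (hK : MeasurableSet K)
    {η : ℝ} (hη : 0 < η) (hf : ‖f‖ = 1) (hfK : ∫ y in K, ‖f y‖ ^ 2 ∂(leb Ω) ≤ η ^ 2)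
    (hwK : ∫ y in Kᶜ, ‖w y‖ ^ 2 ∂(leb Ω) ≤ η ^ 2) :
    absPair f w ≤ η * (3 + ‖w‖ ^ 2) := by
  have hi := integrable_absPair f w
  have hf2 := integrable_norm_sq_Lp f
  have hw2 := integrable_norm_sq_Lp w
  rw [absPair, ← integral_add_compl hK hi]
  have hη0 := hη.ne'
  have amgm : ∀ p q : ℝ, p * q ≤ η⁻¹ * p ^ 2 + η * q ^ 2 := fun p q => by
    have h1 : 0 ≤ η * (η⁻¹ * p - q) ^ 2 := by positivity
    have h2 : η * (η⁻¹ * p - q) ^ 2 = η⁻¹ * p ^ 2 - 2 * (p * q) + η * q ^ 2 := by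
      field_simp; ring
    have h3 : 0 ≤ η⁻¹ * p ^ 2 + η * q ^ 2 := by positivity
    linarith
  have hfull : ∀ (v : Lp ℂ 2 (leb Ω)) (S : Set Ω), ∫ y in S, ‖v y‖ ^ 2 ∂(leb Ω) ≤ ‖v‖ ^ 2 :=
    fun v S => by
      rw [norm_sq_eq_integral]
      exact setIntegral_le_integral (integrable_norm_sq_Lp v) (ae_of_all _ fun _ => by positivity)
  have h1 : ∫ y in K, ‖f y‖ * ‖w y‖ ∂(leb Ω) ≤ η + η * ‖w‖ ^ 2 := by
    calc _ ≤ ∫ y in K, (η⁻¹ * ‖f y‖ ^ 2 + η * ‖w y‖ ^ 2) ∂(leb Ω) :=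
          integral_mono hi.integrableOn
            (Integrable.fun_add (hf2.const_mul η⁻¹) (hw2.const_mul η)).integrableOn
            fun y => amgm _ _
      _ = η⁻¹ * ∫ y in K, ‖f y‖ ^ 2 ∂(leb Ω) + η * ∫ y in K, ‖w y‖ ^ 2 ∂(leb Ω) := by
          rw [integral_add (hf2.const_mul _).integrableOn (hw2.const_mul _).integrableOn,
            integral_const_mul, integral_const_mul]
      _ ≤ η⁻¹ * η ^ 2 + η * ‖w‖ ^ 2 := by gcongr; exact hfull w K
      _ = _ := by field_simp
  have h2 : ∫ y in Kᶜ, ‖f y‖ * ‖w y‖ ∂(leb Ω) ≤ 2 * η := by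
    calc _ ≤ ∫ y in Kᶜ, (η⁻¹ * ‖w y‖ ^ 2 + η * ‖f y‖ ^ 2) ∂(leb Ω) :=
          integral_mono hi.integrableOn
            (Integrable.fun_add (hw2.const_mul η⁻¹) (hf2.const_mul η)).integrableOn fun y => by
              rw [mul_comm]; exact amgm _ _
      _ = η⁻¹ * ∫ y in Kᶜ, ‖w y‖ ^ 2 ∂(leb Ω) + η * ∫ y in Kᶜ, ‖f y‖ ^ 2 ∂(leb Ω) := by
          rw [integral_add (hw2.const_mul _).integrableOn (hf2.const_mul _).integrableOn,
            integral_const_mul, integral_const_mul]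
      _ ≤ η⁻¹ * η ^ 2 + η * ‖f‖ ^ 2 := by gcongr; exact hfull f Kᶜ
      _ = _ := by rw [hf]; field_simp; ring
  linarith

/-- Weighted Cauchy-Schwarz inequality. -/
theorem sq_integral_le_mul_integral {α : Type*} {m : MeasurableSpace α} {ν : Measure α}
    {p g c : α → ℝ} (hg : ∀ z, 0 ≤ g z) (hgp : ∀ᵐ z ∂ν, g z = 0 → p z = 0)
    (hQ : Integrable (fun z => p z ^ 2 / g z) ν) (hI : Integrable (fun z => p z * c z) ν)
    (hJ : Integrable (fun z => g z * c z ^ 2) ν) :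
    (∫ z, p z * c z ∂ν) ^ 2 ≤ (∫ z, p z ^ 2 / g z ∂ν) * ∫ z, g z * c z ^ 2 ∂ν := by
  have key : ∀ l : ℝ, 0 ≤ (∫ z, p z ^ 2 / g z ∂ν) * (l * l) + (-2 * ∫ z, p z * c z ∂ν) * l +
      ∫ z, g z * c z ^ 2 ∂ν := fun l => by
    have h1 : 0 ≤ ∫ z, ((l * l) * (p z ^ 2 / g z) + (-2 * l) * (p z * c z) + g z * c z ^ 2) ∂ν := by
      refine integral_nonneg_of_ae ?_
      filter_upwards [hgp] with z hz
      rcases (hg z).eq_or_lt with h0 | h0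
      · simp [← h0, hz h0.symm]
      · have : l * l * (p z ^ 2 / g z) + -2 * l * (p z * c z) + g z * c z ^ 2 =
            (l * p z - g z * c z) ^ 2 / g z := by
          field_simp; ring
        rw [Pi.zero_apply, this]
        positivity
    rw [integral_add (Integrable.fun_add (hQ.const_mul _) (hI.const_mul _)) hJ,
      integral_add (hQ.const_mul _) (hI.const_mul _), integral_const_mul, integral_const_mul] at h1
    linarith
  have := discrim_le_zero key
  rw [discrim] at this
  nlinarith

variable {A : Subalgebra ℂ (HInfty Ω)}

theorem UnitBall.integral_norm_sub_sq_le (ψ : UnitBall A) (ρ : Measure Ω)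
    [IsProbabilityMeasure ρ] (z : Ω) {δ : ℝ}
    (h : ‖∫ x, (ψ.fn : Ω → ℂ) x ∂ρ - (ψ.fn : Ω → ℂ) z‖ ≤ δ) :
    ∫ x, ‖(ψ.fn : Ω → ℂ) x - (ψ.fn : Ω → ℂ) z‖ ^ 2 ∂ρ ≤
      ∫ x, ‖(ψ.fn : Ω → ℂ) x‖ ^ 2 ∂ρ - ‖(ψ.fn : Ω → ℂ) z‖ ^ 2 + 2 * δ := by
  set c := (ψ.fn : Ω → ℂ) z with hc
  have hexp : ∀ x, ‖(ψ.fn : Ω → ℂ) x - c‖ ^ 2 =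
      ‖(ψ.fn : Ω → ℂ) x‖ ^ 2 + (-2) * (conj c * (ψ.fn : Ω → ℂ) x).re + ‖c‖ ^ 2 := fun x => by
    rw [@norm_sub_sq ℂ, ← inner_conj_symm]
    simp [RCLike.inner_apply]; ring
  have hi1 := ψ.integrable_norm_sq ρ
  have hi2 : Integrable (fun x => (conj c * (ψ.fn : Ω → ℂ) x).re) ρ :=
    ((ψ.integrable ρ).const_mul (conj c)).re
  have hre : ∫ x, (conj c * (ψ.fn : Ω → ℂ) x).re ∂ρ =
      (conj c * ∫ x, (ψ.fn : Ω → ℂ) x ∂ρ).re := by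
    have := integral_re ((ψ.integrable ρ).const_mul (conj c))
    rw [integral_const_mul] at this
    exact this
  simp only [hexp]
  rw [integral_add (Integrable.fun_add hi1 (hi2.const_mul _)) (integrable_const _),
    integral_add hi1 (hi2.const_mul _), integral_const_mul, hre, integral_const]
  have h1 : (conj c * ∫ x, (ψ.fn : Ω → ℂ) x ∂ρ).re =
      ‖c‖ ^ 2 + (conj c * (∫ x, (ψ.fn : Ω → ℂ) x ∂ρ - c)).re := by
    rw [mul_sub, Complex.sub_re, mul_comm (conj c) c, Complex.mul_conj, Complex.ofReal_re,
      Complex.normSq_eq_norm_sq]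
    ring
  have h2 : |(conj c * (∫ x, (ψ.fn : Ω → ℂ) x ∂ρ - c)).re| ≤ δ := by
    refine (Complex.abs_re_le_norm _).trans ?_
    rw [norm_mul, RCLike.norm_conj]
    exact (mul_le_of_le_one_left (norm_nonneg _) (ψ.le_one z)).trans h
  have h3 := (abs_le.1 h2).1
  simp only [probReal_univ, one_smul]
  linarith

theorem evSq_mem_energyApprox_one (hΩ : IsOpen Ω) (hc : IsConnected Ω)
    (hb : Bornology.IsBounded Ω) (i : Fin d) (z : Ω) : evSq A z ∈ EnergyApprox A 1 := by
  intro W ε hε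
  have hfin := isFiniteMeasure_leb hΩ hb
  set M : ℝ := ∑ w ∈ W, ‖w‖ ^ 2 with hM
  have hM0 : 0 ≤ M := Finset.sum_nonneg fun _ _ => by positivity
  set η : ℝ := ε / (3 + M) with hη
  have hη0 : 0 < η := by positivity
  have hηw : ∀ w ∈ W, η * (3 + ‖w‖ ^ 2) ≤ ε := fun w hw => by
    have : ‖w‖ ^ 2 ≤ M := Finset.single_le_sum (f := fun w : Lp ℂ 2 (leb Ω) => ‖w‖ ^ 2)
      (fun _ _ => by positivity) hw
    calc _ ≤ η * (3 + M) := by gcongr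
      _ = ε := by rw [hη]; field_simp
  set δ : ℝ := ε / 48 with hδ
  have hδ0 : 0 < δ := by positivity
  obtain ⟨K, hK, hKW⟩ := exists_compact_forall_setIntegral_compl_le hΩ hb W
    (show 0 < η ^ 2 by positivity)
  obtain ⟨y, hy, hyz⟩ := Metric.mem_closure_iff.1
    (ev_mem_closure_convexHull (A := A) hΩ hc hb i hK (show 0 < η ^ 2 / 4 by positivity) z) δ hδ0
  rw [convexHull_eq] at hy
  obtain ⟨ι, t, w, ys, hw, hw1, hys, hyc⟩ := hy
  rw [Finset.centerMass_eq_of_sum_1 _ _ hw1] at hyc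
  choose! x hxB hx1 hxK hxy using hys
  set g : Ω → ℝ := fun z => ∑ i ∈ t, w i * ‖x i z‖ ^ 2 with hg
  have hg0 : ∀ z, 0 ≤ g z := fun z =>
    Finset.sum_nonneg fun i hi => mul_nonneg (hw i hi) (by positivity)
  obtain ⟨f, hfB, hf1, hfK, hfg, hQi, hQ⟩ := exists_signed_combination t hw hw1 hxB hx1
    (show 0 < η ^ 2 / 4 by positivity) hxK (fun z => rfl : ∀ z, g z = _)
  have hgm : Measurable g := by
    refine Finset.measurable_fun_sum _ fun i _ => ?_
    exact (((Lp.stronglyMeasurable (x i)).norm.measurable).pow_const 2).const_mul _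
  have hgint : Integrable g (leb Ω) :=
    integrable_finsetSum _ fun i _ => (integrable_norm_sq_Lp _).const_mul _
  have hgtot : ∫ z, g z ∂(leb Ω) = 1 := by
    rw [hg, integral_finsetSum _ fun i _ => (integrable_norm_sq_Lp _).const_mul _, ← hw1]
    refine Finset.sum_congr rfl fun i hi => ?_
    rw [integral_const_mul, ← norm_sq_eq_integral, hx1 i hi]; ring
  set ρ : Measure Ω := (leb Ω).withDensity fun z => ENNReal.ofReal (g z) with hρ
  have hprob : IsProbabilityMeasure ρ := ⟨by
    rw [hρ, withDensity_apply _ MeasurableSet.univ, Measure.restrict_univ,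
      ← ofReal_integral_eq_lintegral_ofReal hgint (ae_of_all _ hg0), hgtot, ENNReal.ofReal_one]⟩
  have hρint : ∀ {E : Type} [NormedAddCommGroup E] [NormedSpace ℝ E] (h : Ω → E),
      ∫ z, h z ∂ρ = ∫ z, g z • h z ∂(leb Ω) := fun h => by
    rw [hρ, integral_withDensity_eq_integral_toReal_smul hgm.ennreal_ofReal
      (ae_of_all _ fun z => ENNReal.ofReal_lt_top)]
    simp only [ENNReal.toReal_ofReal (hg0 _)]
  have hmean : ∀ ψ : UnitBall A, ∫ z, (ψ.fn : Ω → ℂ) z ∂ρ = y ψ := fun ψ => by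
    have hev : y ψ = ∑ i ∈ t, w i • ys i ψ := by
      rw [← hyc, BoundedContinuousFunction.sum_apply]; rfl
    rw [hρint, hev]
    have h1 : ∀ i ∈ t, w i • ys i ψ =
        ∫ z, w i • (x i z * conj (x i z) * (ψ.fn : Ω → ℂ) z) ∂(leb Ω) := fun i hi => by
      rw [← hxy i hi, rankOne_apply hΩ, integral_smul]
    rw [Finset.sum_congr rfl h1, ← integral_finsetSum]
    · refine integral_congr_ae (ae_of_all _ fun z => ?_)
      simp only [hg, Finset.sum_smul]
      refine Finset.sum_congr rfl fun i _ => ?_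
      rw [Complex.mul_conj, Complex.normSq_eq_norm_sq, mul_smul, ← Complex.real_smul]
    · intro i _
      refine Integrable.smul (w i) ?_
      exact (integrable_mul_conj (x i) (x i)).mul_bdd
        (Holo.continuous ψ.fn.2.1).aestronglyMeasurable (ae_of_all _ ψ.le_one)
  have hlin : ∀ ψ : UnitBall A, ‖∫ z, (ψ.fn : Ω → ℂ) z ∂ρ - (ψ.fn : Ω → ℂ) z‖ ≤ δ := fun ψ => by
    rw [hmean, norm_sub_rev, ← dist_eq_norm]
    exact (BoundedContinuousFunction.dist_coe_le_dist (f := ev A z) (g := y) ψ).trans hyz.le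
  refine ⟨f, hfB, ρ, hprob, by rw [hf1]; linarith, fun w hw => ?_, fun ψ => ?_, fun ψ => ?_⟩
  · exact (absPair_le_of_concentrated hK.measurableSet hη0 hf1 (hfK.trans_eq (by ring))
      (hKW w hw)).trans (hηw w hw)
  · exact (hlin ψ).trans (by rw [hδ]; linarith)
  · change ((1 : ℕ) : ℝ) * ‖rankOne A f f ψ - (ψ.fn : Ω → ℂ) z‖ ^ 2 ≤
      24 * (∫ x, ‖(ψ.fn : Ω → ℂ) x‖ ^ 2 ∂ρ - ‖(ψ.fn : Ω → ℂ) z‖ ^ 2) + ε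
    set c : Ω → ℝ := fun x => ‖(ψ.fn : Ω → ℂ) x - (ψ.fn : Ω → ℂ) z‖ with hcdef
    have hcc : Continuous c := ((Holo.continuous ψ.fn.2.1).sub continuous_const).norm
    have hc2 : ∀ x, ‖c x‖ ≤ 2 := fun x => by
      rw [hcdef, norm_norm]
      exact (norm_sub_le _ _).trans (by linarith [ψ.le_one x, ψ.le_one z])
    have hf2 := integrable_norm_sq_Lp f
    have hIint : Integrable (fun x => ‖f x‖ ^ 2 * c x) (leb Ω) :=
      hf2.mul_bdd hcc.aestronglyMeasurable (ae_of_all _ hc2)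
    have hJint : Integrable (fun x => g x * c x ^ 2) (leb Ω) :=
      hgint.mul_bdd (c := 4) (hcc.pow 2).aestronglyMeasurable (ae_of_all _ fun x => by
        rw [norm_pow]; nlinarith [hc2 x, norm_nonneg (c x)])
    have hp4 : ∀ x, ‖f x‖ ^ 4 / g x = (‖f x‖ ^ 2) ^ 2 / g x := fun x => by ring
    simp only [hp4] at hQi hQ
    have hCS := sq_integral_le_mul_integral hg0 (hfg.mono fun x hx h0 => by rw [hx h0]; simp)
      hQi hIint hJint
    have hJ : ∫ x, g x * c x ^ 2 ∂(leb Ω) ≤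
        ∫ x, ‖(ψ.fn : Ω → ℂ) x‖ ^ 2 ∂ρ - ‖(ψ.fn : Ω → ℂ) z‖ ^ 2 + 2 * δ := by
      have := ψ.integral_norm_sub_sq_le ρ z (hlin ψ)
      rwa [hρint] at this
    have hJ0 : 0 ≤ ∫ x, g x * c x ^ 2 ∂(leb Ω) :=
      integral_nonneg fun x => mul_nonneg (hg0 x) (by positivity)
    have hle : ‖rankOne A f f ψ - (ψ.fn : Ω → ℂ) z‖ ≤ ∫ x, ‖f x‖ ^ 2 * c x ∂(leb Ω) := by
      have h1 : rankOne A f f ψ - (ψ.fn : Ω → ℂ) z =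
          ∫ x, f x * conj (f x) * ((ψ.fn : Ω → ℂ) x - (ψ.fn : Ω → ℂ) z) ∂(leb Ω) := by
        simp only [mul_sub]
        rw [integral_sub, rankOne_apply hΩ, integral_mul_const]
        · have h2 : ∫ x, f x * conj (f x) ∂(leb Ω) = 1 := by
            have h3 : ∀ x, f x * conj (f x) = ((‖f x‖ ^ 2 : ℝ) : ℂ) := fun x => by
              rw [Complex.mul_conj, Complex.normSq_eq_norm_sq]
            simp only [h3]
            rw [integral_complex_ofReal, ← norm_sq_eq_integral, hf1]; simp
          rw [h2, one_mul]
        · exact (integrable_mul_conj f f).mul_bdd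
            (Holo.continuous ψ.fn.2.1).aestronglyMeasurable (ae_of_all _ ψ.le_one)
        · exact (integrable_mul_conj f f).mul_const _
      rw [h1]
      refine norm_integral_le_of_norm_le hIint (ae_of_all _ fun x => ?_)
      rw [norm_mul, norm_mul, RCLike.norm_conj, ← pow_two]
    have hsq : ‖rankOne A f f ψ - (ψ.fn : Ω → ℂ) z‖ ^ 2 ≤ (∫ x, ‖f x‖ ^ 2 * c x ∂(leb Ω)) ^ 2 := by
      gcongr
    have h24 : (∫ x, (‖f x‖ ^ 2) ^ 2 / g x ∂(leb Ω)) * ∫ x, g x * c x ^ 2 ∂(leb Ω) ≤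
        24 * ∫ x, g x * c x ^ 2 ∂(leb Ω) := by gcongr
    rw [Nat.cast_one, one_mul]
    have hδε : 48 * δ = ε := by rw [hδ]; ring
    linarith

end EnergyBase

theorem exists_clm_comp_eq {V E : Type*} [AddCommGroup V] [Module ℂ V] [NormedAddCommGroup E]
    [NormedSpace ℂ E] (T : V →ₗ[ℂ] E) (ℓ : V →ₗ[ℂ] ℂ) {C : ℝ} (hC : 0 ≤ C)
    (h : ∀ v, ‖ℓ v‖ ≤ C * ‖T v‖) : ∃ Λ : E →L[ℂ] ℂ, ‖Λ‖ ≤ C ∧ ∀ v, Λ (T v) = ℓ v := by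
  obtain ⟨g, hg⟩ :=
    T.rangeRestrict.exists_rightInverse_of_surjective (LinearMap.range_rangeRestrict T)
  have hgT : ∀ u : LinearMap.range T, T (g u) = u := fun u =>
    congrArg Subtype.val (LinearMap.congr_fun hg u)
  have hb : ∀ u : LinearMap.range T, ‖(ℓ.comp g) u‖ ≤ C * ‖u‖ := fun u => by
    have := h (g u)
    rwa [hgT] at this
  obtain ⟨Λ, hΛ, hn⟩ := exists_extension_norm_eq (LinearMap.range T)
    ((ℓ.comp g).mkContinuous C hb)
  refine ⟨Λ, hn.le.trans (LinearMap.mkContinuous_norm_le _ hC _), fun v => ?_⟩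
  have h1 : Λ (T v) = ℓ (g ⟨T v, v, rfl⟩) := hΛ ⟨T v, v, rfl⟩
  have h2 := h (g ⟨T v, v, rfl⟩ - v)
  rw [map_sub T, hgT, sub_self, norm_zero, mul_zero, norm_le_zero_iff, map_sub, sub_eq_zero] at h2
  rw [h1, h2]

theorem posSemidef_gram_sub_iff {H : Type*} [NormedAddCommGroup H] [InnerProductSpace ℂ H] {n : ℕ}
    (w : Fin n → ℂ) (k : Fin n → H) :
    (Matrix.of fun i j : Fin n => (1 - w i * conj (w j)) * inner ℂ (k i) (k j)).PosSemidef ↔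
      ∀ x : Fin n → ℂ, ‖∑ j, (x j * conj (w j)) • k j‖ ≤ ‖∑ j, x j • k j‖ := by
  have hin : ∀ x : Fin n → ℂ, ((‖∑ j, x j • k j‖ ^ 2 : ℝ) : ℂ) =
      ∑ i, ∑ j, conj (x i) * (x j * inner ℂ (k i) (k j)) := fun x => by
    have h := inner_self_eq_norm_sq_to_K (𝕜 := ℂ) (∑ j, x j • k j)
    rw [Complex.ofReal_pow]
    refine h.symm.trans ?_
    simp only [sum_inner, inner_sum, inner_smul_left, inner_smul_right, Finset.mul_sum]
    rw [Finset.sum_comm]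
    exact Finset.sum_congr rfl fun i _ => Finset.sum_congr rfl fun j _ => by ring
  have hq : ∀ x : Fin n → ℂ, star x ⬝ᵥ ((Matrix.of fun i j : Fin n =>
      (1 - w i * conj (w j)) * inner ℂ (k i) (k j)).mulVec x) =
      ((‖∑ j, x j • k j‖ ^ 2 - ‖∑ j, (x j * conj (w j)) • k j‖ ^ 2 : ℝ) : ℂ) := fun x => by
    rw [Complex.ofReal_sub, hin, hin, ← Finset.sum_sub_distrib]
    refine Finset.sum_congr rfl fun i _ => ?_
    rw [Matrix.mulVec, dotProduct, Finset.mul_sum, ← Finset.sum_sub_distrib]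
    refine Finset.sum_congr rfl fun j _ => ?_
    simp only [Matrix.of_apply, Pi.star_apply, RCLike.star_def, map_mul, Complex.conj_conj]
    ring
  rw [Matrix.posSemidef_iff_dotProduct_mulVec]
  have hherm : (Matrix.of fun i j : Fin n =>
      (1 - w i * conj (w j)) * inner ℂ (k i) (k j)).IsHermitian := by
    ext i j
    simp [mul_comm]
  simp only [hherm, true_and, hq, Complex.zero_le_real, sub_nonneg]
  exact forall_congr' fun x => sq_le_sq₀ (norm_nonneg _) (norm_nonneg _)

section Kernel

variable {d : ℕ} {Ω : Set (Fin d → ℂ)}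

theorem kernelAt_mem_A2 {A : Subalgebra ℂ (HInfty Ω)} {ν : Measure Ω} (z : Ω) :
    kernelAt A ν z ∈ A2 A ν := by
  unfold kernelAt
  split_ifs with h
  · exact h.choose_spec.1
  · exact zero_mem _

theorem kernelAt_eq_zero {A : Subalgebra ℂ (HInfty Ω)} {ν : Measure Ω} {z : Ω}
    (h : ¬∃ k, Reproduces A ν z k) : kernelAt A ν z = 0 := by
  unfold kernelAt
  rw [dif_neg h]

theorem sum_smul_kernelAt_mem_A2 {A : Subalgebra ℂ (HInfty Ω)} {ν : Measure Ω} {n : ℕ}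
    (z : Fin n → Ω) (x : Fin n → ℂ) :
    ∑ j, x j • kernelAt A ν (z j) ∈ A2 A ν :=
  sum_mem fun j _ => Submodule.smul_mem _ _ (kernelAt_mem_A2 (z j))

theorem memLp_HInfty (ν : Measure Ω) [IsFiniteMeasure ν] (φ : HInfty Ω) :
    MemLp (φ : Ω → ℂ) 2 ν := by
  obtain ⟨hφ, C, hC⟩ := φ.2
  exact MemLp.of_bound (Holo.continuous hφ).aestronglyMeasurable C (ae_of_all _ hC)

/-- The class of a bounded holomorphic function in `L²(ν)`. -/
def toL2 (ν : Measure Ω) [IsFiniteMeasure ν] : HInfty Ω →ₗ[ℂ] Lp ℂ 2 ν where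
  toFun φ := (memLp_HInfty ν φ).toLp _
  map_add' _ _ := rfl
  map_smul' _ _ := rfl

variable (ν : Measure Ω) [IsFiniteMeasure ν]

theorem coeFn_toL2 (φ : HInfty Ω) : ⇑(toL2 ν φ) =ᵐ[ν] (φ : Ω → ℂ) := 
  MemLp.coeFn_toLp (memLp_HInfty ν φ)

theorem norm_toL2 (φ : HInfty Ω) : ‖toL2 ν φ‖ = (eLpNorm (φ : Ω → ℂ) 2 ν).toReal :=
  Lp.norm_toLp _ (memLp_HInfty ν φ)

theorem norm_toL2_mul_le (χ φ : HInfty Ω) {C : ℝ} (hC : ∀ x, ‖(χ : Ω → ℂ) x‖ ≤ C) :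
    ‖toL2 ν (χ * φ)‖ ≤ C * ‖toL2 ν φ‖ := by
  refine Lp.norm_le_mul_norm_of_ae_le_mul ?_
  filter_upwards [coeFn_toL2 ν (χ * φ), coeFn_toL2 ν φ] with x h1 h2
  rw [h1, h2]
  change ‖(χ : Ω → ℂ) x * (φ : Ω → ℂ) x‖ ≤ _
  rw [norm_mul]
  exact mul_le_mul_of_nonneg_right (hC x) (norm_nonneg _)

theorem toL2_mem_A2 {A : Subalgebra ℂ (HInfty Ω)} {φ : HInfty Ω} (hφ : φ ∈ A) :
    toL2 ν φ ∈ A2 A ν :=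
  Submodule.le_topologicalClosure _ ⟨φ, hφ, coeFn_toL2 ν φ⟩

theorem eq_toL2 {g : Lp ℂ 2 ν} {φ : HInfty Ω} (h : ⇑g =ᵐ[ν] (φ : Ω → ℂ)) : g = toL2 ν φ :=
  Lp.ext (h.trans (coeFn_toL2 ν φ).symm)

variable {ν} {A : Subalgebra ℂ (HInfty Ω)}

theorem reproduces_iff {z : Ω} {k : Lp ℂ 2 ν} :
    Reproduces A ν z k ↔
      k ∈ A2 A ν ∧ ∀ φ ∈ A, inner ℂ k (toL2 ν φ) = (φ : Ω → ℂ) z := by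
  refine and_congr_right fun _ => ⟨fun h φ hφ => h φ hφ _ (coeFn_toL2 ν φ), fun h φ hφ g hg => ?_⟩
  rw [eq_toL2 ν hg, h φ hφ]

theorem norm_le_of_forall_inner_toL2 {v : Lp ℂ 2 ν} (hv : v ∈ A2 A ν) {C : ℝ} (hC : 0 ≤ C)
    (h : ∀ φ ∈ A, ‖inner ℂ v (toL2 ν φ)‖ ≤ C * ‖toL2 ν φ‖) : ‖v‖ ≤ C := by
  have hcl : IsClosed {g : Lp ℂ 2 ν | ‖inner ℂ v g‖ ≤ C * ‖g‖} :=
    isClosed_le (by fun_prop) (by fun_prop)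
  have hsub : (classes A ν : Set (Lp ℂ 2 ν)) ⊆ {g : Lp ℂ 2 ν | ‖inner ℂ v g‖ ≤ C * ‖g‖} := by
    rintro g ⟨φ, hφ, hg⟩
    rw [eq_toL2 ν hg]
    exact h φ hφ
  have h1 : ‖inner ℂ v v‖ ≤ C * ‖v‖ := closure_minimal hsub hcl hv
  rw [← inner_self_re_eq_norm, inner_self_eq_norm_mul_norm] at h1
  rcases (norm_nonneg v).eq_or_lt with h0 | h0
  · exact h0 ▸ hC
  · exact le_of_mul_le_mul_right h1 h0

theorem eq_zero_of_forall_inner_toL2 {v : Lp ℂ 2 ν} (hv : v ∈ A2 A ν)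
    (h : ∀ φ ∈ A, inner ℂ v (toL2 ν φ) = 0) : v = 0 := by
  have := norm_le_of_forall_inner_toL2 hv le_rfl fun φ hφ => by rw [h φ hφ]; simp
  exact norm_le_zero_iff.1 this

theorem exists_reproduces_of_bounded {z : Ω} {C : ℝ} (hC : 0 ≤ C)
    (h : ∀ φ ∈ A, ‖(φ : Ω → ℂ) z‖ ≤ C * ‖toL2 ν φ‖) : ∃ k, Reproduces A ν z k := by
  let ℓ : Subalgebra.toSubmodule A →ₗ[ℂ] ℂ :=
    { toFun := fun φ => ((φ : HInfty Ω) : Ω → ℂ) z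
      map_add' := fun _ _ => rfl
      map_smul' := fun _ _ => rfl }
  obtain ⟨Λ, -, hΛ⟩ := exists_clm_comp_eq (V := Subalgebra.toSubmodule A)
    ((toL2 ν).comp (Subalgebra.toSubmodule A).subtype) ℓ hC
    fun φ => h φ φ.2
  have : CompleteSpace (A2 A ν) := (Submodule.isClosed_topologicalClosure _).completeSpace_coe
  set k := (InnerProductSpace.toDual ℂ (Lp ℂ 2 ν)).symm Λ with hk
  refine ⟨(A2 A ν).starProjection k, reproduces_iff.2 ⟨Submodule.starProjection_apply_mem _ _,
    fun φ hφ => ?_⟩⟩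
  rw [Submodule.inner_starProjection_left_eq_right,
    Submodule.starProjection_eq_self_iff.2 (toL2_mem_A2 ν hφ), hk,
    InnerProductSpace.toDual_symm_apply]
  exact hΛ ⟨φ, hφ⟩

theorem inner_kernelAt_toL2 {z : Ω} (h : ∃ k, Reproduces A ν z k) {φ : HInfty Ω} (hφ : φ ∈ A) :
    inner ℂ (kernelAt A ν z) (toL2 ν φ) = (φ : Ω → ℂ) z := by
  unfold kernelAt
  rw [dif_pos h]
  exact (reproduces_iff.1 h.choose_spec).2 φ hφ

theorem inner_kernelAt_toL2_mul (z : Ω) {φ ψ : HInfty Ω} (hφ : φ ∈ A) (hψ : ψ ∈ A) :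
    inner ℂ (kernelAt A ν z) (toL2 ν (φ * ψ)) =
      (φ : Ω → ℂ) z * inner ℂ (kernelAt A ν z) (toL2 ν ψ) := by
  by_cases h : ∃ k, Reproduces A ν z k
  · rw [inner_kernelAt_toL2 h hψ, inner_kernelAt_toL2 h (A.mul_mem hφ hψ)]
    rfl
  · simp [kernelAt_eq_zero h]

theorem posSemidef_of_interpolates {n : ℕ} (z : Fin n → Ω) {φ : HInfty Ω} (hφ : φ ∈ A)
    (hφ1 : ∀ x, ‖(φ : Ω → ℂ) x‖ ≤ 1) :
    (Matrix.of fun i j : Fin n => (1 - (φ : Ω → ℂ) (z i) * conj ((φ : Ω → ℂ) (z j))) *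
      kernel A ν (z i) (z j)).PosSemidef := by
  refine (posSemidef_gram_sub_iff _ _).2 fun x => ?_
  refine norm_le_of_forall_inner_toL2 (A := A) (sum_smul_kernelAt_mem_A2 z _) (norm_nonneg _)
    fun ψ hψ => ?_
  have : inner ℂ (∑ j, (x j * conj ((φ : Ω → ℂ) (z j))) • kernelAt A ν (z j)) (toL2 ν ψ) =
      inner ℂ (∑ j, x j • kernelAt A ν (z j)) (toL2 ν (φ * ψ)) := by
    simp only [sum_inner, inner_smul_left, inner_kernelAt_toL2_mul _ hφ hψ, map_mul,
      Complex.conj_conj, mul_assoc]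
  rw [this]
  refine (norm_inner_le_norm _ _).trans (mul_le_mul_of_nonneg_left ?_ (norm_nonneg _))
  simpa using norm_toL2_mul_le ν φ ψ hφ1

/-- A bounded combination of unbounded evaluations has coefficients that sum to zero. -/
theorem sum_eq_zero_of_bounded {ι : Type*} [DecidableEq ι] (z : ι → Ω) (T : Finset ι) :
    ∀ a : ι → ℂ, (∀ i ∈ T, ¬∃ k, Reproduces A ν (z i) k) →
      (∃ C : ℝ, 0 ≤ C ∧ ∀ φ ∈ A, ‖∑ i ∈ T, a i * (φ : Ω → ℂ) (z i)‖ ≤ C * ‖toL2 ν φ‖) →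
      ∑ i ∈ T, a i = 0 := by
  induction T using Finset.strongInduction with
  | H T ih =>
    rintro a hT ⟨C, hC, hb⟩
    by_cases hsep : ∃ χ ∈ A, ∃ i ∈ T, ∃ l ∈ T, (χ : Ω → ℂ) (z i) ≠ (χ : Ω → ℂ) (z l)
    · obtain ⟨χ, hχ, i, hi, l, hl, hne⟩ := hsep
      have key : ∀ m ∈ T, ∑ j ∈ T, a j * ((χ : Ω → ℂ) (z j) - (χ : Ω → ℂ) (z m)) = 0 := by
        intro m hm
        set χ' : HInfty Ω := χ - algebraMap ℂ (HInfty Ω) ((χ : Ω → ℂ) (z m)) with hχ'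
        have hχ'A : χ' ∈ A := A.sub_mem hχ (A.algebraMap_mem _)
        have hval : ∀ x, (χ' : Ω → ℂ) x = (χ : Ω → ℂ) x - (χ : Ω → ℂ) (z m) := fun x => rfl
        obtain ⟨D, hD⟩ := χ'.2.2
        have hD0 : 0 ≤ D := (norm_nonneg _).trans (hD (z m))
        have herase : ∀ b : ι → ℂ, ∑ j ∈ T.erase m, a j * ((χ : Ω → ℂ) (z j) -
            (χ : Ω → ℂ) (z m)) * b j = ∑ j ∈ T, a j * ((χ : Ω → ℂ) (z j) -
            (χ : Ω → ℂ) (z m)) * b j := fun b => Finset.sum_erase _ (by simp)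
        have h := ih (T.erase m) (Finset.erase_ssubset hm)
          (fun j => a j * ((χ : Ω → ℂ) (z j) - (χ : Ω → ℂ) (z m)))
          (fun j hj => hT j (Finset.mem_of_mem_erase hj)) ⟨C * D, by positivity, fun φ hφ => by
            rw [herase]
            have h1 := hb (χ' * φ) (A.mul_mem hχ'A hφ)
            have h2 := norm_toL2_mul_le ν χ' φ hD
            have h3 : ∑ j ∈ T, a j * ((χ' * φ : HInfty Ω) : Ω → ℂ) (z j) =
                ∑ j ∈ T, a j * ((χ : Ω → ℂ) (z j) - (χ : Ω → ℂ) (z m)) * (φ : Ω → ℂ) (z j) :=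
              Finset.sum_congr rfl fun j _ => by rw [mul_assoc, ← hval]; rfl
            rw [← h3, mul_assoc]
            exact h1.trans (mul_le_mul_of_nonneg_left h2 hC)⟩
        have := herase fun _ => 1
        simp only [mul_one] at this
        rwa [← this]
      have h1 := key i hi
      have h2 := key l hl
      have h3 : (∑ j ∈ T, a j) * ((χ : Ω → ℂ) (z i) - (χ : Ω → ℂ) (z l)) = 0 := by
        rw [← sub_eq_zero.2 (h2.trans h1.symm), Finset.sum_mul, ← Finset.sum_sub_distrib]
        exact Finset.sum_congr rfl fun j _ => by ring
      exact (mul_eq_zero.1 h3).resolve_right (sub_ne_zero.2 hne)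
    · push Not at hsep
      rcases T.eq_empty_or_nonempty with rfl | ⟨i, hi⟩
      · simp
      by_contra hs
      refine hT i hi (exists_reproduces_of_bounded (C := ‖∑ j ∈ T, a j‖⁻¹ * C) (by positivity)
        fun φ hφ => ?_)
      have h1 := hb φ hφ
      have h2 : ∑ j ∈ T, a j * (φ : Ω → ℂ) (z j) = (∑ j ∈ T, a j) * (φ : Ω → ℂ) (z i) := by
        rw [Finset.sum_mul]
        exact Finset.sum_congr rfl fun j hj => by rw [hsep φ hφ j hj i hi]
      rw [h2, norm_mul] at h1
      rw [mul_assoc]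
      exact (le_inv_mul_iff₀ (norm_pos_iff.2 hs)).2 h1

end Kernel

section Interpolation

variable {d : ℕ} {Ω : Set (Fin d → ℂ)} {A : Subalgebra ℂ (HInfty Ω)}

theorem exists_reproduces_leb (hΩ : IsOpen Ω) (hb : Bornology.IsBounded Ω) (z : Ω) :
    ∃ k, Reproduces A (leb Ω) z k := by
  have := isFiniteMeasure_leb hΩ hb
  obtain ⟨r, hr, -, C, hC, h⟩ := exists_norm_le_mul_eLpNorm hΩ hb z.2
  refine exists_reproduces_of_bounded hC fun φ _ => ?_
  rw [norm_toL2]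
  exact h φ ⟨φ.2.1, memLp_HInfty _ φ⟩ z (mem_ball_self hr)

theorem sqMeasure_one : sqMeasure (fun _ : Ω => (1 : ℂ)) = leb Ω := by
  simp [sqMeasure]

theorem isFiniteMeasure_sqMeasure {f : Ω → ℂ} (hf : MemLp f 2 (leb Ω)) :
    IsFiniteMeasure (sqMeasure f) := by
  refine isFiniteMeasure_withDensity ?_
  have := lintegral_rpow_enorm_lt_top_of_eLpNorm_lt_top two_ne_zero ENNReal.ofNat_ne_top hf.2
  simpa using this.ne

variable {n : ℕ} {z : Fin n → Ω} {w : Fin n → ℂ}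

/-- A linear relation between the evaluations at the nodes also holds between the targets. -/
theorem sum_mul_eq_zero_of_posSemidef (hΩ : IsOpen Ω) (hb : Bornology.IsBounded Ω)
    (H : (Matrix.of fun i j : Fin n => (1 - w i * conj (w j)) *
      kernel A (leb Ω) (z i) (z j)).PosSemidef) {u : Fin n → ℂ}
    (hu : ∀ φ ∈ A, ∑ i, u i * (φ : Ω → ℂ) (z i) = 0) : ∑ i, u i * w i = 0 := by
  have := isFiniteMeasure_leb hΩ hb
  have hk := fun i => exists_reproduces_leb (A := A) hΩ hb (z i)
  have h0 : ∑ j, conj (u j) • kernelAt A (leb Ω) (z j) = 0 :=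
    eq_zero_of_forall_inner_toL2 (sum_smul_kernelAt_mem_A2 z _) fun φ hφ => by
      simpa only [sum_inner, inner_smul_left, Complex.conj_conj,
        inner_kernelAt_toL2 (hk _) hφ] using hu φ hφ
  have h1 := (posSemidef_gram_sub_iff _ _).1 H fun j => conj (u j)
  rw [h0, norm_zero, norm_le_zero_iff] at h1
  have h2 : inner ℂ (∑ j, (conj (u j) * conj (w j)) • kernelAt A (leb Ω) (z j))
      (toL2 (leb Ω) 1) = ∑ j, u j * w j := by
    simp only [sum_inner, inner_smul_left, map_mul, Complex.conj_conj,
        inner_kernelAt_toL2 (hk _) A.one_mem]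
    exact Finset.sum_congr rfl fun j _ => mul_one _
  rw [← h2, h1, inner_zero_left]

theorem norm_sum_mul_le_of_posSemidef (hΩ : IsOpen Ω) (hb : Bornology.IsBounded Ω)
    (H₁ : (Matrix.of fun i j : Fin n => (1 - w i * conj (w j)) *
      kernel A (leb Ω) (z i) (z j)).PosSemidef)
    {ν : Measure Ω} [IsFiniteMeasure ν]
    (H : (Matrix.of fun i j : Fin n => (1 - w i * conj (w j)) *
      kernel A ν (z i) (z j)).PosSemidef) {c : Fin n → ℂ} {G : Lp ℂ 2 ν}
    (hG : ∀ φ ∈ A, inner ℂ G (toL2 ν φ) = ∑ i, c i * (φ : Ω → ℂ) (z i)) :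
    ‖∑ i, c i * w i‖ ≤ ‖G‖ * ‖toL2 ν 1‖ := by
  classical
  set v := ∑ j, conj (c j) • kernelAt A ν (z j) with hv
  set S : Finset (Fin n) := Finset.univ.filter fun i => ¬∃ k, Reproduces A ν (z i) k with hS
  set u : Fin n → ℂ := fun i => if i ∈ S then c i else 0 with hu
  have hsplit : ∀ (i : Fin n) {φ : HInfty Ω}, φ ∈ A →
      inner ℂ (kernelAt A ν (z i)) (toL2 ν φ) = if i ∈ S then 0 else (φ : Ω → ℂ) (z i) := by
    intro i φ hφ
    by_cases hi : ∃ k, Reproduces A ν (z i) k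
    · rw [inner_kernelAt_toL2 hi hφ, if_neg (by simpa [hS] using hi)]
    · rw [kernelAt_eq_zero hi, inner_zero_left, if_pos (by simpa [hS] using hi)]
  have hU : ∀ φ ∈ A, inner ℂ (G - v) (toL2 ν φ) = ∑ i ∈ S, c i * (φ : Ω → ℂ) (z i) := by
    intro φ hφ
    rw [inner_sub_left, hG φ hφ, hv, sum_inner, ← Finset.sum_sub_distrib,
      ← Finset.sum_subset (Finset.subset_univ S) fun i _ hi => ?_]
    · exact Finset.sum_congr rfl fun i hi => by
        rw [inner_smul_left, hsplit i hφ, if_pos hi, mul_zero, sub_zero]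
    · rw [inner_smul_left, hsplit i hφ, if_neg hi, Complex.conj_conj, sub_self]
  have hzero : ∀ φ ∈ A, ∑ i ∈ S, c i * (φ : Ω → ℂ) (z i) = 0 := by
    intro φ hφ
    obtain ⟨D, hD⟩ := φ.2.2
    refine sum_eq_zero_of_bounded (A := A) (ν := ν) z S _ (fun i hi => by simpa [hS] using hi)
      ⟨‖G - v‖ * |D|, by positivity, fun ψ hψ => ?_⟩
    have h1 : ∑ i ∈ S, c i * (φ : Ω → ℂ) (z i) * (ψ : Ω → ℂ) (z i) =
        ∑ i ∈ S, c i * ((φ * ψ : HInfty Ω) : Ω → ℂ) (z i) :=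
      Finset.sum_congr rfl fun i _ => mul_assoc _ _ _
    rw [h1, ← hU _ (A.mul_mem hφ hψ), mul_assoc]
    exact (norm_inner_le_norm _ _).trans (mul_le_mul_of_nonneg_left
      (norm_toL2_mul_le ν φ ψ fun x => (hD x).trans (le_abs_self D)) (norm_nonneg _))
  have hSw : ∑ i, u i * w i = 0 := sum_mul_eq_zero_of_posSemidef hΩ hb H₁ fun φ hφ => by
    rw [← hzero φ hφ]
    simp [hu, ite_mul, Finset.sum_ite_mem]
  have hvG : ‖v‖ ≤ ‖G‖ := by
    refine norm_le_of_forall_inner_toL2 (A := A) (sum_smul_kernelAt_mem_A2 z _) (norm_nonneg _)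
      fun φ hφ => ?_
    have h1 := (hU φ hφ).trans (hzero φ hφ)
    rw [inner_sub_left, sub_eq_zero] at h1
    rw [← h1]
    exact norm_inner_le_norm _ _
  have hpair : inner ℂ (∑ j, (conj (c j) * conj (w j)) • kernelAt A ν (z j)) (toL2 ν 1) =
      ∑ j, c j * w j := by
    rw [← sub_zero (∑ j, c j * w j), ← hSw, ← Finset.sum_sub_distrib, sum_inner]
    refine Finset.sum_congr rfl fun j _ => ?_
    rw [inner_smul_left, hsplit j A.one_mem]
    by_cases hj : j ∈ S
    · simp [hu, hj]
    · simp [hu, hj]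
  rw [← hpair]
  refine (norm_inner_le_norm _ _).trans (mul_le_mul_of_nonneg_right ?_ (norm_nonneg _))
  exact ((posSemidef_gram_sub_iff _ _).1 H fun j => conj (c j)).trans hvG

end Interpolation

section Factorization

variable {d : ℕ} {Ω : Set (Fin d → ℂ)} {A : Subalgebra ℂ (HInfty Ω)}

theorem integral_sqMeasure {E : Type*} [NormedAddCommGroup E] [NormedSpace ℝ E] {F : Ω → ℂ}
    (hF : Continuous F) (h : Ω → E) :
    ∫ x, h x ∂(sqMeasure F) = ∫ x, ‖F x‖ ^ 2 • h x ∂(leb Ω) := by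
  rw [sqMeasure, integral_withDensity_eq_integral_toReal_smul (hF.enorm.measurable.pow_const 2)
    (ae_of_all _ fun x => ENNReal.pow_lt_top enorm_lt_top)]
  simp

theorem integrable_sqMeasure_iff {E : Type*} [NormedAddCommGroup E] [NormedSpace ℝ E] {F : Ω → ℂ}
    (hF : Continuous F) {h : Ω → E} :
    Integrable h (sqMeasure F) ↔ Integrable (fun x => ‖F x‖ ^ 2 • h x) (leb Ω) := by
  rw [sqMeasure, integrable_withDensity_iff_integrable_smul' (hF.enorm.measurable.pow_const 2)
    (ae_of_all _ fun x => ENNReal.pow_lt_top enorm_lt_top)]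
  simp

theorem norm_sq_mul_norm_div_sq_le (a b : ℂ) : ‖b‖ ^ 2 * ‖a / b‖ ^ 2 ≤ ‖a‖ ^ 2 := by
  by_cases hb : b = 0
  · simp [hb]
  · rw [norm_div, div_pow, mul_div_cancel₀ _ (by simpa using hb)]

/-- Division by `F` carries `L²(μ)` into `L²(|F|²μ)` contractively. -/
theorem exists_quotient_sqMeasure {F : Ω → ℂ} (hF : Continuous F) (g : Lp ℂ 2 (leb Ω)) :
    ∃ G : Lp ℂ 2 (sqMeasure F), ‖G‖ ≤ ‖g‖ ∧ ⇑G =ᵐ[sqMeasure F] fun x => g x / F x := by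
  have hac : sqMeasure F ≪ leb Ω := withDensity_absolutelyContinuous _ _
  have hint := integrable_norm_sq_Lp g
  have hm : AEStronglyMeasurable (fun x => g x / F x) (leb Ω) :=
    ((Lp.aestronglyMeasurable g).aemeasurable.div hF.aemeasurable).aestronglyMeasurable
  have hle : ∀ x, ‖F x‖ ^ 2 • ‖g x / F x‖ ^ 2 ≤ ‖g x‖ ^ 2 := fun x =>
    norm_sq_mul_norm_div_sq_le _ _
  have hi : Integrable (fun x => ‖F x‖ ^ 2 • ‖g x / F x‖ ^ 2) (leb Ω) :=
    hint.mono' ((hF.norm.pow 2).aestronglyMeasurable.smul (hm.norm.pow 2))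
      (ae_of_all _ fun x => by
        rw [Real.norm_of_nonneg (by positivity)]
        exact hle x)
  have hmem : MemLp (fun x => g x / F x) 2 (sqMeasure F) :=
    (memLp_two_iff_integrable_sq_norm (hm.mono_ac hac)).2 ((integrable_sqMeasure_iff hF).2 hi)
  refine ⟨hmem.toLp _, ?_, hmem.coeFn_toLp⟩
  refine (sq_le_sq₀ (norm_nonneg _) (norm_nonneg _)).1 ?_
  rw [norm_sq_eq_integral, norm_sq_eq_integral]
  calc ∫ x, ‖hmem.toLp _ x‖ ^ 2 ∂(sqMeasure F) = ∫ x, ‖g x / F x‖ ^ 2 ∂(sqMeasure F) :=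
        integral_congr_ae (hmem.coeFn_toLp.mono fun x hx => by simp only [hx])
    _ = ∫ x, ‖F x‖ ^ 2 • ‖g x / F x‖ ^ 2 ∂(leb Ω) := integral_sqMeasure hF _
    _ ≤ ∫ x, ‖g x‖ ^ 2 ∂(leb Ω) := integral_mono hi hint hle

theorem norm_sq_mul_conj_div_mul (a b c : ℂ) :
    (‖b‖ ^ 2 : ℝ) • (conj (a / b) * c) = b * conj a * c := by
  by_cases hb : b = 0
  · simp [hb]
  · rw [Complex.real_smul, Complex.ofReal_pow, ← Complex.mul_conj', map_div₀]
    have : conj b ≠ 0 := by simpa using hb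
    field_simp

/-- A rank one functional is a pairing in `L²(|F|²μ)`. -/
theorem exists_inner_toL2_eq_of_rankOne (hΩ : IsOpen Ω) {f g : Lp ℂ 2 (leb Ω)} {F : Ω → ℂ}
    (hF : Continuous F) (hfF : ⇑f =ᵐ[leb Ω] F) [IsFiniteMeasure (sqMeasure F)] :
    ∃ G : Lp ℂ 2 (sqMeasure F), ‖G‖ ≤ ‖g‖ ∧ ∀ ψ : UnitBall A,
      inner ℂ G (toL2 (sqMeasure F) ψ.fn) = rankOne A f g ψ := by
  obtain ⟨G, hG, hGg⟩ := exists_quotient_sqMeasure hF g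
  refine ⟨G, hG, fun ψ => ?_⟩
  rw [rankOne_apply hΩ, L2.inner_def]
  calc ∫ x, inner ℂ (G x) (toL2 (sqMeasure F) ψ.fn x) ∂(sqMeasure F)
      = ∫ x, conj (g x / F x) * (ψ.fn : Ω → ℂ) x ∂(sqMeasure F) := by
        refine integral_congr_ae ?_
        filter_upwards [hGg, coeFn_toL2 (sqMeasure F) ψ.fn] with x h1 h2
        rw [h1, h2, RCLike.inner_apply, mul_comm]
    _ = ∫ x, ‖F x‖ ^ 2 • (conj (g x / F x) * (ψ.fn : Ω → ℂ) x) ∂(leb Ω) :=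
        integral_sqMeasure hF _
    _ = ∫ x, f x * conj (g x) * (ψ.fn : Ω → ℂ) x ∂(leb Ω) := by
        refine integral_congr_ae (hfF.mono fun x hx => ?_)
        simp only [hx, norm_sq_mul_conj_div_mul]

theorem norm_toL2_one_sqMeasure {f : Lp ℂ 2 (leb Ω)} {F : Ω → ℂ}
    (hF : Continuous F) (hfF : ⇑f =ᵐ[leb Ω] F) [IsFiniteMeasure (sqMeasure F)] :
    ‖toL2 (sqMeasure F) 1‖ = ‖f‖ := by
  refine (sq_eq_sq₀ (norm_nonneg _) (norm_nonneg _)).1 ?_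
  rw [norm_sq_eq_integral, norm_sq_eq_integral]
  calc ∫ x, ‖toL2 (sqMeasure F) 1 x‖ ^ 2 ∂(sqMeasure F) = ∫ _, (1 : ℝ) ∂(sqMeasure F) := by
        refine integral_congr_ae ((coeFn_toL2 (sqMeasure F) 1).mono fun x hx => ?_)
        simp only [hx]
        simp
    _ = ∫ x, ‖F x‖ ^ 2 • (1 : ℝ) ∂(leb Ω) := integral_sqMeasure hF _
    _ = ∫ x, ‖f x‖ ^ 2 ∂(leb Ω) :=
        integral_congr_ae (hfF.mono fun x hx => by simp [hx])

variable {n : ℕ} {z : Fin n → Ω} {w : Fin n → ℂ}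

theorem inner_toL2_eq_sum_of_unitBall {ν : Measure Ω} [IsFiniteMeasure ν] {G : Lp ℂ 2 ν}
    {c : Fin n → ℂ} (h : ∀ ψ : UnitBall A, inner ℂ G (toL2 ν ψ.fn) = (∑ i, c i • ev A (z i)) ψ)
    {φ : HInfty Ω} (hφ : φ ∈ A) : inner ℂ G (toL2 ν φ) = ∑ i, c i * (φ : Ω → ℂ) (z i) := by
  obtain ⟨C, ψ, -, rfl⟩ := exists_unitBall_smul hφ
  rw [map_smul, inner_smul_right, h, BoundedContinuousFunction.sum_apply, Finset.mul_sum]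
  refine Finset.sum_congr rfl fun i _ => ?_
  change (C : ℂ) * (c i * (ψ.fn : Ω → ℂ) (z i)) = c i * ((C : ℂ) * (ψ.fn : Ω → ℂ) (z i))
  ring

theorem norm_sum_mul_le_one (hΩ : IsOpen Ω) (hc : IsConnected Ω) (hb : Bornology.IsBounded Ω)
    (hA : IsClosed[weakStar Ω] (A : Set (HInfty Ω)))
    (H : ∀ f : Ω → ℂ, MemBergman Ω f → (Matrix.of fun i j : Fin n => (1 - w i * conj (w j)) *
      kernel A (sqMeasure f) (z i) (z j)).PosSemidef)
    {c : Fin n → ℂ} (hy : ‖∑ i, c i • ev A (z i)‖ ≤ 1) : ‖∑ i, c i * w i‖ ≤ 1 := by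
  have hfin := isFiniteMeasure_leb hΩ hb
  have H₁ := H (fun _ => 1) ⟨holo_const 1, memLp_const 1⟩
  rw [sqMeasure_one] at H₁
  rcases isEmpty_or_nonempty (Fin d) with hd | ⟨⟨i₀⟩⟩
  · have hsub : ∀ x y : Ω, x = y := fun x y => Subsingleton.elim _ _
    obtain ⟨p, hp⟩ := hc.nonempty
    obtain ⟨r, hr, -, C, hC, hCb⟩ := exists_norm_le_mul_eLpNorm hΩ hb hp
    set e := toL2 (leb Ω) 1 with he
    have he0 : ‖e‖ ≠ 0 := fun h => by
      have h1 := hCb _ ⟨(1 : HInfty Ω).2.1, memLp_HInfty (leb Ω) 1⟩ ⟨p, hp⟩ (mem_ball_self hr)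
      rw [← norm_toL2, ← he, h] at h1
      norm_num at h1
    have hs : ‖∑ i, c i‖ ≤ 1 := by
      have h1 := (∑ i, c i • ev A (z i)).norm_coe_le_norm
        ⟨1, A.one_mem, fun x => by simp⟩
      rw [BoundedContinuousFunction.sum_apply] at h1
      refine le_trans (le_of_eq ?_) (h1.trans hy)
      congr 1
      exact Finset.sum_congr rfl fun i _ => (mul_one _).symm
    have h := norm_sum_mul_le_of_posSemidef hΩ hb H₁ H₁ (c := c)
      (G := (conj (∑ i, c i) * ((‖e‖ : ℂ) ^ 2)⁻¹) • e) fun φ _ => by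
        have hφ : φ = (φ : Ω → ℂ) ⟨p, hp⟩ • (1 : HInfty Ω) := by
          ext x
          rw [hsub x ⟨p, hp⟩]
          exact (mul_one _).symm
        have hsum : ∑ i, c i * (φ : Ω → ℂ) (z i) = (∑ i, c i) * (φ : Ω → ℂ) ⟨p, hp⟩ := by
          rw [Finset.sum_mul]
          exact Finset.sum_congr rfl fun i _ => by rw [hsub (z i) ⟨p, hp⟩]
        rw [hsum]
        conv_lhs => rw [hφ, map_smul, ← he, inner_smul_left, inner_smul_right,
          inner_self_eq_norm_sq_to_K]
        have : (‖e‖ : ℂ) ≠ 0 := by exact_mod_cast he0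
        simp
        field_simp
    refine h.trans (le_trans (le_of_eq ?_) hs)
    rw [norm_smul, norm_mul, ← he, RCLike.norm_conj, norm_inv, norm_pow,
      Complex.norm_real, norm_norm]
    field_simp
  · refine le_of_forall_pos_le_add fun δ hδ => ?_
    set ε : ℝ := min 1 (δ / 3) with hε
    have hε0 : 0 < ε := lt_min one_pos (by positivity)
    have hε1 : ε ≤ 1 := min_le_left _ _
    have hεδ : ε ≤ δ / 3 := min_le_right _ _
    obtain ⟨f, ⟨F, hF, hfF⟩, g, -, hf1, hg1, hfg⟩ := exists_rankOne_eq hΩ hb hA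
      (evSq_mem_energyApprox_one hΩ hc hb i₀)
      (sum_mem fun i _ => Submodule.smul_mem _ _ (ev_mem_predual (A := A) (z i))) hy hε0
    have hFB := memBergman_of_ae hF hfF
    have := isFiniteMeasure_sqMeasure hFB.2
    obtain ⟨G, hGg, hG⟩ := exists_inner_toL2_eq_of_rankOne (A := A) (g := g) hΩ hF.continuous hfF
    have h := norm_sum_mul_le_of_posSemidef hΩ hb H₁ (H F hFB) (c := c) (G := G)
      fun φ hφ => inner_toL2_eq_sum_of_unitBall (fun ψ => by rw [hG, hfg]) hφ
    rw [norm_toL2_one_sqMeasure hF.continuous hfF] at h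
    have h2 : ‖G‖ * ‖f‖ ≤ (1 + ε) * (1 + ε) :=
      mul_le_mul (hGg.trans hg1) hf1 (norm_nonneg _) (by positivity)
    nlinarith

theorem norm_sum_mul_le_norm_sum_ev (hΩ : IsOpen Ω) (hc : IsConnected Ω)
    (hb : Bornology.IsBounded Ω) (hA : IsClosed[weakStar Ω] (A : Set (HInfty Ω)))
    (H : ∀ f : Ω → ℂ, MemBergman Ω f → (Matrix.of fun i j : Fin n => (1 - w i * conj (w j)) *
      kernel A (sqMeasure f) (z i) (z j)).PosSemidef)
    (c : Fin n → ℂ) : ‖∑ i, c i * w i‖ ≤ ‖∑ i, c i • ev A (z i)‖ := by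
  refine le_of_forall_pos_le_add fun δ hδ => ?_
  set t : ℝ := ‖∑ i, c i • ev A (z i)‖ + δ with ht
  have ht0 : 0 < t := by positivity
  have hn : ‖((t : ℂ)⁻¹)‖ = t⁻¹ := by
    rw [norm_inv, Complex.norm_real, Real.norm_of_nonneg ht0.le]
  have h := norm_sum_mul_le_one (c := fun i => (t : ℂ)⁻¹ * c i) hΩ hc hb hA H (by
    simp only [mul_smul]
    rw [← Finset.smul_sum, norm_smul, hn, inv_mul_le_one₀ ht0]
    linarith)
  simp only [mul_assoc] at h
  rwa [← Finset.mul_sum, norm_mul, hn, inv_mul_le_one₀ ht0] at h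

theorem exists_interpolating_of_posSemidef (hΩ : IsOpen Ω) (hc : IsConnected Ω)
    (hb : Bornology.IsBounded Ω) (hA : IsClosed[weakStar Ω] (A : Set (HInfty Ω)))
    (H : ∀ f : Ω → ℂ, MemBergman Ω f → (Matrix.of fun i j : Fin n => (1 - w i * conj (w j)) *
      kernel A (sqMeasure f) (z i) (z j)).PosSemidef) :
    ∃ φ ∈ A, (∀ x : Ω, ‖(φ : Ω → ℂ) x‖ ≤ 1) ∧ ∀ i, (φ : Ω → ℂ) (z i) = w i := by
  obtain ⟨Λ, hΛ1, hΛ⟩ := exists_clm_comp_eq (Fintype.linearCombination ℂ fun i => ev A (z i))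
    (Fintype.linearCombination ℂ w) zero_le_one fun c => by
      simpa [Fintype.linearCombination_apply] using
        norm_sum_mul_le_norm_sum_ev hΩ hc hb hA H c
  obtain ⟨φ, hφ, hφΛ⟩ := exists_mem_forall_eq_comp_ev hΩ hA Λ
  refine ⟨φ, hφ, fun x => ?_, fun i => ?_⟩
  · rw [hφΛ]
    exact (norm_comp_ev_le A Λ x).trans hΛ1
  · classical
    have := hΛ (Pi.single i 1)
    simpa [Fintype.linearCombination_apply_single, hφΛ] using this

end Factorization

end BergmanPick
end

theorem theorem1p2 {d n : ℕ} (Ω : Set (Fin d → ℂ)) (hΩ_open : IsOpen Ω)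
    (hΩ_conn : IsConnected Ω) (hΩ_bdd : Bornology.IsBounded Ω)
    (A : Subalgebra ℂ (BergmanPick.HInfty Ω))
    (hA : IsClosed[BergmanPick.weakStar Ω] (A : Set (BergmanPick.HInfty Ω)))
    (z : Fin n → Ω) (w : Fin n → ℂ) :
    (∃ φ ∈ A, (∀ x : Ω, ‖(φ : Ω → ℂ) x‖ ≤ 1) ∧ ∀ i, (φ : Ω → ℂ) (z i) = w i) ↔
      ∀ f : Ω → ℂ, BergmanPick.MemBergman Ω f →
        (Matrix.of fun i j : Fin n =>
          (1 - w i * conj (w j)) *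
            BergmanPick.kernel A (BergmanPick.sqMeasure f) (z i) (z j)).PosSemidef := by
  constructor
  · rintro ⟨φ, hφ, hφ1, hφw⟩ f hf
    have := BergmanPick.isFiniteMeasure_sqMeasure hf.2
    simpa only [hφw] using
      BergmanPick.posSemidef_of_interpolates (ν := BergmanPick.sqMeasure f) z hφ hφ1
  · exact BergmanPick.exists_interpolating_of_posSemidef hΩ_open hΩ_conn hΩ_bdd hA
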